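/- Let $k$ be a field and let $H=(H,\Delta,\varepsilon,\Phi,S,\alpha,\beta)$ be a finite-dimensional quasi-Hopf algebra over $k$: $H$ is a unital associative algebra, $\Delta:H\to H\otimes H$ and $\varepsilon:H\to k$ are algebra maps, $\Phi\in H^{\otimes 3}$ is invertible with $(id\otimes\Delta)\Delta(h)=\Phi\,(\Delta\otimes id)\Delta(h)\,\Phi^{-1}$, $(id\otimes\varepsilon)\Delta(h)=h\otimes 1$, $(\varepsilon\otimes id)\Delta(h)=1\otimes h$, $(1\otimes\Phi)(id\otimes\Delta\otimes id)(\Phi)(\Phi\otimes1)=(id\otimes id\otimes\Delta)(\Phi)(\Delta\otimes id\otimes id)(\Phi)$, $(id\otimes\varepsilon\otimes id)(\Phi)=1\otimes1\otimes1$; $S$ is a $k$-linear (unital) anti-endomorphism of the algebra $H$, not assumed bijective, and $\alpha,\beta\in H$; writing $\Phi=X^1\otimes X^2\otimes X^3$, $\Phi^{-1}=x^1\otimes x^2\otimes x^3$ and $\Delta(h)=h_1\otimes h_2$ (summation understood), $S(h_1)\alpha h_2=\varepsilon(h)\alpha$, $h_1\beta S(h_2)=\varepsilon(h)\beta$, $X^1\beta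 S(X^2)\alpha X^3=1=S(x^1)\alpha x^2\beta S(x^3)$. Let $H$ be quasi-triangular with $R$-matrix $R=R^1\otimes R^2\in H\otimes H$ (not assumed invertible), i.e. with $\Phi_{132}=X^1\otimes X^3\otimes X^2$, $\Phi_{213}=X^2\otimes X^1\otimes X^3$, $\Phi_{312}=X^2\otimes X^3\otimes X^1$, $\Phi_{231}=X^3\otimes X^1\otimes X^2$ and likewise for $\Phi^{-1}$, $$(\Delta\otimes id)(R)=\Phi_{312}R_{13}\Phi^{-1}_{132}R_{23}\Phi,\qquad (id\otimes\Delta)(R)=\Phi^{-1}_{231}R_{13}\Phi_{213}R_{12}\Phi^{-1},$$ $\Delta^{op}(h)R=R\Delta(h)$ for all $h\in H$, and $(\varepsilon\otimes id)(R)=(id\otimes\varepsilon)(R)=1$. Put $A^1\otimes A^2\otimes A^3\otimes A^4=(\Phi\otimes1)(\Delta\otimes id\otimes id)(\Phi^{-1})$, $B^1\otimes B^2\otimes B^3\otimes B^4=(\Delta\otimes id\otimes id)(\Phi)(\Phi^{-1}\otimes1)$, $\gamma=S(A^2)\alpha A^3\otimes S(A^1)\alpha A^4$, $\delta=B^1\beta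 S(B^4)\otimes B^2\beta S(B^3)$, $$f=f^1\otimes f^2=(S\otimes S)(\Delta^{op}(x^1))\,\gamma\,\Delta(x^2\beta S(x^3)),\qquad f^{-1}=g^1\otimes g^2=\Delta(S(x^1)\alpha x^2)\,\delta\,(S\otimes S)(\Delta^{op}(x^3)),$$ $$p_R=p^1\otimes p^2=x^1\otimes x^2\beta S(x^3),\qquad q_R=q^1\otimes q^2=X^1\otimes S^{-1}(\alpha X^3)X^2,$$ $$p_L=\tilde p^1\otimes\tilde p^2=X^2S^{-1}(X^1\beta)\otimes X^3,\qquad U=g^1S(q^2)\otimes g^2S(q^1),\qquad u=S(R^2p^2)\alpha R^1p^1.$$ Let $P^1\otimes P^2$ and $Q^1\otimes Q^2$ be further copies of $p_R$ and $q_R$, and $r^1\otimes r^2$ a further copy of $R$. A left (right) integral in $H$ is $t\in H$ with $ht=\varepsilon(h)t$ ($th=\varepsilon(h)t$) for all $h\in H$; $H$ is unimodular if it has a non-zero left integral that is also a right integral. The distinguished group-like element is the $\mu\in H^*$ with $th=\mu(h)t$ for all left integrals $t$ and all $h\in H$. For $h\in H$ put $h\leftharpoonup\mu=\mu(h_1)h_2$.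 $(H,R)$ is called factorizable if the map $$\mathcal Q:H^*\to H,\qquad \mathcal Q(\chi)=\chi\big(S(X^2_2\tilde p^2)f^1R^2r^1U^1X^3\big)\,X^1S(X^2_1\tilde p^1)f^2R^1r^2U^2$$ is bijective. Then $S$ is bijective (so that $S^{-1}$ above makes sense), and: 1) if $\mu$ is the distinguished group-like element of $H^*$, then for every left integral $t$ in $H$ $$\mu(Q^1)\,q^2t_2p^2\,S\big(Q^2(R^2P^2\leftharpoonup\mu)\big)R^1P^1\otimes q^1t_1p^1=S(u)\,q^1t_1p^1\otimes q^2t_2p^2 ;$$ 2) if $(H,R)$ is factorizable, then $H$ is unimodular. -/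

import Mathlib

open scoped TensorProduct

noncomputable section

namespace QuasiHopf

section Aux

variable {k H : Type*} [Field k] [Ring H] [Algebra k H]

/-- The linear map `a ⊗ b ↦ S(a) α b`. -/
def evMap (S : H →ₗ[k] H) (α : H) : H ⊗[k] H →ₗ[k] H :=
  LinearMap.mul' k H ∘ₗ TensorProduct.map (LinearMap.mulRight k α ∘ₗ S) LinearMap.id

/-- The linear map `a ⊗ b ↦ a β S(b)`. -/
def coevMap (S : H →ₗ[k] H) (β : H) : H ⊗[k] H →ₗ[k] H :=
  LinearMap.mul' k H ∘ₗ TensorProduct.map (LinearMap.mulRight k β) S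

/-- The flip `a ⊗ b ↦ b ⊗ a`. -/
def flip₂ : H ⊗[k] H →ₐ[k] H ⊗[k] H :=
  (Algebra.TensorProduct.comm k H H).toAlgHom

/-- Reassociation `(a ⊗ b) ⊗ c ↦ a ⊗ (b ⊗ c)`, for algebras. -/
def assocHom (A B C : Type*) [Ring A] [Algebra k A] [Ring B] [Algebra k B] [Ring C]
    [Algebra k C] : (A ⊗[k] B) ⊗[k] C →ₐ[k] A ⊗[k] (B ⊗[k] C) :=
  (Algebra.TensorProduct.assoc k k k A B C).toAlgHom

/-- Reassociation `a ⊗ (b ⊗ c) ↦ (a ⊗ b) ⊗ c`, for algebras. -/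
def assocInvHom (A B C : Type*) [Ring A] [Algebra k A] [Ring B] [Algebra k B] [Ring C]
    [Algebra k C] : A ⊗[k] (B ⊗[k] C) →ₐ[k] (A ⊗[k] B) ⊗[k] C :=
  (Algebra.TensorProduct.assoc k k k A B C).symm.toAlgHom

/-- `a ⊗ b ↦ a ⊗ b ⊗ 1`, so that `R ↦ R₁₂`. -/
def place12 : H ⊗[k] H →ₐ[k] H ⊗[k] (H ⊗[k] H) :=
  Algebra.TensorProduct.map (AlgHom.id k H) Algebra.TensorProduct.includeLeft

/-- `a ⊗ b ↦ a ⊗ 1 ⊗ b`, so that `R ↦ R₁₃`. -/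
def place13 : H ⊗[k] H →ₐ[k] H ⊗[k] (H ⊗[k] H) :=
  Algebra.TensorProduct.map (AlgHom.id k H) Algebra.TensorProduct.includeRight

/-- `a ⊗ b ↦ 1 ⊗ a ⊗ b`, so that `R ↦ R₂₃`. -/
def place23 : H ⊗[k] H →ₐ[k] H ⊗[k] (H ⊗[k] H) :=
  Algebra.TensorProduct.includeRight

/-- `X¹ ⊗ X² ⊗ X³ ↦ X¹ ⊗ X³ ⊗ X²`, so that `Φ ↦ Φ₁₃₂`. -/
def perm132 : H ⊗[k] (H ⊗[k] H) →ₐ[k] H ⊗[k] (H ⊗[k] H) :=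
  Algebra.TensorProduct.map (AlgHom.id k H) flip₂

/-- `X¹ ⊗ X² ⊗ X³ ↦ X² ⊗ X³ ⊗ X¹`, so that `Φ ↦ Φ₃₁₂`. -/
def perm312 : H ⊗[k] (H ⊗[k] H) →ₐ[k] H ⊗[k] (H ⊗[k] H) :=
  (assocHom H H H).comp (Algebra.TensorProduct.comm k H (H ⊗[k] H)).toAlgHom

/-- `X¹ ⊗ X² ⊗ X³ ↦ X³ ⊗ X¹ ⊗ X²`, so that `Φ ↦ Φ₂₃₁`. -/
def perm231 : H ⊗[k] (H ⊗[k] H) →ₐ[k] H ⊗[k] (H ⊗[k] H) :=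
  (Algebra.TensorProduct.comm k (H ⊗[k] H) H).toAlgHom.comp (assocInvHom H H H)

/-- `X¹ ⊗ X² ⊗ X³ ↦ X² ⊗ X¹ ⊗ X³`, so that `Φ ↦ Φ₂₁₃`. -/
def perm213 : H ⊗[k] (H ⊗[k] H) →ₐ[k] H ⊗[k] (H ⊗[k] H) :=
  (perm132.comp perm312 : H ⊗[k] (H ⊗[k] H) →ₐ[k] H ⊗[k] (H ⊗[k] H))

end Aux

/-- A quasi-bialgebra structure on the unital associative `k`-algebra `H`. Threefold and fourfold
tensor powers are bracketed to the right. -/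
structure QuasiBialgebra (k H : Type*) [Field k] [Ring H] [Algebra k H] where
  /-- The comultiplication `Δ`. -/
  comul : H →ₐ[k] H ⊗[k] H
  /-- The counit `ε`. -/
  counit : H →ₐ[k] k
  /-- The reassociator `Φ`. -/
  Φ : (H ⊗[k] (H ⊗[k] H))ˣ
  /-- `(id ⊗ Δ)(Δ(h)) = Φ (Δ ⊗ id)(Δ(h)) Φ⁻¹`. -/
  quasi_coassoc : ∀ h : H,
    Algebra.TensorProduct.map (AlgHom.id k H) comul (comul h) =
      (Φ : H ⊗[k] (H ⊗[k] H)) *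
        assocHom H H H (Algebra.TensorProduct.map comul (AlgHom.id k H) (comul h)) *
        (↑Φ⁻¹ : H ⊗[k] (H ⊗[k] H))
  /-- `(id ⊗ ε)(Δ(h)) = h ⊗ 1`. -/
  counit_right : ∀ h : H,
    Algebra.TensorProduct.map (AlgHom.id k H) counit (comul h) = h ⊗ₜ[k] (1 : k)
  /-- `(ε ⊗ id)(Δ(h)) = 1 ⊗ h`. -/
  counit_left : ∀ h : H,
    Algebra.TensorProduct.map counit (AlgHom.id k H) (comul h) = (1 : k) ⊗ₜ[k] h
  /-- `(1 ⊗ Φ)(id ⊗ Δ ⊗ id)(Φ)(Φ ⊗ 1) = (id ⊗ id ⊗ Δ)(Φ)(Δ ⊗ id ⊗ id)(Φ)`. -/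
  cocycle :
    ((1 : H) ⊗ₜ[k] (Φ : H ⊗[k] (H ⊗[k] H)) : H ⊗[k] (H ⊗[k] (H ⊗[k] H))) *
        Algebra.TensorProduct.map (AlgHom.id k H)
          ((assocHom H H H).comp (Algebra.TensorProduct.map comul (AlgHom.id k H)))
          (Φ : H ⊗[k] (H ⊗[k] H)) *
        Algebra.TensorProduct.map (AlgHom.id k H) place12 (Φ : H ⊗[k] (H ⊗[k] H)) =
      Algebra.TensorProduct.map (AlgHom.id k H)
          (Algebra.TensorProduct.map (AlgHom.id k H) comul) (Φ : H ⊗[k] (H ⊗[k] H)) *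
        assocHom H H (H ⊗[k] H)
          (Algebra.TensorProduct.map comul (AlgHom.id k (H ⊗[k] H)) (Φ : H ⊗[k] (H ⊗[k] H)))
  /-- `(id ⊗ ε ⊗ id)(Φ) = 1 ⊗ 1 ⊗ 1`. -/
  counit_Φ :
    Algebra.TensorProduct.map (AlgHom.id k H)
        (Algebra.TensorProduct.map counit (AlgHom.id k H)) (Φ : H ⊗[k] (H ⊗[k] H)) =
      (1 : H) ⊗ₜ[k] ((1 : k) ⊗ₜ[k] (1 : H))

/-- A quasi-Hopf algebra structure on `H`. Bijectivity of the antipode is not required. -/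
structure QuasiHopfAlgebra (k H : Type*) [Field k] [Ring H] [Algebra k H] extends
    QuasiBialgebra k H where
  /-- The antipode. -/
  S : H →ₗ[k] H
  /-- The element `α`. -/
  α : H
  /-- The element `β`. -/
  β : H
  S_one : S 1 = 1
  S_mul : ∀ a b : H, S (a * b) = S b * S a
  /-- `S(h₁) α h₂ = ε(h) α`. -/
  antipode_left : ∀ h : H, evMap S α (comul h) = counit h • α
  /-- `h₁ β S(h₂) = ε(h) β`. -/
  antipode_right : ∀ h : H, coevMap S β (comul h) = counit h • β
  /-- `X¹ β S(X²) α X³ = 1`. -/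
  antipode_Φ :
    LinearMap.mul' k H (TensorProduct.map (LinearMap.mulRight k β) (evMap S α)
      (Φ : H ⊗[k] (H ⊗[k] H))) = 1
  /-- `S(x¹) α x² β S(x³) = 1`. -/
  antipode_Φ_inv :
    LinearMap.mul' k H (TensorProduct.map (LinearMap.mulRight k α ∘ₗ S) (coevMap S β)
      (↑Φ⁻¹ : H ⊗[k] (H ⊗[k] H))) = 1

namespace QuasiHopfAlgebra

variable {k H : Type*} [Field k] [Ring H] [Algebra k H] (A : QuasiHopfAlgebra k H)

open Classical in
/-- The inverse `S⁻¹` of the antipode (with the value `0` if `S` is not bijective). -/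
def Sinv : H →ₗ[k] H :=
  if h : Function.Bijective A.S then ((LinearEquiv.ofBijective A.S h).symm : H →ₗ[k] H) else 0

/-- `S ⊗ S`. -/
def SS : H ⊗[k] H →ₗ[k] H ⊗[k] H := TensorProduct.map A.S A.S

/-- `a ⊗ b ↦ S(b) ⊗ S(a)`. -/
def SSop : H ⊗[k] H →ₗ[k] H ⊗[k] H := A.SS ∘ₗ (flip₂ : H ⊗[k] H →ₐ[k] H ⊗[k] H).toLinearMap

/-- `Δ ⊗ id ⊗ id` on `H ⊗ H ⊗ H`. -/
def comulFirst : H ⊗[k] (H ⊗[k] H) →ₐ[k] H ⊗[k] (H ⊗[k] (H ⊗[k] H)) :=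
  (assocHom H H (H ⊗[k] H)).comp (Algebra.TensorProduct.map A.comul (AlgHom.id k (H ⊗[k] H)))

/-- `A¹ ⊗ A² ⊗ A³ ⊗ A⁴ = (Φ ⊗ 1)(Δ ⊗ id ⊗ id)(Φ⁻¹)`. -/
def elemA : H ⊗[k] (H ⊗[k] (H ⊗[k] H)) :=
  Algebra.TensorProduct.map (AlgHom.id k H) place12 (A.Φ : H ⊗[k] (H ⊗[k] H)) *
    A.comulFirst (↑A.Φ⁻¹ : H ⊗[k] (H ⊗[k] H))

/-- `B¹ ⊗ B² ⊗ B³ ⊗ B⁴ = (Δ ⊗ id ⊗ id)(Φ)(Φ⁻¹ ⊗ 1)`. -/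
def elemB : H ⊗[k] (H ⊗[k] (H ⊗[k] H)) :=
  A.comulFirst (A.Φ : H ⊗[k] (H ⊗[k] H)) *
    Algebra.TensorProduct.map (AlgHom.id k H) place12 (↑A.Φ⁻¹ : H ⊗[k] (H ⊗[k] H))

/-- `γ = S(A²) α A³ ⊗ S(A¹) α A⁴`. -/
def γ : H ⊗[k] H :=
  LinearMap.mul' k (H ⊗[k] H)
    (TensorProduct.map (LinearMap.mulRight k (A.α ⊗ₜ[k] A.α) ∘ₗ A.SSop) LinearMap.id
      (assocInvHom H H (H ⊗[k] H) A.elemA))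

/-- `δ = B¹ β S(B⁴) ⊗ B² β S(B³)`. -/
def δ : H ⊗[k] H :=
  LinearMap.mul' k (H ⊗[k] H)
    (TensorProduct.map (LinearMap.mulRight k (A.β ⊗ₜ[k] A.β)) A.SSop
      (assocInvHom H H (H ⊗[k] H) A.elemB))

/-- The Drinfeld twist `f = (S ⊗ S)(Δᵒᵖ(x¹)) γ Δ(x² β S(x³))`. -/
def f : H ⊗[k] H :=
  LinearMap.mul' k (H ⊗[k] H)
    (TensorProduct.map (LinearMap.mulRight k A.γ ∘ₗ A.SSop ∘ₗ A.comul.toLinearMap)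
      (A.comul.toLinearMap ∘ₗ coevMap A.S A.β) (↑A.Φ⁻¹ : H ⊗[k] (H ⊗[k] H)))

/-- The inverse twist `f⁻¹ = g¹ ⊗ g² = Δ(S(x¹) α x²) δ (S ⊗ S)(Δᵒᵖ(x³))`. -/
def fInv : H ⊗[k] H :=
  LinearMap.mul' k (H ⊗[k] H)
    (TensorProduct.map
      (LinearMap.mulRight k A.δ ∘ₗ A.comul.toLinearMap ∘ₗ evMap A.S A.α)
      (A.SSop ∘ₗ A.comul.toLinearMap)
      (assocInvHom H H H (↑A.Φ⁻¹ : H ⊗[k] (H ⊗[k] H))))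

/-- `p_R = x¹ ⊗ x² β S(x³)`. -/
def pR : H ⊗[k] H :=
  TensorProduct.map LinearMap.id (coevMap A.S A.β) (↑A.Φ⁻¹ : H ⊗[k] (H ⊗[k] H))

/-- `q_R = X¹ ⊗ S⁻¹(α X³) X²`. -/
def qR : H ⊗[k] H :=
  TensorProduct.map LinearMap.id
    (LinearMap.mul' k H ∘ₗ
      TensorProduct.map (A.Sinv ∘ₗ LinearMap.mulLeft k A.α) LinearMap.id ∘ₗ
      (flip₂ : H ⊗[k] H →ₐ[k] H ⊗[k] H).toLinearMap)
    (A.Φ : H ⊗[k] (H ⊗[k] H))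

/-- `p_L = X² S⁻¹(X¹ β) ⊗ X³`. -/
def pL : H ⊗[k] H :=
  TensorProduct.map
    (LinearMap.mul' k H ∘ₗ
      TensorProduct.map LinearMap.id (A.Sinv ∘ₗ LinearMap.mulRight k A.β) ∘ₗ
      (flip₂ : H ⊗[k] H →ₐ[k] H ⊗[k] H).toLinearMap)
    LinearMap.id
    (assocInvHom H H H (A.Φ : H ⊗[k] (H ⊗[k] H)))

/-- `U = g¹ S(q²) ⊗ g² S(q¹)`, where `f⁻¹ = g¹ ⊗ g²` and `q_R = q¹ ⊗ q²`. -/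
def U : H ⊗[k] H := A.fInv * A.SSop A.qR

/-- `R` is an `R`-matrix for the quasi-Hopf algebra. Invertibility of `R` is not required. -/
structure IsRMatrix (R : H ⊗[k] H) : Prop where
  /-- `(Δ ⊗ id)(R) = Φ₃₁₂ R₁₃ (Φ⁻¹)₁₃₂ R₂₃ Φ`. -/
  comul_left :
    assocHom H H H (Algebra.TensorProduct.map A.comul (AlgHom.id k H) R) =
      perm312 (A.Φ : H ⊗[k] (H ⊗[k] H)) * place13 R *
        perm132 (↑A.Φ⁻¹ : H ⊗[k] (H ⊗[k] H)) * place23 R * (A.Φ : H ⊗[k] (H ⊗[k] H))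
  /-- `(id ⊗ Δ)(R) = (Φ⁻¹)₂₃₁ R₁₃ Φ₂₁₃ R₁₂ Φ⁻¹`. -/
  comul_right :
    Algebra.TensorProduct.map (AlgHom.id k H) A.comul R =
      perm231 (↑A.Φ⁻¹ : H ⊗[k] (H ⊗[k] H)) * place13 R *
        perm213 (A.Φ : H ⊗[k] (H ⊗[k] H)) * place12 R * (↑A.Φ⁻¹ : H ⊗[k] (H ⊗[k] H))
  /-- `Δᵒᵖ(h) R = R Δ(h)`. -/
  intertwine : ∀ h : H, flip₂ (A.comul h) * R = R * A.comul h
  /-- `(ε ⊗ id)(R) = 1`. -/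
  counit_left : Algebra.TensorProduct.map A.counit (AlgHom.id k H) R = (1 : k) ⊗ₜ[k] (1 : H)
  /-- `(id ⊗ ε)(R) = 1`. -/
  counit_right : Algebra.TensorProduct.map (AlgHom.id k H) A.counit R = (1 : H) ⊗ₜ[k] (1 : k)

/-- The Drinfeld element `u = S(R² p²) α R¹ p¹`, where `p_R = p¹ ⊗ p²`. -/
def drinfeldElement (R : H ⊗[k] H) : H := evMap A.S A.α (flip₂ (R * A.pR))

/-- With `p_L = p̃¹ ⊗ p̃²` and `r¹ ⊗ r²` a second copy of `R`, the element
`X¹ S(X²₁ p̃¹) f² R¹ r² U² ⊗ S(X²₂ p̃²) f¹ R² r¹ U¹ X³`, written as the image of `Φ` under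
`x ⊗ y ⊗ z ↦ (x ⊗ 1) (S ⊗ S)(Δ(y) p_L) (f₂₁ R r₂₁ U₂₁) (1 ⊗ z)`. -/
def QElement (R : H ⊗[k] H) : H ⊗[k] H :=
  LinearMap.mul' k (H ⊗[k] H)
    (TensorProduct.map
      (Algebra.TensorProduct.includeLeft : H →ₐ[k] H ⊗[k] H).toLinearMap
      (LinearMap.mul' k (H ⊗[k] H) ∘ₗ
        TensorProduct.map
          (LinearMap.mulRight k (flip₂ A.f * R * flip₂ R * flip₂ A.U) ∘ₗ A.SS ∘ₗ
            LinearMap.mulRight k A.pL ∘ₗ A.comul.toLinearMap)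
          (Algebra.TensorProduct.includeRight : H →ₐ[k] H ⊗[k] H).toLinearMap)
      (A.Φ : H ⊗[k] (H ⊗[k] H)))

/-- The map `𝒬 : H* → H`,
`𝒬(χ) = χ(S(X²₂ p̃²) f¹ R² r¹ U¹ X³) X¹ S(X²₁ p̃¹) f² R¹ r² U²`. -/
def QMap (R : H ⊗[k] H) (χ : Module.Dual k H) : H :=
  TensorProduct.rid k H (TensorProduct.map LinearMap.id χ (A.QElement R))

/-- `(H, R)` is factorizable if `𝒬` is bijective. -/
def IsFactorizable (R : H ⊗[k] H) : Prop := Function.Bijective (A.QMap R)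

/-- Left integrals: `h t = ε(h) t` for all `h`. -/
def IsLeftIntegral (t : H) : Prop := ∀ h : H, h * t = A.counit h • t

/-- Right integrals: `t h = ε(h) t` for all `h`. -/
def IsRightIntegral (t : H) : Prop := ∀ h : H, t * h = A.counit h • t

/-- There is a non-zero left integral that is also a right integral. -/
def IsUnimodular : Prop := ∃ t : H, t ≠ 0 ∧ A.IsLeftIntegral t ∧ A.IsRightIntegral t

/-- The property that characterizes the distinguished group-like element `μ` of `H*`:
`t h = μ(h) t` for all left integrals `t` and all `h`. -/
def IsDistinguishedGrouplike (μ : Module.Dual k H) : Prop :=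
  ∀ t : H, A.IsLeftIntegral t → ∀ h : H, t * h = μ h • t

/-- `h ↼ χ = χ(h₁) h₂`. -/
def harpoon (χ : Module.Dual k H) : H →ₗ[k] H :=
  (TensorProduct.lid k H).toLinearMap ∘ₗ TensorProduct.map χ LinearMap.id ∘ₗ A.comul.toLinearMap

/-- `q¹ t₁ p¹ ⊗ q² t₂ p²`, where `q_R = q¹ ⊗ q²` and `p_R = p¹ ⊗ p²`. -/
def qtp (t : H) : H ⊗[k] H := A.qR * A.comul t * A.pR

/-- `μ(Q¹) S(Q² (R² P² ↼ μ)) R¹ P¹`, where `q_R = Q¹ ⊗ Q²` and `p_R = P¹ ⊗ P²`. -/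
def twistFactor (R : H ⊗[k] H) (μ : Module.Dual k H) : H :=
  LinearMap.mul' k H
    (TensorProduct.map
      (A.S ∘ₗ
        LinearMap.mulLeft k (TensorProduct.lid k H (TensorProduct.map μ LinearMap.id A.qR)) ∘ₗ
        A.harpoon μ)
      LinearMap.id (flip₂ (R * A.pR)))

end QuasiHopfAlgebra

end QuasiHopf

end

/-! All identities are evaluated through linear maps into one algebra B. A tensor a ⊗ b ⊗ c is sent
to f(a) g(b) h(c) (`joint`), for algebra maps f, g, h with commuting ranges. The pentagon,
quasi-coassociativity and the hexagons then hold for arbitrary such maps, with permutations of legs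
turned into permutations of arguments. Long chains such as l₁(a) m₁ l₂(b) m₂ l₃(c) m₃ l₄(d) (`quad`)
absorb coproducts by the antipode axioms, and hence absorb reassociators.

Bijectivity of S. Two algebra maps that agree on S(H) are conjugate, through f(X¹β) s(X²) g(αX³),
where s is their common composite with S. By induction the same holds for maps that agree on the
image of a power of S. Fitting's lemma for a high even power ψ of S gives an algebra map g that
vanishes on ker S and agrees with the identity on the image of ψ; being conjugate to the identity it
is injective, so ker S = 0.

Formula 1). For a left integral t, y Δ(t) = (y¹βS(y²) ⊗ 1) q_R Δ(t). Since S(u) = q²R¹βS(q¹R²)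
(`antipode_drinfeldElement`), this gives (q_R)₂₁ R Δ(t) = (S(u) ⊗ 1) q_R Δ(t). On the other side, th
= μ(h)t gives Δ(t) y = Δ(t) p_R (1 ⊗ m(y)) for a linear map m, `twistedEv`. The formula compares
both evaluations of (q_R)₂₁ R Δ(t) p_R, using Δᵒᵖ(t)R = RΔ(t).

Unimodularity. A Hopf module argument gives a non-zero left integral t with th = μ(h)t for a
character μ. Write M = R₂₁R and c = (μ ⊗ id)(M), which is central. From Δ(t)M = Δ(t)(1 ⊗ S(u)u) one
gets m(My) = S(u)u m(y), because Δ(t) p_R (1 ⊗ z) = 0 forces z = 0. The hexagons contracted with μ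
give m(My) = c S(u)u m(y). As M is invertible and m(p_R) = 1, c = 1. For any character χ with (χ ⊗
id)(M) = 1, the twist f cancels f⁻¹ in 𝒬(χ), and 𝒬(χ) = χ(α)β. This applies to ε and to μ, so ε(α)μ
− μ(α)ε lies in the kernel of 𝒬; injectivity gives μ = ε, and t is two-sided. -/

noncomputable section

namespace QuasiHopf

/-! ### Evaluation of tensors through commuting maps. -/

section Joint

variable {k : Type*} [Field k] {P Q T B : Type*} [Ring P] [Algebra k P] [Ring Q] [Algebra k Q]
  [Ring T] [Algebra k T] [Ring B] [Algebra k B]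

/-- A linear map that is unital and multiplicative. -/
class IsMulMap (f : P →ₗ[k] B) : Prop where
  map_one : f 1 = 1
  map_mul : ∀ x y, f (x * y) = f x * f y

/-- A linear map that is unital and anti-multiplicative. -/
class IsAntiMap (f : P →ₗ[k] B) : Prop where
  map_one : f 1 = 1
  map_mul : ∀ x y, f (x * y) = f y * f x

/-- The ranges of the two maps commute elementwise. -/
class CommRange (f : P →ₗ[k] B) (g : Q →ₗ[k] B) : Prop where
  comm : ∀ x y, f x * g y = g y * f x

/-- The linear map `x ⊗ y ↦ f x * g y`. -/
def joint (f : P →ₗ[k] B) (g : Q →ₗ[k] B) : P ⊗[k] Q →ₗ[k] B :=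
  LinearMap.mul' k B ∘ₗ TensorProduct.map f g

@[simp] theorem joint_tmul (f : P →ₗ[k] B) (g : Q →ₗ[k] B) (x : P) (y : Q) :
    joint f g (x ⊗ₜ y) = f x * g y := rfl

/-- The linear map `x ↦ f x * m`. -/
def mulAfter (f : P →ₗ[k] B) (m : B) : P →ₗ[k] B := LinearMap.mulRight k m ∘ₗ f

@[simp] theorem mulAfter_apply (f : P →ₗ[k] B) (m : B) (x : P) : mulAfter f m x = f x * m := rfl

instance (f : P →ₐ[k] B) : IsMulMap f.toLinearMap := ⟨map_one f, map_mul f⟩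

instance : IsMulMap (LinearMap.id : P →ₗ[k] P) := ⟨rfl, fun _ _ => rfl⟩

instance (f : Q →ₗ[k] B) (g : P →ₗ[k] Q) [IsMulMap f] [IsMulMap g] : IsMulMap (f ∘ₗ g) :=
  ⟨by simp [IsMulMap.map_one], by simp [IsMulMap.map_mul]⟩

theorem IsAntiMap.comp_mul (f : Q →ₗ[k] B) (g : P →ₗ[k] Q) [IsAntiMap f] [IsMulMap g] :
    IsAntiMap (f ∘ₗ g) :=
  ⟨by simp [IsMulMap.map_one, IsAntiMap.map_one], by simp [IsMulMap.map_mul, IsAntiMap.map_mul]⟩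

theorem IsMulMap.comp_anti (f : Q →ₗ[k] B) (g : P →ₗ[k] Q) [IsMulMap f] [IsAntiMap g] :
    IsAntiMap (f ∘ₗ g) :=
  ⟨by simp [IsMulMap.map_one, IsAntiMap.map_one], by simp [IsMulMap.map_mul, IsAntiMap.map_mul]⟩

theorem IsAntiMap.comp_anti (f : Q →ₗ[k] B) (g : P →ₗ[k] Q) [IsAntiMap f] [IsAntiMap g] :
    IsMulMap (f ∘ₗ g) :=
  ⟨by simp [IsAntiMap.map_one], by simp [IsAntiMap.map_mul]⟩

instance (f : P →ₗ[k] B) (g : Q →ₗ[k] B) [IsMulMap f] [IsMulMap g] [CommRange f g] :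
    IsMulMap (joint f g) where
  map_one := by
    rw [Algebra.TensorProduct.one_def, joint_tmul, IsMulMap.map_one (f := f),
      IsMulMap.map_one (f := g), one_mul]
  map_mul x y := by
    induction x using TensorProduct.induction_on with
    | zero => simp
    | add x x' hx hx' => simp only [add_mul, map_add, hx, hx']
    | tmul a b =>
      induction y using TensorProduct.induction_on with
      | zero => simp
      | add y y' hy hy' => simp only [mul_add, map_add, hy, hy']
      | tmul c d =>
        rw [Algebra.TensorProduct.tmul_mul_tmul, joint_tmul, joint_tmul, joint_tmul,
          IsMulMap.map_mul (f := f), IsMulMap.map_mul (f := g), mul_assoc, mul_assoc,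
          ← mul_assoc (f c), CommRange.comm (f := f) (g := g) c b, mul_assoc]

instance (f : P →ₗ[k] B) (g : Q →ₗ[k] B) (h : T →ₗ[k] B) [CommRange f h] [CommRange g h] :
    CommRange (joint f g) h where
  comm x y := by
    induction x using TensorProduct.induction_on with
    | zero => simp
    | add x x' hx hx' => simp only [add_mul, mul_add, map_add, hx, hx']
    | tmul a b =>
      rw [joint_tmul, mul_assoc, CommRange.comm (f := g) (g := h), ← mul_assoc,
        CommRange.comm (f := f) (g := h), mul_assoc]

instance (f : P →ₗ[k] B) (g : Q →ₗ[k] B) (h : T →ₗ[k] B) [CommRange f h] [CommRange f g] :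
    CommRange f (joint g h) where
  comm x y := by
    induction y using TensorProduct.induction_on with
    | zero => simp
    | add x x' hx hx' => simp only [add_mul, mul_add, map_add, hx, hx']
    | tmul a b =>
      rw [joint_tmul, mul_assoc, ← CommRange.comm (f := f) (g := h), ← mul_assoc,
        CommRange.comm (f := f) (g := g), mul_assoc]

instance (f : Q →ₗ[k] B) (h : T →ₗ[k] B) (g : P →ₗ[k] Q) [CommRange f h] :
    CommRange (f ∘ₗ g) h := ⟨fun x y => CommRange.comm (f := f) (g x) y⟩

instance (f : Q →ₗ[k] B) (h : T →ₗ[k] B) (g : P →ₗ[k] Q) [CommRange h f] :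
    CommRange h (f ∘ₗ g) := ⟨fun x y => CommRange.comm (f := h) x (g y)⟩

theorem CommRange.symm (f : P →ₗ[k] B) (g : Q →ₗ[k] B) [CommRange f g] : CommRange g f :=
  ⟨fun x y => (CommRange.comm (f := f) y x).symm⟩

/-- The scalar-valued algebra map `χ`, with values in `B`. -/
def scalarMap (B : Type*) [Ring B] [Algebra k B] (χ : P →ₐ[k] k) : P →ₗ[k] B :=
  Algebra.linearMap k B ∘ₗ χ.toLinearMap

@[simp] theorem scalarMap_apply (χ : P →ₐ[k] k) (x : P) :
    scalarMap B χ x = algebraMap k B (χ x) := rfl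

instance (χ : P →ₐ[k] k) : IsMulMap (scalarMap B χ) := ⟨by simp, by simp⟩

instance (χ : P →ₐ[k] k) (f : Q →ₗ[k] B) : CommRange (scalarMap B χ) f :=
  ⟨fun _ _ => Algebra.commutes _ _⟩

instance (χ : P →ₐ[k] k) (f : Q →ₗ[k] B) : CommRange f (scalarMap B χ) :=
  ⟨fun _ _ => (Algebra.commutes _ _).symm⟩

theorem joint_one_tmul (f : P →ₗ[k] B) (g : Q →ₗ[k] B) [IsMulMap f] (y : Q) :
    joint f g (1 ⊗ₜ y) = g y := by simp [IsMulMap.map_one]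

/-- Contraction of the left tensor factor by a functional. -/
def contractL (χ : P →ₗ[k] k) : P ⊗[k] Q →ₗ[k] Q :=
  (TensorProduct.lid k Q).toLinearMap ∘ₗ TensorProduct.map χ LinearMap.id

/-- Contraction of the right tensor factor by a functional. -/
def contractR (χ : Q →ₗ[k] k) : P ⊗[k] Q →ₗ[k] P :=
  (TensorProduct.rid k P).toLinearMap ∘ₗ TensorProduct.map LinearMap.id χ

@[simp] theorem contractL_tmul (χ : P →ₗ[k] k) (x : P) (y : Q) :
    contractL χ (x ⊗ₜ y) = χ x • y := by simp [contractL]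

@[simp] theorem contractR_tmul (χ : Q →ₗ[k] k) (x : P) (y : Q) :
    contractR χ (x ⊗ₜ y) = χ y • x := by simp [contractR]

variable {M : Type*} [AddCommGroup M] [Module k M]

/-- The `absorb` lemmas abstract the move S(h₁)αh₂ = ε(h)α inside a long product. If F swallows the
values of p up to the functional χ, then the leg evaluated through p may be contracted with χ. The
versions differ in the side of the multiplication and the position of the leg; commutation of ranges
brings the leg to the edge where needed. -/
theorem absorb_left_fst (F : B →ₗ[k] M) (p : P →ₗ[k] B) (q : Q →ₗ[k] B) (χ : P →ₗ[k] k)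
    (hF : ∀ x y, F (p x * y) = χ x • F y) (W : P ⊗[k] Q) (y : B) :
    F (joint p q W * y) = F (q (contractL χ W) * y) := by
  induction W using TensorProduct.induction_on with
  | zero => simp
  | add x x' hx hx' => simp only [add_mul, map_add, hx, hx']
  | tmul a b => simp [mul_assoc, hF]

theorem absorb_left_snd (F : B →ₗ[k] M) (f : T →ₗ[k] B) (p : P →ₗ[k] B) (q : Q →ₗ[k] B)
    [CommRange f p] (χ : P →ₗ[k] k) (hF : ∀ x y, F (p x * y) = χ x • F y) (W : T ⊗[k] (P ⊗[k] Q))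
    (y : B) :
    F (joint f (joint p q) W * y)
      = F (joint f q (TensorProduct.map LinearMap.id (contractL χ) W) * y) := by
  induction W using TensorProduct.induction_on with
  | zero => simp
  | add x x' hx hx' => simp only [add_mul, map_add, hx, hx']
  | tmul a W =>
    induction W using TensorProduct.induction_on with
    | zero => simp
    | add x x' hx hx' => simp only [add_mul, map_add, hx, hx', TensorProduct.tmul_add]
    | tmul b c =>
      rw [joint_tmul, joint_tmul, ← mul_assoc, CommRange.comm (f := f) (g := p), mul_assoc,
        mul_assoc, hF]
      simp [mul_assoc]

theorem absorb_left_trd (F : B →ₗ[k] M) (f : T →ₗ[k] B) (p : P →ₗ[k] B) (q : Q →ₗ[k] B)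
    [CommRange f p] [CommRange q p] (χ : P →ₗ[k] k) (hF : ∀ x y, F (p x * y) = χ x • F y)
    (W : T ⊗[k] (Q ⊗[k] P)) (y : B) :
    F (joint f (joint q p) W * y)
      = F (joint f q (TensorProduct.map LinearMap.id (contractR χ) W) * y) := by
  induction W using TensorProduct.induction_on with
  | zero => simp
  | add x x' hx hx' => simp only [add_mul, map_add, hx, hx']
  | tmul a W =>
    induction W using TensorProduct.induction_on with
    | zero => simp
    | add x x' hx hx' => simp only [add_mul, map_add, hx, hx', TensorProduct.tmul_add]
    | tmul b c =>
      rw [joint_tmul, joint_tmul, CommRange.comm (f := q) (g := p), ← mul_assoc,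
        CommRange.comm (f := f) (g := p), mul_assoc, mul_assoc, hF]
      simp [mul_assoc]

theorem absorb_left_snd' (F : B →ₗ[k] M) (p : P →ₗ[k] B) (q : Q →ₗ[k] B) [CommRange q p]
    (χ : P →ₗ[k] k) (hF : ∀ x y, F (p x * y) = χ x • F y) (W : Q ⊗[k] P) (y : B) :
    F (joint q p W * y) = F (q (contractR χ W) * y) := by
  induction W using TensorProduct.induction_on with
  | zero => simp
  | add x x' hx hx' => simp only [add_mul, map_add, hx, hx']
  | tmul a b =>
    rw [joint_tmul, CommRange.comm (f := q) (g := p), mul_assoc, hF]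
    simp

theorem absorb_right_fst (F : B →ₗ[k] M) (p : P →ₗ[k] B) (q : Q →ₗ[k] B) [CommRange p q]
    (χ : P →ₗ[k] k) (hF : ∀ x y, F (y * p x) = χ x • F y) (W : P ⊗[k] Q) (y : B) :
    F (y * joint p q W) = F (y * q (contractL χ W)) := by
  induction W using TensorProduct.induction_on with
  | zero => simp
  | add x x' hx hx' => simp only [mul_add, map_add, hx, hx']
  | tmul a b => rw [joint_tmul, CommRange.comm (f := p), ← mul_assoc, hF]; simp

theorem absorb_right_snd (F : B →ₗ[k] M) (f : T →ₗ[k] B) (p : P →ₗ[k] B) (q : Q →ₗ[k] B)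
    [CommRange p q] (χ : P →ₗ[k] k) (hF : ∀ x y, F (y * p x) = χ x • F y)
    (W : T ⊗[k] (P ⊗[k] Q)) (y : B) :
    F (y * joint f (joint p q) W)
      = F (y * joint f q (TensorProduct.map LinearMap.id (contractL χ) W)) := by
  induction W using TensorProduct.induction_on with
  | zero => simp
  | add x x' hx hx' => simp only [mul_add, map_add, hx, hx']
  | tmul a W =>
    rw [joint_tmul, ← mul_assoc, absorb_right_fst F p q χ hF]
    simp [mul_assoc]

theorem absorb_right_trd (F : B →ₗ[k] M) (f : T →ₗ[k] B) (p : P →ₗ[k] B) (q : Q →ₗ[k] B)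
    (χ : P →ₗ[k] k) (hF : ∀ x y, F (y * p x) = χ x • F y)
    (W : T ⊗[k] (Q ⊗[k] P)) (y : B) :
    F (y * joint f (joint q p) W)
      = F (y * joint f q (TensorProduct.map LinearMap.id (contractR χ) W)) := by
  induction W using TensorProduct.induction_on with
  | zero => simp
  | add x x' hx hx' => simp only [mul_add, map_add, hx, hx']
  | tmul a W =>
    induction W using TensorProduct.induction_on with
    | zero => simp
    | add x x' hx hx' => simp only [mul_add, map_add, hx, hx', TensorProduct.tmul_add]
    | tmul b c =>
      rw [joint_tmul, joint_tmul, ← mul_assoc (f a), ← mul_assoc, hF]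
      simp

end Joint


/-! ### The fourfold tensor power and chains with four slots. -/

section Legs

variable {k H : Type*} [Field k] [Ring H] [Algebra k H]

theorem tensor₃_induction {p : H ⊗[k] (H ⊗[k] H) → Prop} (W : H ⊗[k] (H ⊗[k] H))
    (tmul : ∀ a b c, p (a ⊗ₜ (b ⊗ₜ c))) (add : ∀ x y, p x → p y → p (x + y)) : p W := by
  induction W using TensorProduct.induction_on with
  | zero => simpa using tmul 0 0 0
  | add x y hx hy => exact add x y hx hy
  | tmul a W =>
    induction W using TensorProduct.induction_on with
    | zero => simpa using tmul 0 0 0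
    | add x y hx hy => rw [TensorProduct.tmul_add]; exact add _ _ hx hy
    | tmul b c => exact tmul a b c

variable (k H) in
/-- The fourfold tensor power of `H`, as an algebra. -/
def Four : Type _ := H ⊗[k] (H ⊗[k] (H ⊗[k] H))

namespace Four

instance : Ring (Four k H) := inferInstanceAs (Ring (H ⊗[k] (H ⊗[k] (H ⊗[k] H))))
instance : Algebra k (Four k H) := inferInstanceAs (Algebra k (H ⊗[k] (H ⊗[k] (H ⊗[k] H))))

variable (k) in
/-- The pure tensor `a ⊗ b ⊗ c ⊗ d`. -/
def tmul (a b c d : H) : Four k H := a ⊗ₜ[k] (b ⊗ₜ[k] (c ⊗ₜ[k] d))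

@[simp] theorem tmul_mul_tmul (a b c d a' b' c' d' : H) :
    tmul k a b c d * tmul k a' b' c' d' = tmul k (a * a') (b * b') (c * c') (d * d') := by
  change (a ⊗ₜ[k] (b ⊗ₜ[k] (c ⊗ₜ[k] d)) : H ⊗[k] (H ⊗[k] (H ⊗[k] H))) *
    (a' ⊗ₜ[k] (b' ⊗ₜ[k] (c' ⊗ₜ[k] d'))) = _
  simp only [Algebra.TensorProduct.tmul_mul_tmul]
  rfl

theorem induction {p : Four k H → Prop} (W : Four k H)
    (tmul : ∀ a b c d, p (tmul k a b c d)) (add : ∀ x y, p x → p y → p (x + y)) : p W := by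
  have h0 : p 0 := by
    have := tmul 0 0 0 0
    rwa [Four.tmul, TensorProduct.zero_tmul] at this
  refine TensorProduct.induction_on (motive := p) W h0 (fun a W => ?_) add
  induction W using tensor₃_induction with
  | add x y hx hy => rw [TensorProduct.tmul_add]; exact add _ _ hx hy
  | tmul b c d => exact tmul a b c d

end Four

variable (k H)

/-- `a ↦ a ⊗ 1 ⊗ 1 ⊗ 1`. -/
def leg₁ : H →ₗ[k] Four k H :=
  (Algebra.TensorProduct.includeLeft : H →ₐ[k] H ⊗[k] (H ⊗[k] (H ⊗[k] H))).toLinearMap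

/-- `a ↦ 1 ⊗ a ⊗ 1 ⊗ 1`. -/
def leg₂ : H →ₗ[k] Four k H :=
  (Algebra.TensorProduct.includeRight : _ →ₐ[k] H ⊗[k] (H ⊗[k] (H ⊗[k] H))).toLinearMap ∘ₗ
    (Algebra.TensorProduct.includeLeft : H →ₐ[k] _).toLinearMap

/-- `a ↦ 1 ⊗ 1 ⊗ a ⊗ 1`. -/
def leg₃ : H →ₗ[k] Four k H :=
  (Algebra.TensorProduct.includeRight : _ →ₐ[k] H ⊗[k] (H ⊗[k] (H ⊗[k] H))).toLinearMap ∘ₗ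
    (Algebra.TensorProduct.includeRight : _ →ₐ[k] H ⊗[k] (H ⊗[k] H)).toLinearMap ∘ₗ
    (Algebra.TensorProduct.includeLeft : H →ₐ[k] _).toLinearMap

/-- `a ↦ 1 ⊗ 1 ⊗ 1 ⊗ a`. -/
def leg₄ : H →ₗ[k] Four k H :=
  (Algebra.TensorProduct.includeRight : _ →ₐ[k] H ⊗[k] (H ⊗[k] (H ⊗[k] H))).toLinearMap ∘ₗ
    (Algebra.TensorProduct.includeRight : _ →ₐ[k] H ⊗[k] (H ⊗[k] H)).toLinearMap ∘ₗ
    (Algebra.TensorProduct.includeRight : H →ₐ[k] _).toLinearMap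

variable {k H}

@[simp] theorem leg₁_apply (a : H) : leg₁ k H a = Four.tmul k a 1 1 1 := rfl
@[simp] theorem leg₂_apply (a : H) : leg₂ k H a = Four.tmul k 1 a 1 1 := rfl
@[simp] theorem leg₃_apply (a : H) : leg₃ k H a = Four.tmul k 1 1 a 1 := rfl
@[simp] theorem leg₄_apply (a : H) : leg₄ k H a = Four.tmul k 1 1 1 a := rfl

instance : IsMulMap (leg₁ k H) := ⟨rfl, by simp⟩
instance : IsMulMap (leg₂ k H) := ⟨rfl, by simp⟩
instance : IsMulMap (leg₃ k H) := ⟨rfl, by simp⟩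
instance : IsMulMap (leg₄ k H) := ⟨rfl, by simp⟩
instance : CommRange (leg₁ k H) (leg₂ k H) := ⟨by simp⟩
instance : CommRange (leg₁ k H) (leg₃ k H) := ⟨by simp⟩
instance : CommRange (leg₁ k H) (leg₄ k H) := ⟨by simp⟩
instance : CommRange (leg₂ k H) (leg₁ k H) := ⟨by simp⟩
instance : CommRange (leg₂ k H) (leg₃ k H) := ⟨by simp⟩
instance : CommRange (leg₂ k H) (leg₄ k H) := ⟨by simp⟩
instance : CommRange (leg₃ k H) (leg₁ k H) := ⟨by simp⟩
instance : CommRange (leg₃ k H) (leg₂ k H) := ⟨by simp⟩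
instance : CommRange (leg₃ k H) (leg₄ k H) := ⟨by simp⟩
instance : CommRange (leg₄ k H) (leg₁ k H) := ⟨by simp⟩
instance : CommRange (leg₄ k H) (leg₂ k H) := ⟨by simp⟩
instance : CommRange (leg₄ k H) (leg₃ k H) := ⟨by simp⟩

variable {B : Type*} [Ring B] [Algebra k B]

/-- `a ⊗ b ⊗ c ⊗ d ↦ l₁(a) m₁ l₂(b) m₂ l₃(c) m₃ l₄(d)`. -/
def quad (l₁ : H →ₗ[k] B) (m₁ : B) (l₂ : H →ₗ[k] B) (m₂ : B) (l₃ : H →ₗ[k] B) (m₃ : B)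
    (l₄ : H →ₗ[k] B) : Four k H →ₗ[k] B :=
  joint (mulAfter l₁ m₁) (joint (mulAfter l₂ m₂) (joint (mulAfter l₃ m₃) l₄))

variable (l₁ l₂ l₃ l₄ : H →ₗ[k] B) (m₁ m₂ m₃ : B)

@[simp] theorem quad_tmul (a b c d : H) :
    quad l₁ m₁ l₂ m₂ l₃ m₃ l₄ (Four.tmul k a b c d) =
      l₁ a * m₁ * (l₂ b * m₂ * (l₃ c * m₃ * l₄ d)) := rfl

/-- Because l₁ reverses products and l₂ preserves them, a left factor D in two neighbouring slots
ends up directly around m₁, where `hD` removes it. In the `right` versions the first map preserves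
products and the second reverses them. -/
theorem quad_left₁₂ [IsAntiMap l₁] [IsMulMap l₂] {D : H ⊗[k] H} {r : k}
    (hD : joint (mulAfter l₁ m₁) l₂ D = r • m₁) (y : Four k H) :
    quad l₁ m₁ l₂ m₂ l₃ m₃ l₄ (joint (leg₁ k H) (leg₂ k H) D * y) =
      r • quad l₁ m₁ l₂ m₂ l₃ m₃ l₄ y := by
  induction y using Four.induction with
  | add x y hx hy => simp only [mul_add, map_add, hx, hy, smul_add]
  | tmul a b c d =>
    trans l₁ a * (joint (mulAfter l₁ m₁) l₂ D) * (l₂ b * m₂ * (l₃ c * m₃ * l₄ d))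
    · clear hD
      induction D using TensorProduct.induction_on with
      | zero => simp
      | add x y hx hy => simp only [add_mul, mul_add, map_add, hx, hy]
      | tmul p q => simp [IsAntiMap.map_mul, IsMulMap.map_mul, mul_assoc]
    · rw [hD]; simp

theorem quad_left₂₃ [IsAntiMap l₂] [IsMulMap l₃] {D : H ⊗[k] H} {r : k}
    (hD : joint (mulAfter l₂ m₂) l₃ D = r • m₂) (y : Four k H) :
    quad l₁ m₁ l₂ m₂ l₃ m₃ l₄ (joint (leg₂ k H) (leg₃ k H) D * y) =
      r • quad l₁ m₁ l₂ m₂ l₃ m₃ l₄ y := by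
  induction y using Four.induction with
  | add x y hx hy => simp only [mul_add, map_add, hx, hy, smul_add]
  | tmul a b c d =>
    trans l₁ a * m₁ * (l₂ b * (joint (mulAfter l₂ m₂) l₃ D) * (l₃ c * m₃ * l₄ d))
    · clear hD
      induction D using TensorProduct.induction_on with
      | zero => simp
      | add x y hx hy => simp only [add_mul, mul_add, map_add, hx, hy]
      | tmul p q => simp [IsAntiMap.map_mul, IsMulMap.map_mul, mul_assoc]
    · rw [hD]; simp

theorem quad_left₃₄ [IsAntiMap l₃] [IsMulMap l₄] {D : H ⊗[k] H} {r : k}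
    (hD : joint (mulAfter l₃ m₃) l₄ D = r • m₃) (y : Four k H) :
    quad l₁ m₁ l₂ m₂ l₃ m₃ l₄ (joint (leg₃ k H) (leg₄ k H) D * y) =
      r • quad l₁ m₁ l₂ m₂ l₃ m₃ l₄ y := by
  induction y using Four.induction with
  | add x y hx hy => simp only [mul_add, map_add, hx, hy, smul_add]
  | tmul a b c d =>
    trans l₁ a * m₁ * (l₂ b * m₂ * (l₃ c * (joint (mulAfter l₃ m₃) l₄ D) * l₄ d))
    · clear hD
      induction D using TensorProduct.induction_on with
      | zero => simp
      | add x y hx hy => simp only [add_mul, mul_add, map_add, hx, hy]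
      | tmul p q => simp [IsAntiMap.map_mul, IsMulMap.map_mul, mul_assoc]
    · rw [hD]; simp

theorem quad_right₁₂ [IsMulMap l₁] [IsAntiMap l₂] {D : H ⊗[k] H} {r : k}
    (hD : joint (mulAfter l₁ m₁) l₂ D = r • m₁) (y : Four k H) :
    quad l₁ m₁ l₂ m₂ l₃ m₃ l₄ (y * joint (leg₁ k H) (leg₂ k H) D) =
      r • quad l₁ m₁ l₂ m₂ l₃ m₃ l₄ y := by
  induction y using Four.induction with
  | add x y hx hy => simp only [add_mul, map_add, hx, hy, smul_add]
  | tmul a b c d =>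
    trans l₁ a * (joint (mulAfter l₁ m₁) l₂ D) * (l₂ b * m₂ * (l₃ c * m₃ * l₄ d))
    · clear hD
      induction D using TensorProduct.induction_on with
      | zero => simp
      | add x y hx hy => simp only [add_mul, mul_add, map_add, hx, hy]
      | tmul p q => simp [IsAntiMap.map_mul, IsMulMap.map_mul, mul_assoc]
    · rw [hD]; simp

theorem quad_right₂₃ [IsMulMap l₂] [IsAntiMap l₃] {D : H ⊗[k] H} {r : k}
    (hD : joint (mulAfter l₂ m₂) l₃ D = r • m₂) (y : Four k H) :
    quad l₁ m₁ l₂ m₂ l₃ m₃ l₄ (y * joint (leg₂ k H) (leg₃ k H) D) =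
      r • quad l₁ m₁ l₂ m₂ l₃ m₃ l₄ y := by
  induction y using Four.induction with
  | add x y hx hy => simp only [add_mul, map_add, hx, hy, smul_add]
  | tmul a b c d =>
    trans l₁ a * m₁ * (l₂ b * (joint (mulAfter l₂ m₂) l₃ D) * (l₃ c * m₃ * l₄ d))
    · clear hD
      induction D using TensorProduct.induction_on with
      | zero => simp
      | add x y hx hy => simp only [add_mul, mul_add, map_add, hx, hy]
      | tmul p q => simp [IsAntiMap.map_mul, IsMulMap.map_mul, mul_assoc]
    · rw [hD]; simp

theorem quad_right₃₄ [IsMulMap l₃] [IsAntiMap l₄] {D : H ⊗[k] H} {r : k}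
    (hD : joint (mulAfter l₃ m₃) l₄ D = r • m₃) (y : Four k H) :
    quad l₁ m₁ l₂ m₂ l₃ m₃ l₄ (y * joint (leg₃ k H) (leg₄ k H) D) =
      r • quad l₁ m₁ l₂ m₂ l₃ m₃ l₄ y := by
  induction y using Four.induction with
  | add x y hx hy => simp only [add_mul, map_add, hx, hy, smul_add]
  | tmul a b c d =>
    trans l₁ a * m₁ * (l₂ b * m₂ * (l₃ c * (joint (mulAfter l₃ m₃) l₄ D) * l₄ d))
    · clear hD
      induction D using TensorProduct.induction_on with
      | zero => simp
      | add x y hx hy => simp only [add_mul, mul_add, map_add, hx, hy]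
      | tmul p q => simp [IsAntiMap.map_mul, IsMulMap.map_mul, mul_assoc]
    · rw [hD]; simp

end Legs

/-! ### Reassociator and pentagon for commuting algebra maps. -/

namespace QuasiBialgebra

variable {k H : Type*} [Field k] [Ring H] [Algebra k H] (A : QuasiBialgebra k H)
  {B : Type*} [Ring B] [Algebra k B]

/-- The convolution product `h ↦ f(h₁) g(h₂)`. -/
def conv (f g : H →ₗ[k] B) : H →ₗ[k] B := joint f g ∘ₗ A.comul.toLinearMap

theorem conv_apply (f g : H →ₗ[k] B) (h : H) : A.conv f g h = joint f g (A.comul h) := rfl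

instance (f g : H →ₗ[k] B) [IsMulMap f] [IsMulMap g] [CommRange f g] : IsMulMap (A.conv f g) := by
  unfold conv; infer_instance

instance (f g : H →ₗ[k] B) {Q : Type*} [Ring Q] [Algebra k Q] (h : Q →ₗ[k] B)
    [CommRange f h] [CommRange g h] : CommRange (A.conv f g) h := by
  unfold conv; infer_instance

instance (f g : H →ₗ[k] B) {Q : Type*} [Ring Q] [Algebra k Q] (h : Q →ₗ[k] B)
    [CommRange h f] [CommRange h g] : CommRange h (A.conv f g) := by
  unfold conv; infer_instance

/-- An element of `H ⊗ H ⊗ H` on which the counit in any tensor factor gives `1`. -/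
structure IsCounital (W : H ⊗[k] (H ⊗[k] H)) : Prop where
  fst : contractL A.counit.toLinearMap W = 1
  snd : TensorProduct.map LinearMap.id (contractL A.counit.toLinearMap) W = 1
  trd : TensorProduct.map LinearMap.id (contractR A.counit.toLinearMap) W = 1

/-- `f ⊗ g ⊗ h` evaluated at the reassociator and multiplied in `B`. -/
def phi (f g h : H →ₗ[k] B) : B := joint f (joint g h) (A.Φ : H ⊗[k] (H ⊗[k] H))

/-- `f ⊗ g ⊗ h` evaluated at the inverse reassociator and multiplied in `B`. -/
def phiInv (f g h : H →ₗ[k] B) : B := joint f (joint g h) (↑A.Φ⁻¹ : H ⊗[k] (H ⊗[k] H))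

section

variable (f g h : H →ₗ[k] B) [IsMulMap f] [IsMulMap g] [IsMulMap h] [CommRange f g]
  [CommRange f h] [CommRange g h]

theorem phi_mul_phiInv : A.phi f g h * A.phiInv f g h = 1 := by
  rw [phi, phiInv, ← IsMulMap.map_mul (f := joint f (joint g h)), Units.mul_inv, IsMulMap.map_one]

theorem phiInv_mul_phi : A.phiInv f g h * A.phi f g h = 1 := by
  rw [phi, phiInv, ← IsMulMap.map_mul (f := joint f (joint g h)), Units.inv_mul, IsMulMap.map_one]

theorem phi_mul_phiInv_assoc (x : B) : A.phi f g h * (A.phiInv f g h * x) = x := by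
  rw [← mul_assoc, phi_mul_phiInv, one_mul]

theorem phiInv_mul_phi_assoc (x : B) : A.phiInv f g h * (A.phi f g h * x) = x := by
  rw [← mul_assoc, phiInv_mul_phi, one_mul]

/-- Quasi-coassociativity, for the convolution product of commuting algebra maps. -/
theorem phi_mul_conv (x : H) :
    A.phi f g h * A.conv (A.conv f g) h x = A.conv f (A.conv g h) x * A.phi f g h := by
  have h1 : joint f (joint g h) (assocHom H H H (Algebra.TensorProduct.map A.comul
      (AlgHom.id k H) (A.comul x))) = A.conv (A.conv f g) h x := by
    rw [conv_apply]
    generalize A.comul x = D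
    induction D using TensorProduct.induction_on with
    | zero => simp
    | add x y hx hy => simp only [map_add, hx, hy]
    | tmul p q =>
      rw [joint_tmul, conv_apply, Algebra.TensorProduct.map_tmul, AlgHom.id_apply]
      generalize A.comul p = D
      induction D using TensorProduct.induction_on with
      | zero => simp
      | add x y hx hy => simp only [TensorProduct.add_tmul, map_add, hx, hy, add_mul]
      | tmul r s => simp [assocHom, mul_assoc]
  have h2 : joint f (joint g h) (Algebra.TensorProduct.map (AlgHom.id k H) A.comul (A.comul x)) =
      A.conv f (A.conv g h) x := by
    rw [conv_apply]
    generalize A.comul x = D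
    induction D using TensorProduct.induction_on with
    | zero => simp
    | add x y hx hy => simp only [map_add, hx, hy]
    | tmul p q => simp [conv_apply]
  have := congrArg (joint f (joint g h)) (A.quasi_coassoc x)
  rw [IsMulMap.map_mul (f := joint f (joint g h)), IsMulMap.map_mul (f := joint f (joint g h)),
    h1, h2] at this
  rw [this]
  change _ = A.phi f g h * _ * A.phiInv f g h * A.phi f g h
  rw [mul_assoc _ (A.phiInv f g h), phiInv_mul_phi, mul_one]

theorem conv_mul_phiInv (x : H) :
    A.conv (A.conv f g) h x * A.phiInv f g h = A.phiInv f g h * A.conv f (A.conv g h) x := by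
  rw [← phiInv_mul_phi_assoc A f g h (A.conv (A.conv f g) h x * _), ← mul_assoc (A.phi f g h),
    phi_mul_conv, mul_assoc, phi_mul_phiInv, mul_one]

end

section

variable (f₁ f₂ f₃ f₄ : H →ₗ[k] B) [IsMulMap f₁] [IsMulMap f₂] [IsMulMap f₃] [IsMulMap f₄]
  [CommRange f₁ f₂] [CommRange f₁ f₃] [CommRange f₁ f₄] [CommRange f₂ f₃] [CommRange f₂ f₄]
  [CommRange f₃ f₄]

/-- The pentagon identity, for four commuting algebra maps. -/
theorem pentagon :
    A.phi f₂ f₃ f₄ * (A.phi f₁ (A.conv f₂ f₃) f₄ * A.phi f₁ f₂ f₃) =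
      A.phi f₁ f₂ (A.conv f₃ f₄) * A.phi (A.conv f₁ f₂) f₃ f₄ := by
  let F := joint f₁ (joint f₂ (joint f₃ f₄))
  have hF : IsMulMap F := inferInstance
  have h1 (W : H ⊗[k] (H ⊗[k] H)) :
      F (Algebra.TensorProduct.map (AlgHom.id k H)
        ((assocHom H H H).comp (Algebra.TensorProduct.map A.comul (AlgHom.id k H))) W) =
      joint f₁ (joint (A.conv f₂ f₃) f₄) W := by
    induction W using tensor₃_induction with
    | add x y hx hy => simp only [map_add, hx, hy]
    | tmul a b c =>
      simp only [Algebra.TensorProduct.map_tmul, AlgHom.id_apply, AlgHom.comp_apply, joint_tmul,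
        conv_apply]
      generalize A.comul b = D
      induction D using TensorProduct.induction_on with
      | zero => simp
      | add x y hx hy =>
        simp only [TensorProduct.add_tmul, TensorProduct.tmul_add, map_add, hx, hy, add_mul,
          mul_add]
      | tmul r s => simp [assocHom, mul_assoc, F]
  have h2 (W : H ⊗[k] (H ⊗[k] H)) :
      F (Algebra.TensorProduct.map (AlgHom.id k H) place12 W) = joint f₁ (joint f₂ f₃) W := by
    induction W using tensor₃_induction with
    | add x y hx hy => simp only [map_add, hx, hy]
    | tmul a b c => simp [place12, F, IsMulMap.map_one]
  have h3 (W : H ⊗[k] (H ⊗[k] H)) :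
      F (Algebra.TensorProduct.map (AlgHom.id k H)
        (Algebra.TensorProduct.map (AlgHom.id k H) A.comul) W) =
      joint f₁ (joint f₂ (A.conv f₃ f₄)) W := by
    induction W using tensor₃_induction with
    | add x y hx hy => simp only [map_add, hx, hy]
    | tmul a b c => simp [conv_apply, F]
  have h4 (W : H ⊗[k] (H ⊗[k] H)) :
      F (assocHom H H (H ⊗[k] H)
        (Algebra.TensorProduct.map A.comul (AlgHom.id k (H ⊗[k] H)) W)) =
      joint (A.conv f₁ f₂) (joint f₃ f₄) W := by
    induction W using tensor₃_induction with
    | add x y hx hy => simp only [map_add, hx, hy]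
    | tmul a b c =>
      simp only [Algebra.TensorProduct.map_tmul, AlgHom.id_apply, joint_tmul, conv_apply]
      generalize A.comul a = D
      induction D using TensorProduct.induction_on with
      | zero => simp
      | add x y hx hy => simp only [TensorProduct.add_tmul, map_add, hx, hy, add_mul]
      | tmul r s => simp [assocHom, mul_assoc, F]
  have := congrArg F A.cocycle
  rw [IsMulMap.map_mul (f := F), IsMulMap.map_mul (f := F), IsMulMap.map_mul (f := F), h1, h2, h3,
    h4, joint_one_tmul, mul_assoc] at this
  exact this

end

end QuasiBialgebra


/-! ### Counit normalisation and solved forms of the pentagon. -/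

section

variable {k : Type*} [Field k] {P Q T B : Type*} [Ring P] [Algebra k P] [Ring Q] [Algebra k Q]
  [Ring T] [Algebra k T] [Ring B] [Algebra k B]

theorem joint_scalarMap_left (χ : P →ₐ[k] k) (g : Q →ₗ[k] B) (W : P ⊗[k] Q) :
    joint (scalarMap B χ) g W = g (contractL χ.toLinearMap W) := by
  induction W using TensorProduct.induction_on with
  | zero => simp
  | add x y hx hy => simp only [map_add, hx, hy]
  | tmul a b => rw [joint_tmul, scalarMap_apply, contractL_tmul, map_smul, Algebra.smul_def]; rfl

theorem joint_scalarMap_right (χ : Q →ₐ[k] k) (g : P →ₗ[k] B) (W : P ⊗[k] Q) :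
    joint g (scalarMap B χ) W = g (contractR χ.toLinearMap W) := by
  induction W using TensorProduct.induction_on with
  | zero => simp
  | add x y hx hy => simp only [map_add, hx, hy]
  | tmul a b =>
    rw [joint_tmul, scalarMap_apply, contractR_tmul, map_smul, Algebra.smul_def,
      ← Algebra.commutes]
    rfl

theorem joint_scalarMap_mid (f : P →ₗ[k] B) (χ : T →ₐ[k] k) (g : Q →ₗ[k] B)
    (W : P ⊗[k] (T ⊗[k] Q)) :
    joint f (joint (scalarMap B χ) g) W =
      joint f g (TensorProduct.map LinearMap.id (contractL χ.toLinearMap) W) := by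
  induction W using TensorProduct.induction_on with
  | zero => simp
  | add x y hx hy => simp only [map_add, hx, hy]
  | tmul a b => simp [joint_scalarMap_left]

theorem joint_scalarMap_last (f : P →ₗ[k] B) (χ : T →ₐ[k] k) (g : Q →ₗ[k] B)
    (W : P ⊗[k] (Q ⊗[k] T)) :
    joint f (joint g (scalarMap B χ)) W =
      joint f g (TensorProduct.map LinearMap.id (contractR χ.toLinearMap) W) := by
  induction W using TensorProduct.induction_on with
  | zero => simp
  | add x y hx hy => simp only [map_add, hx, hy]
  | tmul a b => simp [joint_scalarMap_right]

theorem joint_include (W : P ⊗[k] Q) :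
    joint (B := P ⊗[k] Q) (Algebra.TensorProduct.includeLeft : P →ₐ[k] P ⊗[k] Q).toLinearMap
      (Algebra.TensorProduct.includeRight : Q →ₐ[k] P ⊗[k] Q).toLinearMap W = W := by
  induction W using TensorProduct.induction_on with
  | zero => simp
  | add x y hx hy => simp only [map_add, hx, hy]
  | tmul a b => simp

instance : CommRange (B := P ⊗[k] Q)
    (Algebra.TensorProduct.includeLeft : P →ₐ[k] P ⊗[k] Q).toLinearMap
    (Algebra.TensorProduct.includeRight : Q →ₐ[k] P ⊗[k] Q).toLinearMap := ⟨by simp⟩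

end

namespace QuasiBialgebra

variable {k H : Type*} [Field k] [Ring H] [Algebra k H] (A : QuasiBialgebra k H)
  {B : Type*} [Ring B] [Algebra k B]

theorem contractL_comul (h : H) : contractL A.counit.toLinearMap (A.comul h) = h := by
  have := congrArg (TensorProduct.lid k H) (A.counit_left h)
  exact this.trans (by simp)

theorem contractR_comul (h : H) : contractR A.counit.toLinearMap (A.comul h) = h := by
  have := congrArg (TensorProduct.rid k H) (A.counit_right h)
  exact this.trans (by simp)

theorem conv_counit_left (f : H →ₗ[k] B) : A.conv (scalarMap B A.counit) f = f := by
  ext h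
  rw [conv_apply, joint_scalarMap_left, contractL_comul]

theorem conv_counit_right (f : H →ₗ[k] B) : A.conv f (scalarMap B A.counit) = f := by
  ext h
  rw [conv_apply, joint_scalarMap_right, contractR_comul]

section

variable (f g h : H →ₗ[k] B) [IsMulMap f] [IsMulMap g] [IsMulMap h] [CommRange f g]
  [CommRange f h] [CommRange g h]

/-- `phi f g h` as a unit, for commuting algebra maps. -/
def phiUnit : Bˣ := ⟨A.phi f g h, A.phiInv f g h, A.phi_mul_phiInv f g h, A.phiInv_mul_phi f g h⟩

end

theorem counital_mid_Φ :
    TensorProduct.map LinearMap.id (contractL A.counit.toLinearMap) (A.Φ : H ⊗[k] (H ⊗[k] H)) =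
      1 := by
  have := congrArg (TensorProduct.map LinearMap.id (TensorProduct.lid k H).toLinearMap) A.counit_Φ
  refine Eq.trans ?_ (this.trans ?_)
  · generalize (A.Φ : H ⊗[k] (H ⊗[k] H)) = W
    induction W using tensor₃_induction with
    | add x y hx hy => simp only [map_add, hx, hy]
    | tmul a b c => simp
  · simp [Algebra.TensorProduct.one_def]

theorem phi_counit_mid (f g : H →ₗ[k] B) [IsMulMap f] [IsMulMap g] [CommRange f g] :
    A.phi f (scalarMap B A.counit) g = 1 := by
  rw [phi, joint_scalarMap_mid, counital_mid_Φ, IsMulMap.map_one]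

/-- Only the counit in the middle leg is an axiom. With the counit in the first two slots the
pentagon reads P · P = P for this invertible element P, so P = 1. The last leg is treated in the
same way. -/
theorem phi_counit_fst (f g : H →ₗ[k] B) [IsMulMap f] [IsMulMap g] [CommRange f g] :
    A.phi (scalarMap B A.counit) f g = 1 := by
  have h := A.pentagon (scalarMap B A.counit) (scalarMap B A.counit) f g
  rw [conv_counit_left, conv_counit_left, phi_counit_mid, phi_counit_mid, mul_one, one_mul] at h
  have h2 := congrArg (A.phiInv (scalarMap B A.counit) f g * ·) h
  simpa only [phiInv_mul_phi_assoc, phiInv_mul_phi] using h2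

theorem phi_counit_last (f g : H →ₗ[k] B) [IsMulMap f] [IsMulMap g] [CommRange f g] :
    A.phi f g (scalarMap B A.counit) = 1 := by
  have h := A.pentagon f g (scalarMap B A.counit) (scalarMap B A.counit)
  rw [conv_counit_right, conv_counit_right, phi_counit_mid, phi_counit_mid, one_mul, mul_one] at h
  have h2 := congrArg (A.phiInv f g (scalarMap B A.counit) * ·) h
  simpa only [phiInv_mul_phi_assoc, phiInv_mul_phi] using h2

theorem phiInv_counit_mid (f g : H →ₗ[k] B) [IsMulMap f] [IsMulMap g] [CommRange f g] :
    A.phiInv f (scalarMap B A.counit) g = 1 := by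
  have := A.phi_mul_phiInv f (scalarMap B A.counit) g
  rwa [phi_counit_mid, one_mul] at this

theorem phiInv_counit_fst (f g : H →ₗ[k] B) [IsMulMap f] [IsMulMap g] [CommRange f g] :
    A.phiInv (scalarMap B A.counit) f g = 1 := by
  have := A.phi_mul_phiInv (scalarMap B A.counit) f g
  rwa [phi_counit_fst, one_mul] at this

theorem phiInv_counit_last (f g : H →ₗ[k] B) [IsMulMap f] [IsMulMap g] [CommRange f g] :
    A.phiInv f g (scalarMap B A.counit) = 1 := by
  have := A.phi_mul_phiInv f g (scalarMap B A.counit)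
  rwa [phi_counit_last, one_mul] at this

/-- The outer legs come from B = H ⊗ H and its two inclusions, for which `joint` is the identity. -/
theorem isCounital_Φ : A.IsCounital (A.Φ : H ⊗[k] (H ⊗[k] H)) where
  fst := by
    have := A.phi_counit_fst (Algebra.TensorProduct.includeLeft : H →ₐ[k] H ⊗[k] H).toLinearMap
      (Algebra.TensorProduct.includeRight : H →ₐ[k] H ⊗[k] H).toLinearMap
    rwa [phi, joint_scalarMap_left, joint_include] at this
  snd := A.counital_mid_Φ
  trd := by
    have := A.phi_counit_last (Algebra.TensorProduct.includeLeft : H →ₐ[k] H ⊗[k] H).toLinearMap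
      (Algebra.TensorProduct.includeRight : H →ₐ[k] H ⊗[k] H).toLinearMap
    rwa [phi, joint_scalarMap_last, joint_include] at this

theorem isCounital_Φ_inv : A.IsCounital (↑A.Φ⁻¹ : H ⊗[k] (H ⊗[k] H)) where
  fst := by
    have := A.phiInv_counit_fst (Algebra.TensorProduct.includeLeft : H →ₐ[k] H ⊗[k] H).toLinearMap
      (Algebra.TensorProduct.includeRight : H →ₐ[k] H ⊗[k] H).toLinearMap
    rwa [phiInv, joint_scalarMap_left, joint_include] at this
  snd := by
    have := A.phiInv_counit_mid (Algebra.TensorProduct.includeLeft : H →ₐ[k] H ⊗[k] H).toLinearMap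
      (Algebra.TensorProduct.includeRight : H →ₐ[k] H ⊗[k] H).toLinearMap
    rwa [phiInv, joint_scalarMap_mid, joint_include] at this
  trd := by
    have := A.phiInv_counit_last
      (Algebra.TensorProduct.includeLeft : H →ₐ[k] H ⊗[k] H).toLinearMap
      (Algebra.TensorProduct.includeRight : H →ₐ[k] H ⊗[k] H).toLinearMap
    rwa [phiInv, joint_scalarMap_last, joint_include] at this

section Absorb

variable {M : Type*} [AddCommGroup M] [Module k M] (F : B →ₗ[k] M) (f g p : H →ₗ[k] B)
  [IsMulMap f] [IsMulMap g] (y : B)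

section

variable (hF : ∀ x y, F (p x * y) = A.counit x • F y)
include hF

/-- A reassociator disappears as soon as one of its legs runs through a map that F absorbs with the
counit. Usually p is a convolution of two neighbouring legs of a chain, absorbed by an antipode
axiom. -/
theorem phi_left_fst [CommRange f g] : F (A.phi p f g * y) = F y := by
  rw [phi, absorb_left_fst F p _ A.counit.toLinearMap hF, A.isCounital_Φ.fst, IsMulMap.map_one,
    one_mul]

theorem phiInv_left_fst [CommRange f g] : F (A.phiInv p f g * y) = F y := by
  rw [phiInv, absorb_left_fst F p _ A.counit.toLinearMap hF, A.isCounital_Φ_inv.fst,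
    IsMulMap.map_one, one_mul]

theorem phi_left_snd [CommRange f g] [CommRange f p] : F (A.phi f p g * y) = F y := by
  rw [phi, absorb_left_snd F f p _ A.counit.toLinearMap hF, A.isCounital_Φ.snd, IsMulMap.map_one,
    one_mul]

theorem phiInv_left_snd [CommRange f g] [CommRange f p] : F (A.phiInv f p g * y) = F y := by
  rw [phiInv, absorb_left_snd F f p _ A.counit.toLinearMap hF, A.isCounital_Φ_inv.snd,
    IsMulMap.map_one, one_mul]

theorem phi_left_trd [CommRange f g] [CommRange f p] [CommRange g p] :
    F (A.phi f g p * y) = F y := by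
  rw [phi, absorb_left_trd F f p _ A.counit.toLinearMap hF, A.isCounital_Φ.trd, IsMulMap.map_one,
    one_mul]

theorem phiInv_left_trd [CommRange f g] [CommRange f p] [CommRange g p] :
    F (A.phiInv f g p * y) = F y := by
  rw [phiInv, absorb_left_trd F f p _ A.counit.toLinearMap hF, A.isCounital_Φ_inv.trd,
    IsMulMap.map_one, one_mul]

end

section

variable (hF : ∀ x y, F (y * p x) = A.counit x • F y)
include hF

theorem phi_right_fst [CommRange f g] [CommRange p f] [CommRange p g] :
    F (y * A.phi p f g) = F y := by
  rw [phi, absorb_right_fst F p _ A.counit.toLinearMap hF, A.isCounital_Φ.fst, IsMulMap.map_one,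
    mul_one]

theorem phiInv_right_fst [CommRange f g] [CommRange p f] [CommRange p g] :
    F (y * A.phiInv p f g) = F y := by
  rw [phiInv, absorb_right_fst F p _ A.counit.toLinearMap hF, A.isCounital_Φ_inv.fst,
    IsMulMap.map_one, mul_one]

theorem phi_right_snd [CommRange f g] [CommRange p g] : F (y * A.phi f p g) = F y := by
  rw [phi, absorb_right_snd F f p _ A.counit.toLinearMap hF, A.isCounital_Φ.snd, IsMulMap.map_one,
    mul_one]

theorem phiInv_right_snd [CommRange f g] [CommRange p g] : F (y * A.phiInv f p g) = F y := by
  rw [phiInv, absorb_right_snd F f p _ A.counit.toLinearMap hF, A.isCounital_Φ_inv.snd,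
    IsMulMap.map_one, mul_one]

theorem phi_right_trd [CommRange f g] : F (y * A.phi f g p) = F y := by
  rw [phi, absorb_right_trd F f p _ A.counit.toLinearMap hF, A.isCounital_Φ.trd, IsMulMap.map_one,
    mul_one]

theorem phiInv_right_trd [CommRange f g] : F (y * A.phiInv f g p) = F y := by
  rw [phiInv, absorb_right_trd F f p _ A.counit.toLinearMap hF, A.isCounital_Φ_inv.trd,
    IsMulMap.map_one, mul_one]

end

end Absorb

section PentagonForms

variable (f₁ f₂ f₃ f₄ : H →ₗ[k] B) [IsMulMap f₁] [IsMulMap f₂] [IsMulMap f₃] [IsMulMap f₄]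
  [CommRange f₁ f₂] [CommRange f₁ f₃] [CommRange f₁ f₄] [CommRange f₂ f₃] [CommRange f₂ f₄]
  [CommRange f₃ f₄]

theorem pentagon_unit :
    A.phiUnit f₂ f₃ f₄ * (A.phiUnit f₁ (A.conv f₂ f₃) f₄ * A.phiUnit f₁ f₂ f₃) =
      A.phiUnit f₁ f₂ (A.conv f₃ f₄) * A.phiUnit (A.conv f₁ f₂) f₃ f₄ :=
  Units.ext (A.pentagon f₁ f₂ f₃ f₄)

theorem pentagon_inv :
    A.phiInv f₁ f₂ f₃ * (A.phiInv f₁ (A.conv f₂ f₃) f₄ * A.phiInv f₂ f₃ f₄) =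
      A.phiInv (A.conv f₁ f₂) f₃ f₄ * A.phiInv f₁ f₂ (A.conv f₃ f₄) := by
  have h := congrArg (·⁻¹) (A.pentagon_unit f₁ f₂ f₃ f₄)
  simp only [mul_inv_rev, mul_assoc] at h
  exact congrArg Units.val h

/-- The pentagon solved for `phiInv f₂ f₃ f₄`. -/
theorem pentagon_phiInv₂₃₄ :
    A.phiInv f₂ f₃ f₄ = A.phi f₁ (A.conv f₂ f₃) f₄ * (A.phi f₁ f₂ f₃ *
      (A.phiInv (A.conv f₁ f₂) f₃ f₄ * A.phiInv f₁ f₂ (A.conv f₃ f₄))) := by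
  refine congrArg Units.val (?_ : (A.phiUnit f₂ f₃ f₄)⁻¹ = A.phiUnit f₁ (A.conv f₂ f₃) f₄ *
    (A.phiUnit f₁ f₂ f₃ * ((A.phiUnit (A.conv f₁ f₂) f₃ f₄)⁻¹ *
      (A.phiUnit f₁ f₂ (A.conv f₃ f₄))⁻¹)))
  rw [← mul_inv_rev, ← pentagon_unit]
  group

/-- The pentagon solved for `phi f₂ f₃ f₄`. -/
theorem pentagon_phi₂₃₄ :
    A.phi f₂ f₃ f₄ = A.phi f₁ f₂ (A.conv f₃ f₄) * (A.phi (A.conv f₁ f₂) f₃ f₄ *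
      (A.phiInv f₁ f₂ f₃ * A.phiInv f₁ (A.conv f₂ f₃) f₄)) := by
  refine congrArg Units.val (?_ : A.phiUnit f₂ f₃ f₄ = A.phiUnit f₁ f₂ (A.conv f₃ f₄) *
    (A.phiUnit (A.conv f₁ f₂) f₃ f₄ * ((A.phiUnit f₁ f₂ f₃)⁻¹ *
      (A.phiUnit f₁ (A.conv f₂ f₃) f₄)⁻¹)))
  rw [← mul_assoc, ← pentagon_unit]
  group

/-- The two forms of the element `B` that defines `δ`. -/
theorem pentagon_elemB :
    A.phi (A.conv f₁ f₂) f₃ f₄ * A.phiInv f₁ f₂ f₃ =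
      A.phiInv f₁ f₂ (A.conv f₃ f₄) * (A.phi f₂ f₃ f₄ * A.phi f₁ (A.conv f₂ f₃) f₄) := by
  refine congrArg Units.val (?_ : A.phiUnit (A.conv f₁ f₂) f₃ f₄ * (A.phiUnit f₁ f₂ f₃)⁻¹ =
    (A.phiUnit f₁ f₂ (A.conv f₃ f₄))⁻¹ * (A.phiUnit f₂ f₃ f₄ *
      A.phiUnit f₁ (A.conv f₂ f₃) f₄))
  rw [eq_inv_mul_iff_mul_eq, ← mul_assoc, ← pentagon_unit]
  group

/-- The two forms of the element `A` that defines `γ`. -/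
theorem pentagon_elemA :
    A.phi f₁ f₂ f₃ * A.phiInv (A.conv f₁ f₂) f₃ f₄ =
      A.phiInv f₁ (A.conv f₂ f₃) f₄ * (A.phiInv f₂ f₃ f₄ * A.phi f₁ f₂ (A.conv f₃ f₄)) := by
  refine congrArg Units.val (?_ : A.phiUnit f₁ f₂ f₃ * (A.phiUnit (A.conv f₁ f₂) f₃ f₄)⁻¹ =
    (A.phiUnit f₁ (A.conv f₂ f₃) f₄)⁻¹ * ((A.phiUnit f₂ f₃ f₄)⁻¹ *
      A.phiUnit f₁ f₂ (A.conv f₃ f₄)))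
  rw [mul_inv_eq_iff_eq_mul, mul_assoc, mul_assoc, ← pentagon_unit]
  group

theorem pentagon_phiInv_mul_phi :
    A.phiInv f₂ f₃ f₄ * A.phi f₁ f₂ (A.conv f₃ f₄) =
      A.phi f₁ (A.conv f₂ f₃) f₄ * (A.phi f₁ f₂ f₃ * A.phiInv (A.conv f₁ f₂) f₃ f₄) := by
  rw [pentagon_elemA, ← mul_assoc, phi_mul_phiInv, one_mul]

theorem pentagon_phiInv_mul_phi' :
    A.phiInv f₁ f₂ (A.conv f₃ f₄) * A.phi f₂ f₃ f₄ =
      A.phi (A.conv f₁ f₂) f₃ f₄ * (A.phiInv f₁ f₂ f₃ * A.phiInv f₁ (A.conv f₂ f₃) f₄) := by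
  rw [← mul_assoc, pentagon_elemB, mul_assoc, mul_assoc, phi_mul_phiInv, mul_one]

end PentagonForms

end QuasiBialgebra


/-! ### Antipodes along algebra maps, and the elements that relate them. -/

section

variable {k : Type*} [Field k] {P Q B M : Type*} [Ring P] [Algebra k P] [Ring Q] [Algebra k Q]
  [Ring B] [Algebra k B] [AddCommGroup M] [Module k M]

theorem absorb_right_snd' (F : B →ₗ[k] M) (p : P →ₗ[k] B) (q : Q →ₗ[k] B)
    (χ : P →ₗ[k] k) (hF : ∀ x y, F (y * p x) = χ x • F y) (W : Q ⊗[k] P) (y : B) :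
    F (y * joint q p W) = F (y * q (contractR χ W)) := by
  induction W using TensorProduct.induction_on with
  | zero => simp
  | add x x' hx hx' => simp only [mul_add, map_add, hx, hx']
  | tmul a b =>
    rw [joint_tmul, ← mul_assoc, hF]
    simp

variable {H : Type*} [Ring H] [Algebra k H] (l₁ l₂ l₃ l₄ : H →ₗ[k] B) (m₁ m₂ m₃ : B)

theorem quad_leg₁₂₃ (W : H ⊗[k] (H ⊗[k] H)) :
    quad l₁ m₁ l₂ m₂ l₃ m₃ l₄ (joint (leg₁ k H) (joint (leg₂ k H) (leg₃ k H)) W) =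
      joint (mulAfter l₁ m₁) (joint (mulAfter l₂ m₂) l₃) W * (m₃ * l₄ 1) := by
  induction W using tensor₃_induction with
  | add x y hx hy => simp only [map_add, hx, hy, add_mul]
  | tmul a b c => simp [mul_assoc]

theorem quad_leg₂₃₄ (W : H ⊗[k] (H ⊗[k] H)) :
    quad l₁ m₁ l₂ m₂ l₃ m₃ l₄ (joint (leg₂ k H) (joint (leg₃ k H) (leg₄ k H)) W) =
      l₁ 1 * m₁ * joint (mulAfter l₂ m₂) (joint (mulAfter l₃ m₃) l₄) W := by
  induction W using tensor₃_induction with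
  | add x y hx hy => simp only [map_add, hx, hy, mul_add]
  | tmul a b c => simp [mul_assoc]

theorem quad_leg₁_mul [IsMulMap l₁] (x : H) (y : Four k H) :
    quad l₁ m₁ l₂ m₂ l₃ m₃ l₄ (leg₁ k H x * y) = l₁ x * quad l₁ m₁ l₂ m₂ l₃ m₃ l₄ y := by
  induction y using Four.induction with
  | add y z hy hz => simp only [map_add, mul_add, hy, hz]
  | tmul a b c d => simp [mul_assoc, IsMulMap.map_mul]

theorem quad_mul_leg₁ [IsAntiMap l₁] (x : H) (y : Four k H) :
    quad l₁ m₁ l₂ m₂ l₃ m₃ l₄ (y * leg₁ k H x) = l₁ x * quad l₁ m₁ l₂ m₂ l₃ m₃ l₄ y := by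
  induction y using Four.induction with
  | add y z hy hz => simp only [map_add, mul_add, add_mul, hy, hz]
  | tmul a b c d => simp [mul_assoc, IsAntiMap.map_mul]

/-- A scalar-valued fourth map turns the chain into one of three slots that ends with l₃. -/
theorem quad_mul_leg₃ [IsMulMap l₃] (χ : H →ₐ[k] k) (x : H) (y : Four k H) :
    quad l₁ m₁ l₂ m₂ l₃ 1 (scalarMap B χ) (y * leg₃ k H x) =
      quad l₁ m₁ l₂ m₂ l₃ 1 (scalarMap B χ) y * l₃ x := by
  induction y using Four.induction with
  | add y z hy hz => simp only [map_add, add_mul, hy, hz]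
  | tmul a b c d => simp [mul_assoc, IsMulMap.map_mul, ← Algebra.commutes (χ d)]

theorem quad_leg₃_mul [IsAntiMap l₃] (χ : H →ₐ[k] k) (x : H) (y : Four k H) :
    quad l₁ m₁ l₂ m₂ l₃ 1 (scalarMap B χ) (leg₃ k H x * y) =
      quad l₁ m₁ l₂ m₂ l₃ 1 (scalarMap B χ) y * l₃ x := by
  induction y using Four.induction with
  | add y z hy hz => simp only [map_add, mul_add, add_mul, hy, hz]
  | tmul a b c d => simp [mul_assoc, IsAntiMap.map_mul, ← Algebra.commutes (χ d)]

end

namespace QuasiBialgebra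

variable {k H : Type*} [Field k] [Ring H] [Algebra k H] (A : QuasiBialgebra k H)
  {B : Type*} [Ring B] [Algebra k B]

/-- The antipode axioms for the algebra map `g : H → B`, with antipode `s : H → B` and with `a`,
`b` in the roles of `α`, `β`. -/
structure IsAntipode (g s : H →ₗ[k] B) (a b : B) : Prop where
  left : ∀ h, joint (mulAfter s a) g (A.comul h) = A.counit h • a
  right : ∀ h, joint (mulAfter g b) s (A.comul h) = A.counit h • b
  phi : joint (mulAfter g b) (joint (mulAfter s a) g) (A.Φ : H ⊗[k] (H ⊗[k] H)) = 1
  phiInv : joint (mulAfter s a) (joint (mulAfter g b) s) (↑A.Φ⁻¹ : H ⊗[k] (H ⊗[k] H)) = 1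

theorem IsAntipode.map {g s : H →ₗ[k] B} {a b : B} (h : A.IsAntipode g s a b)
    {C : Type*} [Ring C] [Algebra k C] (φ : B →ₗ[k] C) [IsMulMap φ] :
    A.IsAntipode (φ ∘ₗ g) (φ ∘ₗ s) (φ a) (φ b) := by
  have h2 (f g : H →ₗ[k] B) (m : B) (W : H ⊗[k] H) :
      joint (mulAfter (φ ∘ₗ f) (φ m)) (φ ∘ₗ g) W = φ (joint (mulAfter f m) g W) := by
    induction W using TensorProduct.induction_on with
    | zero => simp
    | add x y hx hy => simp only [map_add, hx, hy]
    | tmul a b => simp [IsMulMap.map_mul]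
  have h3 (f g e : H →ₗ[k] B) (m n : B) (W : H ⊗[k] (H ⊗[k] H)) :
      joint (mulAfter (φ ∘ₗ f) (φ m)) (joint (mulAfter (φ ∘ₗ g) (φ n)) (φ ∘ₗ e)) W =
        φ (joint (mulAfter f m) (joint (mulAfter g n) e) W) := by
    induction W using tensor₃_induction with
    | add x y hx hy => simp only [map_add, hx, hy]
    | tmul a b => simp [IsMulMap.map_mul]
  refine ⟨fun x => ?_, fun x => ?_, ?_, ?_⟩
  · rw [h2, h.left, map_smul]
  · rw [h2, h.right, map_smul]
  · rw [h3, h.phi, IsMulMap.map_one]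
  · rw [h3, h.phiInv, IsMulMap.map_one]

section QuadConv

variable (l₁ l₂ l₃ l₄ : H →ₗ[k] B) (m₁ m₂ m₃ : B)

theorem quad_conv_left₁₂ [IsAntiMap l₁] [IsMulMap l₂]
    (hD : ∀ h, joint (mulAfter l₁ m₁) l₂ (A.comul h) = A.counit h • m₁)
    (x : H) (y : Four k H) :
    quad l₁ m₁ l₂ m₂ l₃ m₃ l₄ (A.conv (leg₁ k H) (leg₂ k H) x * y) =
      A.counit x • quad l₁ m₁ l₂ m₂ l₃ m₃ l₄ y :=
  quad_left₁₂ l₁ l₂ l₃ l₄ m₁ m₂ m₃ (hD x) y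

theorem quad_conv_left₂₃ [IsAntiMap l₂] [IsMulMap l₃]
    (hD : ∀ h, joint (mulAfter l₂ m₂) l₃ (A.comul h) = A.counit h • m₂)
    (x : H) (y : Four k H) :
    quad l₁ m₁ l₂ m₂ l₃ m₃ l₄ (A.conv (leg₂ k H) (leg₃ k H) x * y) =
      A.counit x • quad l₁ m₁ l₂ m₂ l₃ m₃ l₄ y :=
  quad_left₂₃ l₁ l₂ l₃ l₄ m₁ m₂ m₃ (hD x) y

theorem quad_conv_left₃₄ [IsAntiMap l₃] [IsMulMap l₄]
    (hD : ∀ h, joint (mulAfter l₃ m₃) l₄ (A.comul h) = A.counit h • m₃)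
    (x : H) (y : Four k H) :
    quad l₁ m₁ l₂ m₂ l₃ m₃ l₄ (A.conv (leg₃ k H) (leg₄ k H) x * y) =
      A.counit x • quad l₁ m₁ l₂ m₂ l₃ m₃ l₄ y :=
  quad_left₃₄ l₁ l₂ l₃ l₄ m₁ m₂ m₃ (hD x) y

theorem quad_conv_right₁₂ [IsMulMap l₁] [IsAntiMap l₂]
    (hD : ∀ h, joint (mulAfter l₁ m₁) l₂ (A.comul h) = A.counit h • m₁)
    (x : H) (y : Four k H) :
    quad l₁ m₁ l₂ m₂ l₃ m₃ l₄ (y * A.conv (leg₁ k H) (leg₂ k H) x) =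
      A.counit x • quad l₁ m₁ l₂ m₂ l₃ m₃ l₄ y :=
  quad_right₁₂ l₁ l₂ l₃ l₄ m₁ m₂ m₃ (hD x) y

theorem quad_conv_right₂₃ [IsMulMap l₂] [IsAntiMap l₃]
    (hD : ∀ h, joint (mulAfter l₂ m₂) l₃ (A.comul h) = A.counit h • m₂)
    (x : H) (y : Four k H) :
    quad l₁ m₁ l₂ m₂ l₃ m₃ l₄ (y * A.conv (leg₂ k H) (leg₃ k H) x) =
      A.counit x • quad l₁ m₁ l₂ m₂ l₃ m₃ l₄ y :=
  quad_right₂₃ l₁ l₂ l₃ l₄ m₁ m₂ m₃ (hD x) y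

theorem quad_conv_right₃₄ [IsMulMap l₃] [IsAntiMap l₄]
    (hD : ∀ h, joint (mulAfter l₃ m₃) l₄ (A.comul h) = A.counit h • m₃)
    (x : H) (y : Four k H) :
    quad l₁ m₁ l₂ m₂ l₃ m₃ l₄ (y * A.conv (leg₃ k H) (leg₄ k H) x) =
      A.counit x • quad l₁ m₁ l₂ m₂ l₃ m₃ l₄ y :=
  quad_right₃₄ l₁ l₂ l₃ l₄ m₁ m₂ m₃ (hD x) y

end QuadConv

section Transfer

variable {g s : H →ₗ[k] B} {a b : B} [IsMulMap g] [IsAntiMap s] (f : H →ₗ[k] B) [IsMulMap f]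
  (z : B)

/-- `f(X¹) z s(X²) a g(X³)`. -/
def transfer (f : H →ₗ[k] B) (z : B) (s : H →ₗ[k] B) (a : B) (g : H →ₗ[k] B) : B :=
  joint (mulAfter f z) (joint (mulAfter s a) g) (A.Φ : H ⊗[k] (H ⊗[k] H))

/-- Evaluate quasi-coassociativity of x in the chain f z s a g. On one side the coproduct is
absorbed at z and x survives in the last slot; on the other it is absorbed at a and x survives in
the first. -/
theorem transfer_intertwines (hA : A.IsAntipode g s a b)
    (hz : ∀ h, joint (mulAfter f z) s (A.comul h) = A.counit h • z) (x : H) :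
    f x * A.transfer f z s a g = A.transfer f z s a g * g x := by
  obtain ⟨F, hF'⟩ : ∃ F, F = quad f z s a g 1 (scalarMap B A.counit) := ⟨_, rfl⟩
  have hr := A.quad_conv_right₁₂ f s g (scalarMap B A.counit) z a 1 hz
  have hl := A.quad_conv_left₂₃ f s g (scalarMap B A.counit) z a 1 hA.left
  have hF : F (A.phi (leg₁ k H) (leg₂ k H) (leg₃ k H)) = A.transfer f z s a g := by
    rw [hF', phi, quad_leg₁₂₃]
    simp [transfer]
  rw [← hF'] at hr hl
  have := congrArg F (A.phi_mul_conv (leg₁ k H) (leg₂ k H) (leg₃ k H) x)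
  rw [A.conv_apply (A.conv _ _), A.conv_apply _ (A.conv _ _),
    absorb_right_fst F (A.conv (leg₁ k H) (leg₂ k H)) (leg₃ k H) A.counit.toLinearMap hr,
    absorb_left_snd' F (A.conv (leg₂ k H) (leg₃ k H)) (leg₁ k H) A.counit.toLinearMap hl,
    contractL_comul, contractR_comul, hF', quad_mul_leg₃, quad_leg₁_mul, ← hF', hF] at this
  exact this.symm

/-- In the chain f z s a g b s the inverse reassociator on slots 2, 3, 4 evaluates to z by an
antipode axiom. Solving the pentagon for it, the other three factors are absorbed at a, b and z, and
the one on slots 1, 2, 3 is left. -/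
theorem transfer_mul (hA : A.IsAntipode g s a b)
    (hz : ∀ h, joint (mulAfter f z) s (A.comul h) = A.counit h • z) :
    A.transfer f z s a g * b = z := by
  obtain ⟨F, hF⟩ : ∃ F, F = quad f z s a g b s := ⟨_, rfl⟩
  have hz' := A.quad_conv_right₁₂ f s g s z a b hz
  have hl := A.quad_conv_left₂₃ f s g s z a b hA.left
  have hr := A.quad_conv_right₃₄ f s g s z a b hA.right
  have h1 : F (A.phiInv (leg₂ k H) (leg₃ k H) (leg₄ k H)) = z := by
    rw [hF, phiInv, quad_leg₂₃₄, hA.phiInv, IsMulMap.map_one, one_mul, mul_one]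
  rw [← hF] at hz' hl hr
  rw [A.pentagon_phiInv₂₃₄ (leg₁ k H), A.phi_left_snd F (leg₁ k H) (leg₄ k H) _ _ hl, ← mul_assoc,
    A.phiInv_right_trd F (leg₁ k H) (leg₂ k H) _ _ hr,
    A.phiInv_right_fst F (leg₃ k H) (leg₄ k H) _ _ hz'] at h1
  rwa [hF, phi, quad_leg₁₂₃, IsAntiMap.map_one, mul_one] at h1

end Transfer

section Cotransfer

variable {f s : H →ₗ[k] B} {a b : B} [IsMulMap f] [IsAntiMap s] (s' : H →ₗ[k] B) [IsAntiMap s']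
  (a' : B)

/-- `s'(x¹) a' f(x²) b s(x³)`, where `x¹ ⊗ x² ⊗ x³ = Φ⁻¹`. -/
def cotransfer (s' : H →ₗ[k] B) (a' : B) (f : H →ₗ[k] B) (b : B) (s : H →ₗ[k] B) : B :=
  joint (mulAfter s' a') (joint (mulAfter f b) s) (↑A.Φ⁻¹ : H ⊗[k] (H ⊗[k] H))

/-- The mirror image of `transfer`: it relates two anti-maps s and s' over one algebra map f, while
`transfer` relates two algebra maps over one anti-map. -/
theorem cotransfer_intertwines (hA : A.IsAntipode f s a b)
    (ha : ∀ h, joint (mulAfter s' a') f (A.comul h) = A.counit h • a') (x : H) :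
    A.cotransfer s' a' f b s * s x = s' x * A.cotransfer s' a' f b s := by
  obtain ⟨F, hF'⟩ : ∃ F, F = quad s' a' f b s 1 (scalarMap B A.counit) := ⟨_, rfl⟩
  have hr := A.quad_conv_right₂₃ s' f s (scalarMap B A.counit) a' b 1 hA.right
  have hl := A.quad_conv_left₁₂ s' f s (scalarMap B A.counit) a' b 1 ha
  have hF : F (A.phiInv (leg₁ k H) (leg₂ k H) (leg₃ k H)) = A.cotransfer s' a' f b s := by
    rw [hF', phiInv, quad_leg₁₂₃]
    simp [cotransfer]
  rw [← hF'] at hr hl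
  have := congrArg F (A.conv_mul_phiInv (leg₁ k H) (leg₂ k H) (leg₃ k H) x)
  rw [A.conv_apply (A.conv _ _), A.conv_apply _ (A.conv _ _),
    absorb_left_fst F (A.conv (leg₁ k H) (leg₂ k H)) (leg₃ k H) A.counit.toLinearMap hl,
    absorb_right_snd' F (A.conv (leg₂ k H) (leg₃ k H)) (leg₁ k H) A.counit.toLinearMap hr,
    contractL_comul, contractR_comul, hF', quad_mul_leg₁, quad_leg₃_mul, ← hF', hF] at this
  exact this

theorem cotransfer_mul (hA : A.IsAntipode f s a b)
    (ha : ∀ h, joint (mulAfter s' a') f (A.comul h) = A.counit h • a') :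
    A.cotransfer s' a' f b s * a = a' := by
  obtain ⟨F, hF⟩ : ∃ F, F = quad s' a' f b s a f := ⟨_, rfl⟩
  have hl := A.quad_conv_left₁₂ s' f s f a' b a ha
  have hr := A.quad_conv_right₂₃ s' f s f a' b a hA.right
  have hl' := A.quad_conv_left₃₄ s' f s f a' b a hA.left
  have h1 : F (A.phi (leg₂ k H) (leg₃ k H) (leg₄ k H)) = a' := by
    rw [hF, phi, quad_leg₂₃₄, hA.phi, IsAntiMap.map_one, one_mul, mul_one]
  rw [← hF] at hl hr hl'
  rw [A.pentagon_phi₂₃₄ (leg₁ k H), A.phi_left_trd F (leg₁ k H) (leg₂ k H) _ _ hl',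
    A.phi_left_fst F (leg₃ k H) (leg₄ k H) _ _ hl,
    A.phiInv_right_snd F (leg₁ k H) (leg₄ k H) _ _ hr] at h1
  rwa [hF, phiInv, quad_leg₁₂₃, IsMulMap.map_one, mul_one] at h1

end Cotransfer

end QuasiBialgebra

namespace QuasiHopfAlgebra

variable {k H : Type*} [Field k] [Ring H] [Algebra k H] (A : QuasiHopfAlgebra k H)

instance : IsAntiMap A.S := ⟨A.S_one, A.S_mul⟩

theorem isAntipode : A.IsAntipode LinearMap.id A.S A.α A.β :=
  ⟨A.antipode_left, A.antipode_right, A.antipode_Φ, A.antipode_Φ_inv⟩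

/-- Two algebra maps that agree on the image of the antipode are conjugate. -/
theorem exists_conj_of_eq_on_antipode {B : Type*} [Ring B] [Algebra k B] (f g : H →ₐ[k] B)
    (h : ∀ x, f (A.S x) = g (A.S x)) : ∃ c : Bˣ, ∀ x, f x * c = c * g x := by
  have hs : f.toLinearMap ∘ₗ A.S = g.toLinearMap ∘ₗ A.S := LinearMap.ext h
  have : IsAntiMap (f.toLinearMap ∘ₗ A.S) := IsMulMap.comp_anti _ _
  have hf := A.isAntipode.map _ f.toLinearMap
  have hg := A.isAntipode.map _ g.toLinearMap
  rw [LinearMap.comp_id] at hf hg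
  rw [← hs] at hg
  set s := f.toLinearMap ∘ₗ A.S
  -- The two transfers are mutually inverse: the first one, c, moves past g by intertwining, c b' =
  -- b, and what remains is the axiom X¹βS(X²)αX³ = 1 for f.
  have key (f g : H →ₐ[k] B) (a b a' b' : B) (hf : A.IsAntipode f.toLinearMap s a b)
      (hg : A.IsAntipode g.toLinearMap s a' b') :
      A.transfer f.toLinearMap b s a' g.toLinearMap *
        A.transfer g.toLinearMap b' s a f.toLinearMap = 1 := by
    rw [← hf.phi]
    have hi := A.transfer_intertwines f.toLinearMap b hg hf.right
    have hm := A.transfer_mul f.toLinearMap b hg hf.right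
    generalize A.transfer f.toLinearMap b s a' g.toLinearMap = c at *
    rw [QuasiBialgebra.transfer]
    generalize (A.Φ : H ⊗[k] (H ⊗[k] H)) = W
    induction W using TensorProduct.induction_on with
    | zero => simp
    | add x y hx hy => simp only [map_add, mul_add, hx, hy]
    | tmul x y =>
      simp only [joint_tmul, mulAfter_apply]
      rw [← mul_assoc, ← mul_assoc, ← hi, mul_assoc _ c, hm]
  refine ⟨⟨_, _, key f g _ _ _ _ hf hg, key g f _ _ _ _ hg hf⟩, fun x => ?_⟩
  exact A.transfer_intertwines f.toLinearMap _ hg hf.right x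

end QuasiHopfAlgebra


/-! ### The element p_R and its identities. -/

namespace QuasiBialgebra

variable {k H : Type*} [Field k] [Ring H] [Algebra k H] (A : QuasiBialgebra k H)
  {B : Type*} [Ring B] [Algebra k B]

section

variable {g s : H →ₗ[k] B} {a b : B} [IsMulMap g] [IsAntiMap s] (i : H →ₗ[k] B) [IsMulMap i]

/-- `i(x¹) g(x²) b s(x³)`, where `x¹ ⊗ x² ⊗ x³ = Φ⁻¹`. -/
def pElement (i g : H →ₗ[k] B) (b : B) (s : H →ₗ[k] B) : B :=
  joint i (joint (mulAfter g b) s) (↑A.Φ⁻¹ : H ⊗[k] (H ⊗[k] H))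

/-- In the second form of the element B the two outer reassociators are absorbed at a and at b, and
the middle one is an antipode axiom. -/
theorem quad_elemB (hA : A.IsAntipode g s a b) :
    quad i 1 g b s a g (A.phi (A.conv (leg₁ k H) (leg₂ k H)) (leg₃ k H) (leg₄ k H) *
      A.phiInv (leg₁ k H) (leg₂ k H) (leg₃ k H)) = 1 := by
  have hl := A.quad_conv_left₃₄ i g s g 1 b a hA.left
  have hr := A.quad_conv_right₂₃ i g s g 1 b a hA.right
  obtain ⟨F, hF⟩ : ∃ F, F = quad i 1 g b s a g := ⟨_, rfl⟩
  rw [← hF] at hl hr ⊢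
  rw [A.pentagon_elemB, A.phiInv_left_trd F (leg₁ k H) (leg₂ k H) _ _ hl,
    A.phi_right_snd F (leg₁ k H) (leg₄ k H) _ _ hr, hF, phi, quad_leg₂₃₄, hA.phi,
    IsMulMap.map_one]
  simp

theorem quad_phiInv_mul_phi (hA : A.IsAntipode g s a b) :
    quad g b s a g 1 i (A.phiInv (leg₂ k H) (leg₃ k H) (leg₄ k H) *
      A.phi (leg₁ k H) (leg₂ k H) (A.conv (leg₃ k H) (leg₄ k H))) = 1 := by
  have hl := A.quad_conv_left₂₃ g s g i b a 1 hA.left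
  have hr := A.quad_conv_right₁₂ g s g i b a 1 hA.right
  obtain ⟨F, hF⟩ : ∃ F, F = quad g b s a g 1 i := ⟨_, rfl⟩
  rw [← hF] at hl hr ⊢
  rw [A.pentagon_phiInv_mul_phi, A.phi_left_snd F (leg₁ k H) (leg₄ k H) _ _ hl,
    A.phiInv_right_fst F (leg₃ k H) (leg₄ k H) _ _ hr, hF, phi, quad_leg₁₂₃, hA.phi,
    IsMulMap.map_one]
  simp

/-- `Δ(X¹) p (1 ⊗ S(X²) α X³) = 1`. -/
theorem conv_mul_pElement [CommRange i g] (hA : A.IsAntipode g s a b) :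
    joint (mulAfter (A.conv i g) (A.pElement i g b s)) (joint (mulAfter s a) g)
      (A.Φ : H ⊗[k] (H ⊗[k] H)) = 1 := by
  rw [← A.quad_elemB i hA, pElement, phi, phiInv]
  generalize (A.Φ : H ⊗[k] (H ⊗[k] H)) = W
  generalize (↑A.Φ⁻¹ : H ⊗[k] (H ⊗[k] H)) = V
  induction W using tensor₃_induction with
  | add x y hx hy => simp only [map_add, add_mul, hx, hy]
  | tmul x y z =>
    simp only [joint_tmul, mulAfter_apply, conv_apply]
    generalize A.comul x = D
    induction V using tensor₃_induction with
    | add x y hx hy => simp only [map_add, add_mul, mul_add, hx, hy]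
    | tmul u v w =>
      induction D using TensorProduct.induction_on with
      | zero => simp
      | add x y hx hy => simp only [map_add, add_mul, hx, hy]
      | tmul p q =>
        simp only [joint_tmul, mulAfter_apply, leg₁_apply, leg₂_apply, leg₃_apply, leg₄_apply,
          Four.tmul_mul_tmul, quad_tmul, mul_one, one_mul, IsMulMap.map_mul, IsAntiMap.map_mul,
          mul_assoc]
        rw [← mul_assoc (g q) (i u), ← CommRange.comm (f := i) (g := g) u q, mul_assoc]

/-- `Δ(h₁) p (1 ⊗ S(h₂)) = p (h ⊗ 1)`. -/
theorem conv_pElement [CommRange i g] [CommRange i s] (hib : ∀ x, i x * b = b * i x)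
    (hA : A.IsAntipode g s a b) (h : H) :
    joint (mulAfter (A.conv i g) (A.pElement i g b s)) s (A.comul h) =
      A.pElement i g b s * i h := by
  have hr := A.quad_conv_right₂₃ i g s (scalarMap B A.counit) 1 b 1 hA.right
  have key : quad i 1 g b s 1 (scalarMap B A.counit)
      (A.conv (A.conv (leg₁ k H) (leg₂ k H)) (leg₃ k H) h *
        A.phiInv (leg₁ k H) (leg₂ k H) (leg₃ k H)) =
      quad i 1 g b s 1 (scalarMap B A.counit)
        (A.phiInv (leg₁ k H) (leg₂ k H) (leg₃ k H) * leg₁ k H h) := by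
    obtain ⟨F, hF⟩ : ∃ F, F = quad i 1 g b s 1 (scalarMap B A.counit) := ⟨_, rfl⟩
    rw [← hF] at hr ⊢
    rw [conv_mul_phiInv, A.conv_apply (leg₁ k H), absorb_right_snd' F
      (A.conv (leg₂ k H) (leg₃ k H)) (leg₁ k H) A.counit.toLinearMap hr, contractR_comul]
  refine Eq.trans ?_ (key.trans ?_)
  · rw [A.conv_apply (A.conv _ _), pElement, phiInv]
    generalize (↑A.Φ⁻¹ : H ⊗[k] (H ⊗[k] H)) = V
    generalize A.comul h = E
    induction E using TensorProduct.induction_on with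
    | zero => simp
    | add x y hx hy => simp only [map_add, add_mul, hx, hy]
    | tmul x y =>
      simp only [joint_tmul, mulAfter_apply, conv_apply]
      generalize A.comul x = D
      induction V using tensor₃_induction with
      | add x y hx hy => simp only [map_add, add_mul, mul_add, hx, hy]
      | tmul u v w =>
        induction D using TensorProduct.induction_on with
        | zero => simp
        | add x y hx hy => simp only [map_add, add_mul, hx, hy]
        | tmul p q =>
          simp only [joint_tmul, mulAfter_apply, leg₁_apply, leg₂_apply, leg₃_apply,
            Four.tmul_mul_tmul, quad_tmul, mul_one, one_mul, IsMulMap.map_mul, IsAntiMap.map_mul,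
            IsMulMap.map_one, mul_assoc]
          rw [← mul_assoc (g q) (i u), ← CommRange.comm (f := i) (g := g) u q, mul_assoc]
  · rw [pElement, phiInv]
    generalize (↑A.Φ⁻¹ : H ⊗[k] (H ⊗[k] H)) = V
    induction V using tensor₃_induction with
    | add x y hx hy => simp only [map_add, add_mul, hx, hy]
    | tmul u v w =>
      simp only [joint_tmul, mulAfter_apply, leg₁_apply, leg₂_apply, leg₃_apply,
        Four.tmul_mul_tmul, quad_tmul, mul_one, one_mul, IsMulMap.map_mul, IsMulMap.map_one,
        mul_assoc]
      rw [← CommRange.comm (f := i) (g := s), ← mul_assoc b, ← hib, mul_assoc,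
        ← mul_assoc (g v) (i h), ← CommRange.comm (f := i) (g := g), mul_assoc]

/-- `(X¹ β S(X²) ⊗ 1) (S(x¹) α x² ⊗ x³) Δ(X³) = 1`. -/
theorem phiInv_mul_conv [CommRange i g] (hA : A.IsAntipode g s a b) :
    joint (mulAfter g b) (joint (mulAfter s (joint (mulAfter s a) (joint g i)
      (↑A.Φ⁻¹ : H ⊗[k] (H ⊗[k] H)))) (A.conv g i)) (A.Φ : H ⊗[k] (H ⊗[k] H)) = 1 := by
  rw [← A.quad_phiInv_mul_phi i hA, phi, phiInv]
  generalize (A.Φ : H ⊗[k] (H ⊗[k] H)) = W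
  generalize (↑A.Φ⁻¹ : H ⊗[k] (H ⊗[k] H)) = V
  induction W using tensor₃_induction with
  | add x y hx hy => simp only [map_add, mul_add, hx, hy]
  | tmul x y z =>
    simp only [joint_tmul, mulAfter_apply, conv_apply]
    generalize A.comul z = D
    induction V using tensor₃_induction with
    | add x y hx hy => simp only [map_add, add_mul, mul_add, hx, hy]
    | tmul u v w =>
      induction D using TensorProduct.induction_on with
      | zero => simp
      | add x y hx hy => simp only [map_add, mul_add, hx, hy]
      | tmul p q =>
        simp only [joint_tmul, mulAfter_apply, leg₁_apply, leg₂_apply, leg₃_apply, leg₄_apply,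
          Four.tmul_mul_tmul, quad_tmul, mul_one, one_mul, IsMulMap.map_mul, IsAntiMap.map_mul,
          mul_assoc]
        rw [← mul_assoc (i w) (g p), CommRange.comm (f := i) (g := g) w p, mul_assoc]

end

end QuasiBialgebra


/-! ### Bijectivity of the antipode. -/

namespace QuasiHopfAlgebra

variable {k H : Type*} [Field k] [Ring H] [Algebra k H] (A : QuasiHopfAlgebra k H)

/-- The algebra map `op ∘ f ∘ S`. -/
def opAntipode {B : Type*} [Ring B] [Algebra k B] (f : H →ₐ[k] B) : H →ₐ[k] Bᵐᵒᵖ :=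
  AlgHom.ofLinearMap ((MulOpposite.opLinearEquiv k).toLinearMap ∘ₗ f.toLinearMap ∘ₗ A.S)
    (by simp [A.S_one]) (by simp [A.S_mul])

theorem opAntipode_apply {B : Type*} [Ring B] [Algebra k B] (f : H →ₐ[k] B) (x : H) :
    A.opAntipode f x = MulOpposite.op (f (A.S x)) := rfl

/-- The induction passes to the opposite algebra, where op ∘ f ∘ S is an algebra map. The induction
hypothesis conjugates f ∘ S to g ∘ S; once g is conjugated by the element found, the two maps agree
on S(H), and `exists_conj_of_eq_on_antipode` applies. -/
theorem exists_conj_of_eq_on_iterate (n : ℕ) {B : Type*} [Ring B] [Algebra k B]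
    (f g : H →ₐ[k] B) (h : ∀ x, f (A.S^[n] x) = g (A.S^[n] x)) :
    ∃ c : Bˣ, ∀ x, f x * c = c * g x := by
  induction n generalizing B with
  | zero => exact ⟨1, fun x => by simpa using h x⟩
  | succ n ih =>
    obtain ⟨c, hc⟩ := ih (A.opAntipode f) (A.opAntipode g) (fun x => by
      rw [opAntipode_apply, opAntipode_apply, ← Function.iterate_succ_apply' A.S, h])
    obtain ⟨d, rfl⟩ : ∃ d : Bˣ, (Units.opEquiv.symm (MulOpposite.op d)) = c :=
      ⟨(Units.opEquiv c).unop, by simp⟩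
    replace hc (x : H) : (d : B) * f (A.S x) = g (A.S x) * d :=
      congrArg MulOpposite.unop (hc x)
    let g' : H →ₐ[k] B := AlgHom.ofLinearMap
      (LinearMap.mulLeft k (↑d⁻¹ : B) ∘ₗ LinearMap.mulRight k (d : B) ∘ₗ g.toLinearMap)
      (by simp) (fun x y => by simp [mul_assoc])
    have hg' (x : H) : g' x = ↑d⁻¹ * (g x * d) := rfl
    obtain ⟨e, he⟩ := A.exists_conj_of_eq_on_antipode f g' (fun x => by
      rw [hg', ← hc, Units.inv_mul_cancel_left])
    refine ⟨e * d⁻¹, fun x => ?_⟩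
    rw [Units.val_mul, ← mul_assoc, he, hg', mul_assoc, mul_assoc, mul_assoc, mul_assoc,
      Units.mul_inv, mul_one]

theorem antipode_sq_pow_mul (n : ℕ) (x y : H) :
    (A.S ^ (2 * n)) (x * y) = (A.S ^ (2 * n)) x * (A.S ^ (2 * n)) y := by
  induction n with
  | zero => rfl
  | succ n ih => simp [mul_add_one, pow_succ', Module.End.mul_apply, ih, A.S_mul]

theorem antipode_pow_one (n : ℕ) : (A.S ^ n) 1 = 1 := by
  induction n with
  | zero => rfl
  | succ n ih => simp [pow_succ', Module.End.mul_apply, ih, A.S_one]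

/-- The even powers of the antipode, as algebra maps. -/
def antipodeSqPow (n : ℕ) : H →ₐ[k] H :=
  AlgHom.ofLinearMap (A.S ^ (2 * n)) (A.antipode_pow_one _) (A.antipode_sq_pow_mul n)

/-- For a high even power ψ of S the kernel and the range are disjoint, so ψ restricts to an
automorphism of its range. Then g = (ψ restricted)⁻¹ ∘ ψ fixes the range of ψ, hence is conjugate to
the identity; but g kills ker ψ, which contains ker S. -/
theorem antipode_bijective [FiniteDimensional k H] : Function.Bijective A.S := by
  have hinj : Function.Injective A.S := by
    obtain ⟨N, hN⟩ := Filter.eventually_atTop.mp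
      (Module.End.eventually_disjoint_ker_pow_range_pow A.S)
    -- The exponent is even so that the power is an algebra map, and positive so that its kernel
    -- contains that of S; this is why N + 1 is used instead of N.
    replace hN := hN (2 * (N + 1)) (by omega)
    let ψ := A.antipodeSqPow (N + 1)
    have hψ (x : H) : ψ x = (A.S ^ (2 * (N + 1))) x := rfl
    let e : ψ.range →ₐ[k] ψ.range := ψ.rangeRestrict.comp ψ.range.val
    have he : Function.Injective e := by
      refine (injective_iff_map_eq_zero e).mpr fun r hr => ?_
      have h1 : ψ (r : H) = 0 := congrArg Subtype.val hr
      obtain ⟨y, hy⟩ := r.2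
      exact Subtype.ext (Submodule.disjoint_def.mp hN r h1 ⟨y, hy⟩)
    have he' : Function.Bijective e :=
      ⟨he, (LinearMap.injective_iff_surjective (f := e.toLinearMap)).mp he⟩
    let E := AlgEquiv.ofBijective e he'
    let g : H →ₐ[k] H := ψ.range.val.comp (E.symm.toAlgHom.comp ψ.rangeRestrict)
    have hg (x : H) : g (ψ x) = ψ x := by
      have : E.symm (ψ.rangeRestrict (ψ x)) = ψ.rangeRestrict x := by
        rw [AlgEquiv.symm_apply_eq]
        rfl
      exact congrArg Subtype.val this
    obtain ⟨c, hc⟩ := A.exists_conj_of_eq_on_iterate (2 * (N + 1)) (AlgHom.id k H) g (fun x => by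
      rw [← Module.End.pow_apply, ← hψ, hg]
      rfl)
    refine (injective_iff_map_eq_zero A.S).mpr fun x hx => ?_
    have h1 : ψ x = 0 := by
      rw [hψ, mul_add_one, pow_add, Module.End.mul_apply, pow_two, Module.End.mul_apply, hx]
      simp
    have h2 : g x = 0 := by
      have : ψ.rangeRestrict x = 0 := Subtype.ext h1
      simp [g, this]
    have h3 := hc x
    rw [h2, mul_zero, AlgHom.id_apply] at h3
    simpa using h3
  exact ⟨hinj, LinearMap.injective_iff_surjective.mp hinj⟩

end QuasiHopfAlgebra


/-! ### Hexagons and naturality of R for commuting algebra maps. -/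

section

variable {k H : Type*} [Field k] [Ring H] [Algebra k H] {B : Type*} [Ring B] [Algebra k B]

theorem joint_flip₂ (f g : H →ₗ[k] B) [CommRange f g] (W : H ⊗[k] H) :
    joint g f (flip₂ W) = joint f g W := by
  induction W using TensorProduct.induction_on with
  | zero => simp
  | add x y hx hy => simp only [map_add, hx, hy]
  | tmul a b => simp [flip₂, CommRange.comm (f := f) (g := g)]

variable (f g h : H →ₗ[k] B)

theorem joint_perm132 [CommRange g h] (W : H ⊗[k] (H ⊗[k] H)) :
    joint f (joint g h) (perm132 W) = joint f (joint h g) W := by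
  have := CommRange.symm g h
  induction W using TensorProduct.induction_on with
  | zero => simp
  | add x y hx hy => simp only [map_add, hx, hy]
  | tmul a b => simp [perm132, joint_flip₂]

theorem joint_perm312 [CommRange f h] [CommRange g h] (W : H ⊗[k] (H ⊗[k] H)) :
    joint f (joint g h) (perm312 W) = joint h (joint f g) W := by
  induction W using tensor₃_induction with
  | add x y hx hy => simp only [map_add, hx, hy]
  | tmul a b c =>
    trans f b * (g c * h a)
    · simp [perm312, assocHom]
    · rw [← mul_assoc]
      exact CommRange.comm (f := joint f g) (g := h) (b ⊗ₜ c) a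

theorem joint_perm231 [CommRange f g] [CommRange f h] (W : H ⊗[k] (H ⊗[k] H)) :
    joint f (joint g h) (perm231 W) = joint g (joint h f) W := by
  induction W using tensor₃_induction with
  | add x y hx hy => simp only [map_add, hx, hy]
  | tmul a b c =>
    trans f c * (g a * h b)
    · simp [perm231, assocInvHom]
    · exact (CommRange.comm (f := f) (g := joint g h) c (a ⊗ₜ b)).trans (mul_assoc _ _ _)

theorem joint_perm213 [CommRange f g] [CommRange f h] [CommRange g h] (W : H ⊗[k] (H ⊗[k] H)) :
    joint f (joint g h) (perm213 W) = joint g (joint f h) W := by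
  have := CommRange.symm g h
  rw [perm213, AlgHom.comp_apply, joint_perm132, joint_perm312]

theorem joint_place12 [IsMulMap h] (W : H ⊗[k] H) :
    joint f (joint g h) (place12 W) = joint f g W := by
  induction W using TensorProduct.induction_on with
  | zero => simp
  | add x y hx hy => simp only [map_add, hx, hy]
  | tmul a b => simp [place12, IsMulMap.map_one]

theorem joint_place13 [IsMulMap g] (W : H ⊗[k] H) :
    joint f (joint g h) (place13 W) = joint f h W := by
  induction W using TensorProduct.induction_on with
  | zero => simp
  | add x y hx hy => simp only [map_add, hx, hy]
  | tmul a b => simp [place13, IsMulMap.map_one]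

theorem joint_place23 [IsMulMap f] (W : H ⊗[k] H) :
    joint f (joint g h) (place23 W) = joint g h W := by
  induction W using TensorProduct.induction_on with
  | zero => simp
  | add x y hx hy => simp only [map_add, hx, hy]
  | tmul a b => simp [place23, IsMulMap.map_one]

end

namespace QuasiHopfAlgebra

variable {k H : Type*} [Field k] [Ring H] [Algebra k H] {A : QuasiHopfAlgebra k H}
  {B : Type*} [Ring B] [Algebra k B] {R : H ⊗[k] H}

namespace IsRMatrix

variable (hR : A.IsRMatrix R)
include hR

section

variable (f g h : H →ₗ[k] B) [IsMulMap f] [IsMulMap g] [IsMulMap h] [CommRange f g]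
  [CommRange f h] [CommRange g h]

/-- In this form Φ₃₁₂ and Φ⁻¹₁₃₂ are just `phi` and `phiInv` with reordered arguments, so the
hexagon can be used in any choice of slots. -/
theorem joint_conv_left : joint (A.conv f g) h R =
    A.phi h f g * joint f h R * A.phiInv f h g * joint g h R * A.phi f g h := by
  have h1 (W : H ⊗[k] H) : joint f (joint g h) (assocHom H H H
      (Algebra.TensorProduct.map A.comul (AlgHom.id k H) W)) = joint (A.conv f g) h W := by
    induction W using TensorProduct.induction_on with
    | zero => simp
    | add x y hx hy => simp only [map_add, hx, hy]
    | tmul p q =>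
      rw [joint_tmul, QuasiBialgebra.conv_apply, Algebra.TensorProduct.map_tmul, AlgHom.id_apply]
      generalize A.comul p = D
      induction D using TensorProduct.induction_on with
      | zero => simp
      | add x y hx hy => simp only [TensorProduct.add_tmul, map_add, hx, hy, add_mul]
      | tmul r s => simp [assocHom, mul_assoc]
  have := congrArg (joint f (joint g h)) hR.comul_left
  rwa [h1, IsMulMap.map_mul (f := joint f (joint g h)), IsMulMap.map_mul (f := joint f (joint g h)),
    IsMulMap.map_mul (f := joint f (joint g h)), IsMulMap.map_mul (f := joint f (joint g h)),
    joint_perm312, joint_perm132, joint_place13, joint_place23] at this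

theorem joint_conv_right : joint f (A.conv g h) R =
    A.phiInv g h f * joint f h R * A.phi g f h * joint f g R * A.phiInv f g h := by
  have h1 (W : H ⊗[k] H) : joint f (joint g h)
      (Algebra.TensorProduct.map (AlgHom.id k H) A.comul W) = joint f (A.conv g h) W := by
    induction W using TensorProduct.induction_on with
    | zero => simp
    | add x y hx hy => simp only [map_add, hx, hy]
    | tmul p q => simp [QuasiBialgebra.conv_apply]
  have := congrArg (joint f (joint g h)) hR.comul_right
  rwa [h1, IsMulMap.map_mul (f := joint f (joint g h)), IsMulMap.map_mul (f := joint f (joint g h)),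
    IsMulMap.map_mul (f := joint f (joint g h)), IsMulMap.map_mul (f := joint f (joint g h)),
    joint_perm231, joint_perm213, joint_place13, joint_place12] at this

end

section

variable (f g : H →ₗ[k] B) [IsMulMap f] [IsMulMap g] [CommRange f g]

theorem conv_mul_joint (x : H) :
    A.conv g f x * joint f g R = joint f g R * A.conv f g x := by
  have := congrArg (joint f g) (hR.intertwine x)
  have := CommRange.symm f g
  rwa [IsMulMap.map_mul (f := joint f g), IsMulMap.map_mul (f := joint f g), joint_flip₂] at *

/-- Here and in the next three lemmas, R exchanges Δᵒᵖ for Δ when the coproduct sits in one leg of a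
longer tensor; they are used to move R past reassociators. -/
theorem joint_conv_mul {P : Type*} [Ring P] [Algebra k P] (h : P →ₗ[k] B) [CommRange f h]
    [CommRange g h] (W : H ⊗[k] P) :
    joint (A.conv g f) h W * joint f g R = joint f g R * joint (A.conv f g) h W := by
  induction W using TensorProduct.induction_on with
  | zero => simp
  | add x y hx hy => simp only [map_add, mul_add, add_mul, hx, hy]
  | tmul a b =>
    rw [joint_tmul, joint_tmul, mul_assoc, ← CommRange.comm (f := joint f g) (g := h),
      ← mul_assoc, hR.conv_mul_joint, mul_assoc]

theorem joint_mid_conv_mul {P Q : Type*} [Ring P] [Algebra k P] [Ring Q] [Algebra k Q]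
    (h : P →ₗ[k] B) (h' : Q →ₗ[k] B) [CommRange f h] [CommRange g h] [CommRange f h']
    [CommRange g h'] (W : P ⊗[k] (H ⊗[k] Q)) :
    joint h (joint (A.conv g f) h') W * joint f g R =
      joint f g R * joint h (joint (A.conv f g) h') W := by
  induction W using TensorProduct.induction_on with
  | zero => simp
  | add x y hx hy => simp only [map_add, mul_add, add_mul, hx, hy]
  | tmul a b =>
    rw [joint_tmul, joint_tmul, mul_assoc, hR.joint_conv_mul, ← mul_assoc,
      ← CommRange.comm (f := joint f g) (g := h), mul_assoc]

theorem joint_conv_mul' {P : Type*} [Ring P] [Algebra k P] (h : P →ₗ[k] B) [CommRange f h]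
    [CommRange g h] (W : P ⊗[k] H) :
    joint h (A.conv g f) W * joint f g R = joint f g R * joint h (A.conv f g) W := by
  induction W using TensorProduct.induction_on with
  | zero => simp
  | add x y hx hy => simp only [map_add, mul_add, add_mul, hx, hy]
  | tmul a b =>
    rw [joint_tmul, joint_tmul, mul_assoc, hR.conv_mul_joint, ← mul_assoc,
      ← CommRange.comm (f := joint f g) (g := h), mul_assoc]

theorem joint_last_conv_mul {P Q : Type*} [Ring P] [Algebra k P] [Ring Q] [Algebra k Q]
    (h : P →ₗ[k] B) (h' : Q →ₗ[k] B) [CommRange f h] [CommRange g h] [CommRange f h']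
    [CommRange g h'] (W : P ⊗[k] (Q ⊗[k] H)) :
    joint h (joint h' (A.conv g f)) W * joint f g R =
      joint f g R * joint h (joint h' (A.conv f g)) W := by
  induction W using TensorProduct.induction_on with
  | zero => simp
  | add x y hx hy => simp only [map_add, mul_add, add_mul, hx, hy]
  | tmul a b =>
    rw [joint_tmul, joint_tmul, mul_assoc, hR.joint_conv_mul', ← mul_assoc,
      ← CommRange.comm (f := joint f g) (g := h), mul_assoc]

end

end IsRMatrix

end QuasiHopfAlgebra


/-! ### The Drinfeld element and the square of the antipode. -/

namespace QuasiHopfAlgebra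

variable {k H : Type*} [Field k] [Ring H] [Algebra k H] (A : QuasiHopfAlgebra k H)

theorem antipode_comp : IsMulMap (A.S ∘ₗ A.S) := IsAntiMap.comp_anti _ _

theorem antipode_antipode_left (h : H) :
    joint (mulAfter A.S (A.S A.α)) (A.S ∘ₗ A.S) (flip₂ (A.comul h)) =
      A.counit h • A.S A.α := by
  rw [← map_smul, ← A.antipode_left]
  generalize A.comul h = D
  induction D using TensorProduct.induction_on with
  | zero => simp
  | add x y hx hy => simp only [map_add, hx, hy]
  | tmul a b => simp [flip₂, evMap, A.S_mul, mul_assoc]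

/-- `s₁ ⊗ s₃ ⊗ s₄ ⊗ s₂ ↦ S(s₁) α s₃ β S(s₄) S(α) S²(s₂)`. -/
def chainMap : Four k H →ₗ[k] H :=
  quad A.S A.α LinearMap.id A.β A.S (A.S A.α) (A.S ∘ₗ A.S)

-- The indices number the legs as the pentagon and the hexagons use them, whereas the chain
-- multiplies them in the order 1, 3, 4, 2. In this order it absorbs coproducts on the pairs (1,3)
-- and (2,4) from the left and on (3,4) from the right.
local notation "ℓ₁" => leg₁ k H
local notation "ℓ₃" => leg₂ k H
local notation "ℓ₄" => leg₃ k H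
local notation "ℓ₂" => leg₄ k H

theorem chainMap_left₁₃ (x : H) (y : Four k H) :
    A.chainMap (A.conv ℓ₁ ℓ₃ x * y) = A.counit x • A.chainMap y :=
  A.quad_conv_left₁₂ A.S LinearMap.id A.S (A.S ∘ₗ A.S) A.α A.β (A.S A.α) A.isAntipode.left x y

theorem chainMap_right₃₄ (x : H) (y : Four k H) :
    A.chainMap (y * A.conv ℓ₃ ℓ₄ x) = A.counit x • A.chainMap y :=
  A.quad_conv_right₂₃ A.S LinearMap.id A.S (A.S ∘ₗ A.S) A.α A.β (A.S A.α) A.isAntipode.right x y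

theorem chainMap_left₂₄ (x : H) (y : Four k H) :
    A.chainMap (A.conv ℓ₂ ℓ₄ x * y) = A.counit x • A.chainMap y := by
  have := A.antipode_comp
  rw [QuasiBialgebra.conv_apply, ← joint_flip₂]
  exact quad_left₃₄ _ _ _ _ _ _ _ (A.antipode_antipode_left x) y

variable {A} {R : H ⊗[k] H}

/-- The element `a = S(R²) α R¹`. -/
def evR (A : QuasiHopfAlgebra k H) (R : H ⊗[k] H) : H := evMap A.S A.α (flip₂ R)

/-- The element `w = R¹ β S(R²)`. -/
def coevR (A : QuasiHopfAlgebra k H) (R : H ⊗[k] H) : H := coevMap A.S A.β R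

theorem IsRMatrix.contractL_eq_one (hR : A.IsRMatrix R) :
    QuasiHopf.contractL A.counit.toLinearMap R = 1 := by
  have := congrArg (TensorProduct.lid k H) hR.counit_left
  exact this.trans (by simp)

theorem IsRMatrix.contractR_eq_one (hR : A.IsRMatrix R) :
    QuasiHopf.contractR A.counit.toLinearMap R = 1 := by
  have := congrArg (TensorProduct.rid k H) hR.counit_right
  exact this.trans (by simp)

/-- This identity compares R¹βS(R²) with S(R²)αR¹. Both hexagons enter, each applied to a coproduct
that the chain absorbs: the second to R on (1,(24)), the first to R on ((13),4). -/
theorem IsRMatrix.chainMap_eq (hR : A.IsRMatrix R) :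
    A.chainMap (A.phiInv ℓ₂ ℓ₄ ℓ₃ * joint ℓ₃ ℓ₄ R) =
      A.chainMap (A.phiInv ℓ₁ ℓ₃ ℓ₄ * joint ℓ₁ ℓ₂ R) := by
  have hl := A.chainMap_left₁₃
  have hl' := A.chainMap_left₂₄
  have hr := A.chainMap_right₃₄
  obtain ⟨T, hT⟩ : ∃ T, T = A.chainMap := ⟨_, rfl⟩
  rw [← hT] at hl hl' hr ⊢
  have e1 (y : Four k H) : T (joint ℓ₁ (A.conv ℓ₂ ℓ₄) R *
      (A.phiInv ℓ₁ (A.conv ℓ₂ ℓ₄) ℓ₃ * y)) = T y := by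
    rw [absorb_left_snd' T (A.conv ℓ₂ ℓ₄) ℓ₁ A.counit.toLinearMap hl', hR.contractR_eq_one,
      IsMulMap.map_one, one_mul, A.phiInv_left_snd T ℓ₁ ℓ₃ _ _ hl']
  have e2 (y : Four k H) : T (A.phi ℓ₄ ℓ₁ ℓ₃ * y) =
      T (A.phiInv ℓ₂ ℓ₄ ℓ₁ * (A.phiInv ℓ₂ (A.conv ℓ₄ ℓ₁) ℓ₃ * y)) := by
    have h := A.pentagon_inv ℓ₂ ℓ₄ ℓ₁ ℓ₃
    have h2 := congrArg (fun z => T (z * (A.phi ℓ₄ ℓ₁ ℓ₃ * y))) h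
    simp only [mul_assoc, QuasiBialgebra.phiInv_mul_phi_assoc] at h2
    rw [h2, A.phiInv_left_fst T ℓ₁ ℓ₃ _ _ hl', A.phiInv_left_trd T ℓ₂ ℓ₄ _ _ hl]
  have e3 (y : Four k H) : T (A.phi ℓ₄ ℓ₁ ℓ₃ * (joint ℓ₁ ℓ₄ R * (A.phiInv ℓ₁ ℓ₄ ℓ₃ *
      (joint ℓ₃ ℓ₄ R * y)))) = T (A.phiInv ℓ₁ ℓ₃ ℓ₄ * y) := by
    have h := congrArg (fun z => T (z * (A.phiInv ℓ₁ ℓ₃ ℓ₄ * y))) (hR.joint_conv_left ℓ₁ ℓ₃ ℓ₄)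
    simp only [mul_assoc, QuasiBialgebra.phi_mul_phiInv_assoc] at h
    rw [← h, absorb_left_fst T (A.conv ℓ₁ ℓ₃) ℓ₄ A.counit.toLinearMap hl, hR.contractL_eq_one,
      IsMulMap.map_one, one_mul]
  have e4 (y : Four k H) : T (y * (A.phi ℓ₂ ℓ₁ (A.conv ℓ₃ ℓ₄) * joint ℓ₁ ℓ₂ R)) =
      T (y * joint ℓ₁ ℓ₂ R) := by
    rw [← mul_assoc]
    refine A.phi_right_trd (T ∘ₗ LinearMap.mulRight k (joint ℓ₁ ℓ₂ R)) ℓ₂ ℓ₁ (A.conv ℓ₃ ℓ₄) y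
      fun x z => ?_
    simp only [LinearMap.comp_apply, LinearMap.mulRight_apply]
    rw [mul_assoc, ← CommRange.comm (f := joint ℓ₁ ℓ₂), ← mul_assoc, hr]
  have e5 (y : Four k H) : T (y * A.phiInv ℓ₁ ℓ₂ (A.conv ℓ₃ ℓ₄)) = T y :=
    A.phiInv_right_trd T ℓ₁ ℓ₂ (A.conv ℓ₃ ℓ₄) y hr
  have s1 : A.phiInv ℓ₁ ℓ₂ (A.conv ℓ₄ ℓ₃) * joint ℓ₃ ℓ₄ R =
      joint ℓ₃ ℓ₄ R * A.phiInv ℓ₁ ℓ₂ (A.conv ℓ₃ ℓ₄) := hR.joint_last_conv_mul ℓ₃ ℓ₄ ℓ₁ ℓ₂ _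
  have s2 (y : Four k H) : joint ℓ₁ ℓ₂ R * (A.phiInv (A.conv ℓ₁ ℓ₂) ℓ₄ ℓ₃ * y) =
      A.phiInv (A.conv ℓ₂ ℓ₁) ℓ₄ ℓ₃ * (joint ℓ₁ ℓ₂ R * y) := by
    rw [← mul_assoc, ← mul_assoc]
    exact congrArg (· * y) (hR.joint_conv_mul ℓ₁ ℓ₂ (joint ℓ₄ ℓ₃) _).symm
  have s3 (y : Four k H) : A.phi ℓ₂ ℓ₁ ℓ₄ * (A.phiInv (A.conv ℓ₂ ℓ₁) ℓ₄ ℓ₃ * y) =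
      A.phiInv ℓ₂ (A.conv ℓ₁ ℓ₄) ℓ₃ * (A.phiInv ℓ₁ ℓ₄ ℓ₃ *
        (A.phi ℓ₂ ℓ₁ (A.conv ℓ₄ ℓ₃) * y)) := by
    rw [← mul_assoc, A.pentagon_elemA ℓ₂ ℓ₁ ℓ₄ ℓ₃]
    simp only [mul_assoc]
  have s4 (y : Four k H) : joint ℓ₁ ℓ₄ R * (A.phiInv ℓ₂ (A.conv ℓ₁ ℓ₄) ℓ₃ * y) =
      A.phiInv ℓ₂ (A.conv ℓ₄ ℓ₁) ℓ₃ * (joint ℓ₁ ℓ₄ R * y) := by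
    rw [← mul_assoc, ← mul_assoc]
    exact congrArg (· * y) (hR.joint_mid_conv_mul ℓ₁ ℓ₄ ℓ₂ ℓ₃ _).symm
  have s5 (y : Four k H) : A.phi ℓ₂ ℓ₁ (A.conv ℓ₄ ℓ₃) * (joint ℓ₃ ℓ₄ R * y) =
      joint ℓ₃ ℓ₄ R * (A.phi ℓ₂ ℓ₁ (A.conv ℓ₃ ℓ₄) * y) := by
    rw [← mul_assoc, ← mul_assoc]
    exact congrArg (· * y) (hR.joint_last_conv_mul ℓ₃ ℓ₄ ℓ₂ ℓ₁ _)
  have s6 (y : Four k H) : joint ℓ₁ ℓ₂ R * (joint ℓ₃ ℓ₄ R * y) =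
      joint ℓ₃ ℓ₄ R * (joint ℓ₁ ℓ₂ R * y) := by
    rw [← mul_assoc, ← mul_assoc, CommRange.comm (f := joint ℓ₁ ℓ₂) (g := joint ℓ₃ ℓ₄)]
  have s7 := congrArg (· * joint ℓ₃ ℓ₄ R) (A.pentagon_inv ℓ₁ ℓ₂ ℓ₄ ℓ₃)
  simp only [mul_assoc] at s7
  -- The trivial factor of `e1` is inserted and expanded by the second hexagon. The pentagon and
  -- naturality then carry R₃₄ to the place where `e2` and `e3` recognise the first hexagon, which
  -- is absorbed.
  rw [← e1, hR.joint_conv_right ℓ₁ ℓ₂ ℓ₄]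
  simp only [mul_assoc]
  rw [s7, s1, s2, s3, s4, s6, s5, ← e2, e3, ← mul_assoc (A.phi _ _ _), ← mul_assoc, e5, e4]

end QuasiHopfAlgebra


section

variable {k H : Type*} [Field k] [Ring H] [Algebra k H]

@[simp] theorem evMap_tmul (S : H →ₗ[k] H) (a x y : H) : evMap S a (x ⊗ₜ y) = S x * a * y := rfl

@[simp] theorem coevMap_tmul (S : H →ₗ[k] H) (b x y : H) :
    coevMap S b (x ⊗ₜ y) = x * b * S y := rfl

@[simp] theorem flip₂_tmul (x y : H) : flip₂ (k := k) (x ⊗ₜ y) = y ⊗ₜ x := rfl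

theorem flip₂_flip₂ (W : H ⊗[k] H) : flip₂ (flip₂ W) = W := by
  induction W using TensorProduct.induction_on with
  | zero => simp
  | add x y hx hy => simp only [map_add, hx, hy]
  | tmul a b => simp

variable (S : H →ₗ[k] H) [IsAntiMap S] (a : H) (V W : H ⊗[k] H)

omit [IsAntiMap S] in
theorem evMap_add (b : H) : evMap S (a + b) W = evMap S a W + evMap S b W := by
  induction W using TensorProduct.induction_on with
  | zero => simp
  | add x y hx hy => simp only [map_add, hx, hy]; abel
  | tmul p q => simp [mul_add, add_mul]

omit [IsAntiMap S] in
theorem coevMap_add (b : H) : coevMap S (a + b) W = coevMap S a W + coevMap S b W := by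
  induction W using TensorProduct.induction_on with
  | zero => simp
  | add x y hx hy => simp only [map_add, hx, hy]; abel
  | tmul p q => simp [mul_add, add_mul]

omit [IsAntiMap S] in
theorem evMap_smul (r : k) : evMap S (r • a) W = r • evMap S a W := by
  induction W using TensorProduct.induction_on with
  | zero => simp
  | add x y hx hy => simp only [map_add, hx, hy, smul_add]
  | tmul a b => simp

omit [IsAntiMap S] in
theorem coevMap_smul (r : k) : coevMap S (r • a) W = r • coevMap S a W := by
  induction W using TensorProduct.induction_on with
  | zero => simp
  | add x y hx hy => simp only [map_add, hx, hy, smul_add]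
  | tmul a b => simp

/-- `S(w¹) (S(v¹) α v²) w²`. -/
theorem evMap_mul : evMap S a (V * W) = evMap S (evMap S a V) W := by
  induction V using TensorProduct.induction_on with
  | zero => simpa using (evMap_smul S 0 W 0).symm
  | add x y hx hy => rw [add_mul, map_add, hx, hy, map_add, evMap_add]
  | tmul p q =>
    induction W using TensorProduct.induction_on with
    | zero => simp
    | add x y hx hy => simp only [map_add, mul_add, ← hx, ← hy]
    | tmul a b => simp [IsAntiMap.map_mul, mul_assoc]

/-- `v¹ (w¹ β S(w²)) S(v²)`. -/
theorem coevMap_mul : coevMap S a (V * W) = coevMap S (coevMap S a W) V := by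
  induction W using TensorProduct.induction_on with
  | zero => simpa using (coevMap_smul S 0 V 0).symm
  | add x y hx hy => rw [mul_add, map_add, hx, hy, map_add, coevMap_add]
  | tmul p q =>
    induction V using TensorProduct.induction_on with
    | zero => simp
    | add x y hx hy => simp only [map_add, add_mul, ← hx, ← hy]
    | tmul a b => simp [IsAntiMap.map_mul, mul_assoc]

theorem joint_S_evMap :
    joint (mulAfter S (S a)) (S ∘ₗ S) W = S (evMap S a (flip₂ W)) := by
  induction W using TensorProduct.induction_on with
  | zero => simp
  | add x y hx hy => simp only [map_add, hx, hy]
  | tmul p q => simp [IsAntiMap.map_mul, mul_assoc]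

theorem joint_S_coevMap :
    joint (mulAfter (S ∘ₗ S) (S a)) S W = S (coevMap S a (flip₂ W)) := by
  induction W using TensorProduct.induction_on with
  | zero => simp
  | add x y hx hy => simp only [map_add, hx, hy]
  | tmul p q => simp [IsAntiMap.map_mul, mul_assoc]

end

namespace QuasiHopfAlgebra

variable {k H : Type*} [Field k] [Ring H] [Algebra k H] {A : QuasiHopfAlgebra k H} {R : H ⊗[k] H}

namespace IsRMatrix

variable (hR : A.IsRMatrix R)
include hR

theorem coevMap_coevR (h : H) :
    coevMap A.S (A.coevR R) (flip₂ (A.comul h)) = A.counit h • A.coevR R := by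
  rw [coevR, ← coevMap_mul, hR.intertwine, coevMap_mul, A.antipode_right, coevMap_smul]

theorem S_coevR_left (h : H) :
    joint (mulAfter (A.S ∘ₗ A.S) (A.S (A.coevR R))) A.S (A.comul h) =
      A.counit h • A.S (A.coevR R) := by
  rw [joint_S_coevMap, hR.coevMap_coevR, map_smul]

end IsRMatrix

variable (A) in
/-- The element `v = q² R¹ β S(q¹ R²)`, where `q_R = q¹ ⊗ q²`. -/
def coevQR (R : H ⊗[k] H) : H := coevMap A.S A.β (flip₂ A.qR * R)

theorem S_drinfeldElement : A.S (A.drinfeldElement R) =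
    A.cotransfer A.S (A.S (A.evR R)) (A.S ∘ₗ A.S) (A.S (A.S A.β)) (A.S ∘ₗ A.S ∘ₗ A.S) := by
  rw [drinfeldElement, map_mul, evMap_mul, ← evR, pR, QuasiBialgebra.cotransfer]
  generalize (↑A.Φ⁻¹ : H ⊗[k] (H ⊗[k] H)) = W
  induction W using tensor₃_induction with
  | add x y hx hy => simp only [map_add, hx, hy]
  | tmul a b c => simp [A.S_mul, mul_assoc]

theorem chainMap_evR : A.chainMap (A.phiInv (leg₁ k H) (leg₂ k H) (leg₃ k H) *
    joint (leg₁ k H) (leg₄ k H) R) = A.S (A.evR R) := by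
  trans joint (mulAfter A.S (joint (mulAfter A.S A.α) (joint (mulAfter LinearMap.id A.β) A.S)
    (↑A.Φ⁻¹ : H ⊗[k] (H ⊗[k] H)) * A.S A.α)) (A.S ∘ₗ A.S) R
  · rw [chainMap, QuasiBialgebra.phiInv]
    generalize (↑A.Φ⁻¹ : H ⊗[k] (H ⊗[k] H)) = W
    induction W using tensor₃_induction with
    | add x y hx hy =>
      simp only [map_add, add_mul, hx, hy]
      clear hx hy
      induction R using TensorProduct.induction_on with
      | zero => simp
      | add x y hx hy => simp only [map_add, ← hx, ← hy]; abel
      | tmul p q => simp [mul_add, add_mul]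
    | tmul a b c =>
      induction R using TensorProduct.induction_on with
      | zero => simp
      | add x y hx hy => simp only [map_add, mul_add, hx, hy]
      | tmul p q => simp [A.S_mul, mul_assoc]
  · rw [A.isAntipode.phiInv, one_mul, joint_S_evMap, evR]

theorem S_chainMap_coevR : A.S (A.chainMap (A.phiInv (leg₄ k H) (leg₃ k H) (leg₂ k H) *
    joint (leg₂ k H) (leg₃ k H) R)) =
      joint (A.S ∘ₗ A.S ∘ₗ A.S) (joint (mulAfter (LinearMap.mulLeft k (A.S (A.S A.α)) ∘ₗ A.S ∘ₗ A.S)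
        (A.S (A.coevR R))) A.S) (↑A.Φ⁻¹ : H ⊗[k] (H ⊗[k] H)) * A.S A.α := by
  rw [chainMap, QuasiBialgebra.phiInv]
  generalize (↑A.Φ⁻¹ : H ⊗[k] (H ⊗[k] H)) = W
  induction W using tensor₃_induction with
  | add x y hx hy => simp only [map_add, add_mul, hx, hy]
  | tmul a b c =>
    simp only [joint_tmul, mulAfter_apply, coevR]
    induction R using TensorProduct.induction_on with
    | zero => simp
    | add x y hx hy => simp only [map_add, mul_add, add_mul, hx, hy]
    | tmul p q => simp [A.S_mul, A.S_one, mul_assoc]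

variable [FiniteDimensional k H]

theorem S_Sinv (x : H) : A.S (A.Sinv x) = x := by
  rw [Sinv, dif_pos A.antipode_bijective]
  exact LinearEquiv.apply_symm_apply (LinearEquiv.ofBijective A.S A.antipode_bijective) x

/-- For v = q²R¹βS(q¹R²) this presents S(v) as a `transfer` between the identity and S². The general
lemmas then give its commutation rule and its product with β. -/
theorem S_coevQR : A.S (A.coevQR R) =
    A.transfer (A.S ∘ₗ A.S) (A.S (A.coevR R)) A.S A.α LinearMap.id := by
  rw [coevQR, coevMap_mul, ← coevR, qR, QuasiBialgebra.transfer]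
  generalize (A.Φ : H ⊗[k] (H ⊗[k] H)) = W
  induction W using tensor₃_induction with
  | add x y hx hy => simp only [map_add, hx, hy]
  | tmul a b c => simp [A.S_mul, S_Sinv, mul_assoc]

namespace IsRMatrix

variable (hR : A.IsRMatrix R)
include hR

theorem S_coevQR_mul (h : H) : A.S (A.coevQR R) * h = A.S (A.S h) * A.S (A.coevQR R) := by
  have := A.antipode_comp
  rw [S_coevQR]
  exact (A.transfer_intertwines (A.S ∘ₗ A.S) _ A.isAntipode hR.S_coevR_left h).symm

theorem S_coevQR_mul_β : A.S (A.coevQR R) * A.β = A.S (A.coevR R) := by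
  have := A.antipode_comp
  rw [S_coevQR]
  exact A.transfer_mul (A.S ∘ₗ A.S) _ A.isAntipode hR.S_coevR_left

theorem coevQR_mul (h : H) : A.coevQR R * A.S (A.S h) = h * A.coevQR R := by
  refine A.antipode_bijective.1 ?_
  rw [A.S_mul, A.S_mul, hR.S_coevQR_mul]

/-- After applying S, the right side is one side of `chainMap_eq` and the other side contains
S(R¹βS(R²)) = S(v)β. Moving S(v) through by S(v)h = S²(h)S(v) leaves S(x¹)αx²βS(x³) = 1. -/
theorem α_mul_coevQR : A.α * A.coevQR R = A.S (A.evR R) := by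
  refine A.antipode_bijective.1 ?_
  rw [← chainMap_evR, ← hR.chainMap_eq, S_chainMap_coevR, A.S_mul]
  congr 1
  rw [← hR.S_coevQR_mul_β]
  refine ((congrArg (A.S (A.coevQR R) * ·) A.isAntipode.phiInv).trans (mul_one _)).symm.trans ?_
  generalize (↑A.Φ⁻¹ : H ⊗[k] (H ⊗[k] H)) = W
  induction W using tensor₃_induction with
  | add x y hx hy => simp only [map_add, mul_add, hx, hy]
  | tmul a b c =>
    simp only [joint_tmul, mulAfter_apply, LinearMap.comp_apply, LinearMap.mulLeft_apply,
      LinearMap.id_apply, ← mul_assoc, hR.S_coevQR_mul]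
    simp only [A.S_mul, mul_assoc, hR.S_coevQR_mul]

/-- S(u) is the `cotransfer` S(x¹) S(S(R²)αR¹) S²(x²βS(x³)). By `α_mul_coevQR` its middle factor is
αv, and v S²(h) = h v carries v to the right end of S(x¹)αx²βS(x³) = 1. -/
theorem antipode_drinfeldElement : A.S (A.drinfeldElement R) = A.coevQR R := by
  rw [S_drinfeldElement, ← hR.α_mul_coevQR, QuasiBialgebra.cotransfer]
  refine Eq.trans ?_ ((congrArg (· * A.coevQR R) A.isAntipode.phiInv).trans (one_mul _))
  generalize (↑A.Φ⁻¹ : H ⊗[k] (H ⊗[k] H)) = W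
  induction W using tensor₃_induction with
  | add x y hx hy => simp only [map_add, add_mul, hx, hy]
  | tmul a b c =>
    have h := hR.coevQR_mul (b * A.β * A.S c)
    simp only [A.S_mul] at h
    simp only [joint_tmul, mulAfter_apply, LinearMap.comp_apply, LinearMap.id_apply]
    rw [mul_assoc (A.S a * A.α), ← h]
    simp only [mul_assoc]

theorem drinfeldElement_mul (h : H) :
    A.drinfeldElement R * h = A.S (A.S h) * A.drinfeldElement R := by
  refine A.antipode_bijective.1 ?_
  rw [A.S_mul, A.S_mul, hR.antipode_drinfeldElement, hR.coevQR_mul]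

/-- Under S both sides become αv; injectivity of S finishes the proof. -/
theorem evR_eq : A.evR R = A.S A.α * A.drinfeldElement R := by
  refine A.antipode_bijective.1 ?_
  rw [A.S_mul, hR.antipode_drinfeldElement, ← hR.α_mul_coevQR, hR.coevQR_mul]

end IsRMatrix

end QuasiHopfAlgebra


/-! ### The coproduct of an integral, and formula 1). -/

section

variable {k H : Type*} [Field k] [Ring H] [Algebra k H]

variable (k H) in
/-- The map `a ↦ a ⊗ 1`. -/
def inl : H →ₗ[k] H ⊗[k] H := (Algebra.TensorProduct.includeLeft : H →ₐ[k] H ⊗[k] H).toLinearMap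

variable (k H) in
/-- The map `a ↦ 1 ⊗ a`. -/
def inr : H →ₗ[k] H ⊗[k] H := (Algebra.TensorProduct.includeRight : H →ₐ[k] H ⊗[k] H).toLinearMap

@[simp] theorem inl_apply (a : H) : inl k H a = a ⊗ₜ 1 := rfl
@[simp] theorem inr_apply (a : H) : inr k H a = 1 ⊗ₜ a := rfl

instance : IsMulMap (B := H ⊗[k] H) (inl k H) := by unfold inl; infer_instance
instance : IsMulMap (B := H ⊗[k] H) (inr k H) := by unfold inr; infer_instance
instance : CommRange (B := H ⊗[k] H) (inl k H) (inr k H) := ⟨by simp⟩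
instance : CommRange (B := H ⊗[k] H) (inr k H) (inl k H) := ⟨by simp⟩

theorem joint_inl_inr (W : H ⊗[k] H) : joint (B := H ⊗[k] H) (inl k H) (inr k H) W = W :=
  joint_include W

end

namespace QuasiHopfAlgebra

variable {k H : Type*} [Field k] [Ring H] [Algebra k H] (A : QuasiHopfAlgebra k H)

instance : IsAntiMap (B := H ⊗[k] H) (inr k H ∘ₗ A.S) := IsMulMap.comp_anti _ _

theorem isAntipode_inr : A.IsAntipode (B := H ⊗[k] H) (inr k H) (inr k H ∘ₗ A.S) (inr k H A.α)
    (inr k H A.β) := A.isAntipode.map A.toQuasiBialgebra (C := H ⊗[k] H) (inr k H)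

/-- The map `id ⊗ S`. -/
def idS : H ⊗[k] H →ₗ[k] H ⊗[k] H := TensorProduct.map LinearMap.id A.S

@[simp] theorem idS_tmul (a b : H) : A.idS (a ⊗ₜ b) = a ⊗ₜ A.S b := rfl

theorem joint_idS (V W : H ⊗[k] H) :
    joint (B := H ⊗[k] H) (mulAfter (B := H ⊗[k] H) (inl k H) (A.idS V)) (inr k H ∘ₗ A.S) W =
      A.idS (W * V) := by
  induction W using TensorProduct.induction_on with
  | zero => simp
  | add x y hx hy => rw [map_add, hx, hy, add_mul, map_add]
  | tmul a b =>
    rw [joint_tmul, mulAfter_apply]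
    induction V using TensorProduct.induction_on with
    | zero => simp
    | add x y hx hy => rw [map_add, mul_add, add_mul, hx, hy, mul_add, map_add]
    | tmul c d => simp [A.S_mul]

theorem idS_inr_mul (h : H) (V : H ⊗[k] H) :
    A.idS (((1 : H) ⊗ₜ h) * V) = A.idS V * (1 ⊗ₜ A.S h) := by
  induction V using TensorProduct.induction_on with
  | zero => simp
  | add x y hx hy => rw [map_add, mul_add, add_mul, map_add, hx, hy]
  | tmul c d => simp [A.S_mul]

theorem idS_inl_mul (h : H) (V : H ⊗[k] H) :
    A.idS ((h ⊗ₜ (1 : H)) * V) = (h ⊗ₜ 1) * A.idS V := by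
  induction V using TensorProduct.induction_on with
  | zero => simp
  | add x y hx hy => rw [map_add, mul_add, mul_add, map_add, hx, hy]
  | tmul c d => simp

theorem IsLeftIntegral.comul {t : H} (ht : A.IsLeftIntegral t) (h : H) :
    A.comul h * A.comul t = A.counit h • A.comul t := by
  rw [← map_mul, ht, map_smul]

section

variable [FiniteDimensional k H]

theorem Sinv_S (x : H) : A.Sinv (A.S x) = x := A.antipode_bijective.1 (A.S_Sinv _)

theorem idS_injective : Function.Injective A.idS := by
  refine Function.LeftInverse.injective (g := TensorProduct.map LinearMap.id A.Sinv) fun W => ?_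
  induction W using TensorProduct.induction_on with
  | zero => simp
  | add x y hx hy => simp only [map_add, hx, hy]
  | tmul c d => simp [A.Sinv_S]

/-- Applying id ⊗ S removes the S⁻¹ from q_R and makes q_R V a `transfer` with values in H ⊗ H. For
V = Δ(t) the two lemmas on `transfer` become `one_tmul_mul` and `Sinv_mul`. -/
theorem transfer_idS (V : H ⊗[k] H) :
    A.transfer (B := H ⊗[k] H) (inl k H) (A.idS V) (inr k H ∘ₗ A.S) (inr k H A.α) (inr k H) =
      A.idS (A.qR * V) := by
  rw [qR, QuasiBialgebra.transfer]
  generalize (A.Φ : H ⊗[k] (H ⊗[k] H)) = W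
  induction W using tensor₃_induction with
  | add x y hx hy => rw [map_add, hx, hy, map_add, add_mul, map_add]
  | tmul a b c =>
    rw [joint_tmul, joint_tmul, mulAfter_apply, mulAfter_apply]
    induction V using TensorProduct.induction_on with
    | zero => simp
    | add x y hx hy => rw [map_add, mul_add, add_mul, hx, hy, mul_add, map_add]
    | tmul p q => simp [A.S_mul, S_Sinv, mul_assoc]

variable {A} {t : H} (ht : A.IsLeftIntegral t)
include ht

omit [FiniteDimensional k H] in
theorem IsLeftIntegral.idS_antipode (h : H) :
    joint (B := H ⊗[k] H) (mulAfter (B := H ⊗[k] H) (inl k H) (A.idS (A.comul t)))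
      (inr k H ∘ₗ A.S) (A.comul h) = A.counit h • A.idS (A.comul t) := by
  rw [joint_idS, IsLeftIntegral.comul A ht, map_smul]

/-- `(1 ⊗ h) q_R Δ(t) = (S(h) ⊗ 1) q_R Δ(t)`. -/
theorem IsLeftIntegral.one_tmul_mul (h : H) : ((1 : H) ⊗ₜ[k] h) * (A.qR * A.comul t) =
    (A.S h ⊗ₜ (1 : H)) * (A.qR * A.comul t) := by
  refine A.idS_injective ?_
  rw [idS_inr_mul, idS_inl_mul, ← transfer_idS]
  exact (A.transfer_intertwines (B := H ⊗[k] H) (inl k H) _ A.isAntipode_inr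
    ht.idS_antipode (A.S h)).symm

theorem IsLeftIntegral.Sinv_mul :
    ((1 : H) ⊗ₜ[k] A.Sinv A.β) * (A.qR * A.comul t) = A.comul t := by
  refine A.idS_injective ?_
  rw [idS_inr_mul, S_Sinv, ← transfer_idS]
  exact A.transfer_mul (B := H ⊗[k] H) (inl k H) _ A.isAntipode_inr ht.idS_antipode

/-- `y Δ(t) = (y¹ β S(y²) ⊗ 1) q_R Δ(t)`. -/
theorem IsLeftIntegral.mul_comul (y : H ⊗[k] H) :
    y * A.comul t = (coevMap A.S A.β y ⊗ₜ (1 : H)) * (A.qR * A.comul t) := by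
  induction y using TensorProduct.induction_on with
  | zero => simp
  | add x y hx hy => rw [add_mul, hx, hy, map_add, TensorProduct.add_tmul, add_mul]
  | tmul p q =>
    nth_rw 1 [← ht.Sinv_mul]
    rw [← mul_assoc, show (p ⊗ₜ[k] q) * ((1 : H) ⊗ₜ[k] A.Sinv A.β) =
      (p ⊗ₜ[k] (1 : H)) * ((1 : H) ⊗ₜ[k] (q * A.Sinv A.β)) by simp, mul_assoc, ht.one_tmul_mul,
      ← mul_assoc, A.S_mul, S_Sinv]
    simp [mul_assoc]

/-- This is `mul_comul` for y = (q_R)₂₁R, whose contraction y¹βS(y²) is S(u). -/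
theorem IsLeftIntegral.flip_qR_mul {R : H ⊗[k] H} (hR : A.IsRMatrix R) :
    flip₂ A.qR * R * A.comul t =
      (A.S (A.drinfeldElement R) ⊗ₜ (1 : H)) * (A.qR * A.comul t) := by
  rw [ht.mul_comul, hR.antipode_drinfeldElement, coevQR]

end

section

variable (χ : H →ₐ[k] k)

/-- `χ(X¹) S(X²) α X³`. -/
def twistedα : H := contractL χ.toLinearMap
  (TensorProduct.map LinearMap.id (evMap A.S A.α) (A.Φ : H ⊗[k] (H ⊗[k] H)))

/-- `S(y¹ ↼ χ) (χ(X¹) S(X²) α X³) y²`. -/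
def twistedEv : H ⊗[k] H →ₗ[k] H :=
  evMap A.S (A.twistedα χ) ∘ₗ TensorProduct.map (A.harpoon χ.toLinearMap) LinearMap.id

theorem pElement_inr :
    A.pElement (B := H ⊗[k] H) (inl k H) (inr k H) (inr k H A.β) (inr k H ∘ₗ A.S) = A.pR := by
  rw [pR, QuasiBialgebra.pElement]
  generalize (↑A.Φ⁻¹ : H ⊗[k] (H ⊗[k] H)) = W
  induction W using tensor₃_induction with
  | add x y hx hy => rw [map_add, hx, hy, map_add]
  | tmul a b c => simp [mul_assoc]

theorem conv_inl_inr : A.conv (B := H ⊗[k] H) (inl k H) (inr k H) = A.comul.toLinearMap := by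
  ext h
  exact joint_inl_inr _

instance : CommRange (B := H ⊗[k] H) (inl k H) (inr k H ∘ₗ A.S) := ⟨by simp⟩

theorem comul_mul_pR (h : H) :
    joint (B := H ⊗[k] H) (mulAfter (B := H ⊗[k] H) A.comul.toLinearMap A.pR) (inr k H ∘ₗ A.S)
      (A.comul h) = A.pR * (h ⊗ₜ 1) := by
  have := A.conv_pElement (B := H ⊗[k] H) (inl k H) (by simp) A.isAntipode_inr h
  rwa [pElement_inr, conv_inl_inr] at this

theorem comul_mul_pR_Φ :
    joint (B := H ⊗[k] H) (mulAfter (B := H ⊗[k] H) A.comul.toLinearMap A.pR)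
      (joint (B := H ⊗[k] H) (mulAfter (B := H ⊗[k] H) (inr k H ∘ₗ A.S) (inr k H A.α)) (inr k H))
      (A.Φ : H ⊗[k] (H ⊗[k] H)) = 1 := by
  have := A.conv_mul_pElement (B := H ⊗[k] H) (inl k H) A.isAntipode_inr
  rwa [pElement_inr, conv_inl_inr] at this

variable {A χ} {t : H} (ht : ∀ h, t * h = χ h • t)
include ht

/-- Write p_R(h ⊗ 1) as Δ(h₁) p_R (1 ⊗ S(h₂)); then t absorbs h₁ through χ. -/
theorem comul_mul_pR_tmul_one (h : H) : A.comul t * A.pR * (h ⊗ₜ (1 : H)) =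
    A.comul t * A.pR * ((1 : H) ⊗ₜ A.S (A.harpoon χ.toLinearMap h)) := by
  rw [mul_assoc, ← comul_mul_pR]
  change _ = _ * ((1 : H) ⊗ₜ A.S (contractL χ.toLinearMap (A.comul h)))
  generalize A.comul h = D
  induction D using TensorProduct.induction_on with
  | zero => simp
  | add x y hx hy => rw [map_add, mul_add, hx, hy, ← mul_add, ← TensorProduct.tmul_add, ← map_add,
      ← map_add]
  | tmul a b =>
    rw [joint_tmul, mulAfter_apply, AlgHom.toLinearMap_apply, ← mul_assoc, ← mul_assoc, ← map_mul,
      ht]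
    simp

theorem comul_eq_mul_twistedα :
    A.comul t = A.comul t * A.pR * ((1 : H) ⊗ₜ A.twistedα χ) := by
  conv_lhs => rw [← mul_one (A.comul t), ← A.comul_mul_pR_Φ]
  rw [twistedα]
  generalize (A.Φ : H ⊗[k] (H ⊗[k] H)) = W
  induction W using tensor₃_induction with
  | add x y hx hy => rw [map_add, mul_add, hx, hy, ← mul_add, ← TensorProduct.tmul_add, ← map_add,
      ← map_add]
  | tmul a b c =>
    rw [joint_tmul, mulAfter_apply, AlgHom.toLinearMap_apply, ← mul_assoc, ← mul_assoc, ← map_mul,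
      ht]
    simp

/-- `Δ(t) y = Δ(t) p_R (1 ⊗ m(y))` with `m = twistedEv χ`. -/
theorem comul_mul_eq (y : H ⊗[k] H) :
    A.comul t * y = A.comul t * A.pR * ((1 : H) ⊗ₜ A.twistedEv χ y) := by
  induction y using TensorProduct.induction_on with
  | zero => simp
  | add x y hx hy => rw [map_add, mul_add, hx, hy, ← mul_add, ← TensorProduct.tmul_add]
  | tmul p q =>
    nth_rw 1 [comul_eq_mul_twistedα ht]
    rw [mul_assoc, show ((1 : H) ⊗ₜ[k] A.twistedα χ) * (p ⊗ₜ[k] q) =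
      (p ⊗ₜ[k] (1 : H)) * ((1 : H) ⊗ₜ[k] (A.twistedα χ * q)) by simp, ← mul_assoc,
      comul_mul_pR_tmul_one ht, mul_assoc]
    simp [twistedEv, mul_assoc]

end

section

variable [FiniteDimensional k H]

theorem S_contractL_qR (χ : H →ₗ[k] k) : A.S (contractL χ A.qR) = contractL χ
    (TensorProduct.map LinearMap.id (evMap A.S A.α) (A.Φ : H ⊗[k] (H ⊗[k] H))) := by
  rw [qR]
  generalize (A.Φ : H ⊗[k] (H ⊗[k] H)) = W
  induction W using tensor₃_induction with
  | add x y hx hy => simp only [map_add, hx, hy]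
  | tmul a b c => simp [A.S_mul, S_Sinv, mul_assoc]

theorem twistFactor_eq (R : H ⊗[k] H) (χ : H →ₐ[k] k) :
    A.twistFactor R χ.toLinearMap = A.twistedEv χ (flip₂ (R * A.pR)) := by
  rw [twistFactor]
  change _ = evMap A.S (A.twistedα χ) _
  rw [twistedα, ← S_contractL_qR]
  generalize flip₂ (R * A.pR) = W
  induction W using TensorProduct.induction_on with
  | zero => simp
  | add x y hx hy => simp only [map_add, hx, hy]
  | tmul a b =>
    simp [A.S_mul, mul_assoc]
    rfl

/-- Both sides equal (q_R)₂₁ R Δ(t) p_R: the right side because t is a left integral, the left side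
because t absorbs right factors through χ, after a flip and the rule Δᵒᵖ(t)R = RΔ(t). -/
theorem flip_qtp_mul_twistFactor {R : H ⊗[k] H} (hR : A.IsRMatrix R) (χ : H →ₐ[k] k) {t : H}
    (ht : A.IsLeftIntegral t) (htχ : ∀ h, t * h = χ h • t) :
    flip₂ (A.qtp t) * (A.twistFactor R χ.toLinearMap ⊗ₜ[k] (1 : H)) =
      (A.S (A.drinfeldElement R) ⊗ₜ[k] (1 : H)) * A.qtp t := by
  have h1 : A.qtp t * ((1 : H) ⊗ₜ A.twistFactor R χ.toLinearMap) =
      A.qR * (A.comul t * flip₂ (R * A.pR)) := by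
    rw [comul_mul_eq htχ, qtp, twistFactor_eq]
    simp only [mul_assoc]
  have h2 := congrArg flip₂ h1
  rw [map_mul, map_mul, map_mul, flip₂_flip₂, flip₂_tmul, ← mul_assoc (flip₂ (A.comul t)),
    hR.intertwine] at h2
  rw [h2, ← mul_assoc, ← mul_assoc, ht.flip_qR_mul hR, qtp]
  simp only [mul_assoc]

/-- A functional that describes the right multiplication on a non-zero element is an algebra
map. -/
def charOf (μ : Module.Dual k H) (t : H) (ht0 : t ≠ 0) (ht : ∀ h, t * h = μ h • t) : H →ₐ[k] k :=
  AlgHom.ofLinearMap μ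
    (by
      have := ht 1
      rw [mul_one] at this
      have h2 : (μ 1 - 1) • t = 0 := by rw [sub_smul, ← this, one_smul, sub_self]
      exact sub_eq_zero.mp ((smul_eq_zero.mp h2).resolve_right ht0))
    (fun x y => by
      have h2 : (μ (x * y) - μ x * μ y) • t = 0 := by
        rw [sub_smul, ← ht, ← mul_assoc, ht, smul_mul_assoc, ht, smul_smul, sub_self]
      exact sub_eq_zero.mp ((smul_eq_zero.mp h2).resolve_right ht0))

/-- Here μ is only a functional; a non-zero t forces it to be a character, and for t = 0 both sides
vanish. -/
theorem flip_qtp_mul_twistFactor_distinguished {R : H ⊗[k] H} (hR : A.IsRMatrix R)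
    (μ : Module.Dual k H) (hμ : A.IsDistinguishedGrouplike μ) (t : H) (ht : A.IsLeftIntegral t) :
    flip₂ (A.qtp t) * (A.twistFactor R μ ⊗ₜ[k] (1 : H)) =
      (A.S (A.drinfeldElement R) ⊗ₜ[k] (1 : H)) * A.qtp t := by
  by_cases h0 : t = 0
  · simp [h0, qtp]
  · exact A.flip_qtp_mul_twistFactor hR (charOf μ t h0 (hμ t ht)) ht (hμ t ht)

end

end QuasiHopfAlgebra


/-! ### Hopf modules: existence and uniqueness of integrals. -/

namespace QuasiHopfAlgebra

variable {k H : Type*} [Field k] [Ring H] [Algebra k H] (A : QuasiHopfAlgebra k H)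

variable (k H) in
/-- The algebra of endomorphisms of `End H`. -/
def EndEnd : Type _ := Module.End k (Module.End k H)

instance : Ring (EndEnd k H) := inferInstanceAs (Ring (Module.End k (Module.End k H)))
instance : Algebra k (EndEnd k H) := inferInstanceAs (Algebra k (Module.End k (Module.End k H)))

variable (k H) in
/-- Evaluation of an endomorphism of `End H`. -/
def EndEnd.app : EndEnd k H →ₐ[k] Module.End k (Module.End k H) := AlgHom.id k _

theorem EndEnd.ext {F G : EndEnd k H} (h : ∀ f y, app k H F f y = app k H G f y) : F = G :=
  LinearMap.ext fun f => LinearMap.ext fun y => h f y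

variable (k H) in
/-- Left multiplication, acting on endomorphisms by composition on the left. -/
def actL : H →ₗ[k] EndEnd k H :=
  (Algebra.lmul k (Module.End k H)).toLinearMap ∘ₗ (Algebra.lmul k H).toLinearMap

/-- Multiplication by `S(x)`, acting on endomorphisms by composition on the right. -/
def actR : H →ₗ[k] EndEnd k H :=
  (LinearMap.mul k (Module.End k H)).flip ∘ₗ (Algebra.lmul k H).toLinearMap ∘ₗ A.S

@[simp] theorem app_actL (x : H) (f : Module.End k H) (y : H) :
    EndEnd.app k H (actL k H x) f y = x * f y := rfl

@[simp] theorem app_actR (x : H) (f : Module.End k H) (y : H) :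
    EndEnd.app k H (A.actR x) f y = f (A.S x * y) := rfl

instance : IsMulMap (actL k H) :=
  ⟨EndEnd.ext fun f y => by simp, fun x x' => EndEnd.ext fun f y => by simp [mul_assoc]⟩

instance : IsMulMap A.actR :=
  ⟨EndEnd.ext fun f y => by simp [A.S_one],
    fun x x' => EndEnd.ext fun f y => by simp [A.S_mul, mul_assoc]⟩

/-- Composition on the left and on the right commute, so the convolution of `actL` and `actR` is an
algebra map: the action (h·f)(y) = h₁ f(S(h₂)y) on End H. -/
instance : CommRange (actL k H) A.actR := ⟨fun x x' => EndEnd.ext fun f y => by simp⟩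

instance : IsAntiMap (A.actR ∘ₗ A.S) := IsMulMap.comp_anti _ _

theorem isAntipode_actR :
    A.IsAntipode A.actR (A.actR ∘ₗ A.S) (A.actR A.α) (A.actR A.β) :=
  A.isAntipode.map A.toQuasiBialgebra A.actR

/-- The diagonal action of `H` on its endomorphisms, multiplied by `p_R`. -/
def diagP : H →ₗ[k] EndEnd k H :=
  mulAfter (A.conv (actL k H) A.actR)
    (A.pElement (actL k H) A.actR (A.actR A.β) (A.actR ∘ₗ A.S))

/-- The structure map of the Hopf module `H ⊗ H*`, with values in `End H`. -/
def hopfMap : H ⊗[k] Module.Dual k H →ₗ[k] Module.End k H :=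
  TensorProduct.lift (LinearMap.mk₂ k (fun h χ => EndEnd.app k H (A.diagP h) (χ.smulRight (1 : H)))
    (by simp) (by simp)
    (fun h χ χ' => by
      rw [← map_add]; congr 1; ext y; simp [add_smul])
    (fun c h χ => by
      rw [← map_smul]; congr 1; ext y; simp [mul_smul]))

theorem hopfMap_tmul (h : H) (χ : Module.Dual k H) :
    A.hopfMap (h ⊗ₜ χ) = EndEnd.app k H (A.diagP h) (χ.smulRight (1 : H)) := by
  simp [hopfMap]

theorem diagP_mul (x h : H) : A.diagP (x * h) = A.conv (actL k H) A.actR x * A.diagP h := by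
  simp only [diagP, mulAfter_apply, IsMulMap.map_mul (f := A.conv (actL k H) A.actR), mul_assoc]

theorem actR_smulRight (x : H) (χ : Module.Dual k H) :
    EndEnd.app k H (A.actR x) (χ.smulRight (1 : H)) = (χ ∘ₗ LinearMap.mulLeft k (A.S x)).smulRight (1 : H) := by
  ext y; simp

theorem diagP_mul_actR_mem (x y : H) (χ : Module.Dual k H) :
    EndEnd.app k H (A.diagP x * A.actR y) (χ.smulRight (1 : H)) ∈ LinearMap.range A.hopfMap :=
  ⟨x ⊗ₜ (χ ∘ₗ LinearMap.mulLeft k (A.S y)), by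
    rw [hopfMap_tmul, map_mul, Module.End.mul_apply, actR_smulRight]⟩

/-- Insert 1 = Δ(X¹) p_R (1 ⊗ S(X²)αX³) in front of h, and replace p_R(h ⊗ 1) by Δ(h₁) p_R (1 ⊗
S(h₂)). What remains has the form Δ(x) p_R (1 ⊗ y), which maps χ ⊗ 1 into the range. Rank-one maps
span End H, so `hopfMap` is onto, and bijective by dimension. -/
theorem smulRight_mem_range_hopfMap (h : H) (χ : Module.Dual k H) :
    χ.smulRight h ∈ LinearMap.range A.hopfMap := by
  have h1 : χ.smulRight h = EndEnd.app k H (1 * actL k H h) (χ.smulRight (1 : H)) := by ext y; simp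
  rw [h1, ← A.conv_mul_pElement (actL k H) A.isAntipode_actR]
  change EndEnd.app k H (joint A.diagP _ _ * _) _ ∈ _
  generalize (A.Φ : H ⊗[k] (H ⊗[k] H)) = W
  induction W using tensor₃_induction with
  | add x y hx hy => rw [map_add, add_mul, map_add]; exact add_mem hx hy
  | tmul x y z =>
    have h2 : joint A.diagP (joint (mulAfter (A.actR ∘ₗ A.S) (A.actR A.α)) A.actR)
        (x ⊗ₜ (y ⊗ₜ z)) * actL k H h = A.conv (actL k H) A.actR x *
          (joint A.diagP (A.actR ∘ₗ A.S) (A.comul h)) * A.actR (A.S y * A.α * z) := by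
      have := A.conv_pElement (actL k H) (fun x => CommRange.comm x A.β) A.isAntipode_actR h
      change joint A.diagP _ _ = _ at this
      rw [this, IsMulMap.map_mul, IsMulMap.map_mul]
      simp only [joint_tmul, mulAfter_apply, LinearMap.comp_apply, mul_assoc,
        ← CommRange.comm (f := actL k H) (g := A.actR), diagP]
      simp only [← mul_assoc, ← CommRange.comm (f := actL k H) (g := A.actR)]
    rw [h2]
    generalize A.comul h = D
    induction D using TensorProduct.induction_on with
    | zero => simp
    | add x y hx hy => rw [map_add, mul_add, add_mul, map_add]; exact add_mem hx hy
    | tmul p q =>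
      have := A.diagP_mul_actR_mem (x * p) (A.S q * (A.S y * A.α * z)) χ
      rwa [diagP_mul, IsMulMap.map_mul, ← mul_assoc, mul_assoc (A.conv _ _ x)] at this

section

variable [FiniteDimensional k H]

theorem hopfMap_surjective : Function.Surjective A.hopfMap := by
  rw [← LinearMap.range_eq_top, eq_top_iff]
  intro f _
  let b := Module.finBasis k H
  have : f = ∑ i, (b.coord i).smulRight (f (b i)) := by
    refine b.ext fun j => ?_
    simp [Finsupp.single_apply]
  rw [this]
  exact sum_mem fun i _ => A.smulRight_mem_range_hopfMap _ _

theorem hopfMap_bijective : Function.Bijective A.hopfMap := by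
  have h : Module.finrank k (H ⊗[k] Module.Dual k H) = Module.finrank k (Module.End k H) := by
    rw [Module.finrank_tensorProduct, Subspace.dual_finrank_eq, Module.finrank_linearMap]
  exact ⟨(LinearMap.injective_iff_surjective_of_finrank_eq_finrank h).mpr A.hopfMap_surjective,
    A.hopfMap_surjective⟩

omit [FiniteDimensional k H] in
theorem hopfMap_rTensor (x : H) (y : H ⊗[k] Module.Dual k H) :
    A.hopfMap (LinearMap.rTensor _ (LinearMap.mulLeft k x) y) =
      EndEnd.app k H (A.conv (actL k H) A.actR x) (A.hopfMap y) := by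
  induction y using TensorProduct.induction_on with
  | zero => simp
  | add y z hy hz => simp only [map_add, hy, hz]
  | tmul h χ =>
    rw [LinearMap.rTensor_tmul, hopfMap_tmul, LinearMap.mulLeft_apply, diagP_mul, hopfMap_tmul]
    rfl

omit [FiniteDimensional k H] in
theorem conv_act_lmul (x : H) : EndEnd.app k H (A.conv (actL k H) A.actR x) (Algebra.lmul k H A.β) =
    A.counit x • Algebra.lmul k H A.β := by
  rw [← map_smul, ← A.antipode_right, QuasiBialgebra.conv_apply]
  generalize A.comul x = D
  induction D using TensorProduct.induction_on with
  | zero => simp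
  | add y z hy hz => simp only [map_add, LinearMap.add_apply, hy, hz]
  | tmul p q => ext y; simp [mul_assoc]

omit [FiniteDimensional k H] in
theorem β_ne_zero [Nontrivial H] : A.β ≠ 0 := by
  intro h
  have := A.isAntipode.phi
  rw [h] at this
  have h2 : mulAfter (LinearMap.id : H →ₗ[k] H) 0 = 0 := by ext; simp
  rw [h2, joint, TensorProduct.map_zero_left] at this
  simp at this

/-- Left multiplication by β is invariant under the action on End H, since h₁βS(h₂) = ε(h)β. Its
preimage in H ⊗ H* is then invariant under left multiplication on H, and evaluating the functional
at a suitable v gives a non-zero left integral. -/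
theorem exists_isLeftIntegral [Nontrivial H] : ∃ t : H, t ≠ 0 ∧ A.IsLeftIntegral t := by
  obtain ⟨y, hy⟩ := A.hopfMap_surjective (Algebra.lmul k H A.β)
  have hinv (x : H) : LinearMap.rTensor _ (LinearMap.mulLeft k x) y = A.counit x • y := by
    refine A.hopfMap_bijective.1 ?_
    rw [hopfMap_rTensor, hy, conv_act_lmul, map_smul, hy]
  have hy0 : y ≠ 0 := by
    rintro rfl
    refine A.β_ne_zero ?_
    rw [map_zero] at hy
    simpa using (congrArg (fun f : Module.End k H => f 1) hy).symm
  let T : H ⊗[k] Module.Dual k H ≃ₗ[k] Module.End k H :=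
    (TensorProduct.comm k H (Module.Dual k H)).trans (dualTensorHomEquiv k H H)
  have hT (x : H) (z : H ⊗[k] Module.Dual k H) (v : H) :
      T (LinearMap.rTensor _ (LinearMap.mulLeft k x) z) v = x * T z v := by
    induction z using TensorProduct.induction_on with
    | zero => simp
    | add y z hy hz => simp only [map_add, LinearMap.add_apply, hy, hz, mul_add]
    | tmul h χ => simp [T, dualTensorHomEquiv]
  have hTy : T y ≠ 0 := by simpa using hy0
  obtain ⟨v, hv⟩ : ∃ v, T y v ≠ 0 := by
    by_contra! h
    exact hTy (LinearMap.ext h)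
  exact ⟨T y v, hv, fun h => by rw [← hT, hinv, map_smul]; rfl⟩

/-- The space of left integrals. -/
def leftIntegrals (A : QuasiHopfAlgebra k H) : Submodule k H where
  carrier := {t | A.IsLeftIntegral t}
  add_mem' ha hb h := by rw [mul_add, ha, hb, smul_add]
  zero_mem' h := by simp
  smul_mem' c x hx h := by rw [mul_smul_comm, hx, smul_comm]

omit [FiniteDimensional k H] in
-- Invariance of f is the hypothesis of the `transfer` lemmas in End H. They give f = c ∘ (left
-- multiplication by β), where c commutes with all left multiplications; hence c is right
-- multiplication by c(1).
theorem invariant_eq {f : Module.End k H}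
    (hf : ∀ x, EndEnd.app k H (A.conv (actL k H) A.actR x) f = A.counit x • f) :
    ∃ b, ∀ y, f y = A.β * y * b := by
  have hA := A.isAntipode.map A.toQuasiBialgebra (Algebra.lmul k H).toLinearMap
  rw [LinearMap.comp_id] at hA
  have : IsAntiMap ((Algebra.lmul k H).toLinearMap ∘ₗ A.S) := IsMulMap.comp_anti _ _
  have hz (x : H) : joint (mulAfter (Algebra.lmul k H).toLinearMap f)
      ((Algebra.lmul k H).toLinearMap ∘ₗ A.S) (A.comul x) = A.counit x • f := by
    rw [← hf, QuasiBialgebra.conv_apply]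
    generalize A.comul x = D
    induction D using TensorProduct.induction_on with
    | zero => simp
    | add y z hy hz => simp only [map_add, LinearMap.add_apply, hy, hz]
    | tmul p q => ext y; simp
  have h1 := A.transfer_intertwines (Algebra.lmul k H).toLinearMap f hA hz
  have h2 := A.transfer_mul (Algebra.lmul k H).toLinearMap f hA hz
  generalize A.transfer (Algebra.lmul k H).toLinearMap f
    ((Algebra.lmul k H).toLinearMap ∘ₗ A.S) ((Algebra.lmul k H).toLinearMap A.α)
    (Algebra.lmul k H).toLinearMap = c at h1 h2
  refine ⟨c 1, fun y => ?_⟩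
  rw [← h2]
  have h3 := congrArg (fun g : Module.End k H => g 1) (h1 (A.β * y))
  simpa using h3.symm

/-- `hopfMap` embeds (left integrals) ⊗ H* into the maps y ↦ βyb, a space of dimension at most dim
H; divide by dim H. -/
theorem finrank_leftIntegrals_le_one [Nontrivial H] :
    Module.finrank k A.leftIntegrals ≤ 1 := by
  let K : A.leftIntegrals ⊗[k] Module.Dual k H →ₗ[k] Module.End k H :=
    A.hopfMap ∘ₗ LinearMap.rTensor _ A.leftIntegrals.subtype
  have hK : Function.Injective K := A.hopfMap_bijective.1.comp
    (Module.Flat.rTensor_preserves_injective_linearMap _ Subtype.val_injective)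
  let M : H →ₗ[k] Module.End k H :=
    LinearMap.mulLeft k (Algebra.lmul k H A.β) ∘ₗ (LinearMap.mul k H).flip
  have hM (b y : H) : M b y = A.β * (y * b) := rfl
  have hKM : LinearMap.range K ≤ LinearMap.range M := by
    rintro _ ⟨z, rfl⟩
    obtain ⟨b, hb⟩ := A.invariant_eq (f := K z) fun x => by
      rw [LinearMap.comp_apply, ← hopfMap_rTensor, ← map_smul]
      congr 1
      induction z using TensorProduct.induction_on with
      | zero => simp
      | add y z hy hz => simp only [map_add, smul_add, hy, hz]
      | tmul t χ =>
        simp only [LinearMap.rTensor_tmul, LinearMap.mulLeft_apply, Submodule.subtype_apply]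
        rw [t.2 x, TensorProduct.smul_tmul']
    exact ⟨b, by ext y; rw [hM, hb, mul_assoc]⟩
  have h1 := (LinearMap.finrank_range_of_inj hK).symm.le.trans
    ((Submodule.finrank_mono hKM).trans (LinearMap.finrank_range_le M))
  rw [Module.finrank_tensorProduct, Subspace.dual_finrank_eq] at h1
  have : 0 < Module.finrank k H := Module.finrank_pos
  by_contra! h2
  nlinarith

/-- Existence of the distinguished group-like element. -/
theorem exists_char [Nontrivial H] : ∃ (t : H) (χ : H →ₐ[k] k), t ≠ 0 ∧ A.IsLeftIntegral t ∧
    ∀ h, t * h = χ h • t := by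
  obtain ⟨t, ht0, ht⟩ := A.exists_isLeftIntegral
  obtain ⟨v, hv⟩ := finrank_le_one_iff.mp A.finrank_leftIntegrals_le_one
  have hv0 : v ≠ 0 := by
    rintro rfl
    obtain ⟨c, hc⟩ := hv ⟨t, ht⟩
    exact ht0 (by simpa using (congrArg Subtype.val hc).symm)
  have hv0' : (v : H) ≠ 0 := by simpa using hv0
  obtain ⟨φ, hφ⟩ := Module.Projective.exists_dual_eq_one k hv0'
  have hμ (h : H) : (v : H) * h = (φ ∘ₗ LinearMap.mulLeft k (v : H)) h • (v : H) := by
    obtain ⟨c, hc⟩ := hv ⟨v * h, fun x => by rw [← mul_assoc, v.2 x, smul_mul_assoc]⟩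
    have hc' : c • (v : H) = v * h := congrArg Subtype.val hc
    rw [LinearMap.comp_apply, LinearMap.mulLeft_apply, ← hc', map_smul, hφ, smul_eq_mul, mul_one]
  exact ⟨v, charOf _ v hv0' hμ, hv0', v.2, hμ⟩

end

end QuasiHopfAlgebra


/-! ### Characters and the monodromy R₂₁R. -/

section

variable {k H : Type*} [Field k] [Ring H] [Algebra k H]

theorem contractL_mul {P Q : Type*} [Ring P] [Algebra k P] [Ring Q] [Algebra k Q] (χ : P →ₐ[k] k)
    (V W : P ⊗[k] Q) : contractL χ.toLinearMap (V * W) =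
      contractL χ.toLinearMap V * contractL χ.toLinearMap W := by
  have := IsMulMap.map_mul (f := joint (scalarMap Q χ) (LinearMap.id : Q →ₗ[k] Q)) V W
  rwa [joint_scalarMap_left, joint_scalarMap_left, joint_scalarMap_left] at this

end

namespace QuasiHopfAlgebra

variable {k H : Type*} [Field k] [Ring H] [Algebra k H] (A : QuasiHopfAlgebra k H)

section Character

variable (χ : H →ₐ[k] k)

/-- Apply χ to X¹βS(X²)αX³ = 1; the product χ(α)χ(β) divides the left side. -/
theorem char_α_mul_char_β : χ A.α * χ A.β ≠ 0 := by
  have h := congrArg χ A.isAntipode.phi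
  intro h0
  rw [map_one] at h
  refine one_ne_zero (α := k) (h.symm.trans ?_)
  generalize (A.Φ : H ⊗[k] (H ⊗[k] H)) = W
  induction W using tensor₃_induction with
  | add x y hx hy => rw [map_add, map_add, hx, hy, add_zero]
  | tmul a b c =>
    simp only [joint_tmul, mulAfter_apply, LinearMap.id_apply, map_mul]
    linear_combination (χ a * χ (A.S b) * χ c) * h0

/-- The character `χ ∘ S`. -/
def charS : H →ₐ[k] k := AlgHom.ofLinearMap (χ.toLinearMap ∘ₗ A.S) (by simp [A.S_one])
  (fun x y => by simp [A.S_mul, mul_comm])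

@[simp] theorem charS_apply (x : H) : A.charS χ x = χ (A.S x) := rfl

theorem conv_charS_char (B : Type*) [Ring B] [Algebra k B] :
    A.conv (scalarMap B (A.charS χ)) (scalarMap B χ) = scalarMap B A.counit := by
  ext h
  have h1 := congrArg χ (A.antipode_left h)
  have h2 : A.conv (scalarMap k (A.charS χ)) (scalarMap k χ) h = A.counit h := by
    refine mul_left_cancel₀ (left_ne_zero_of_mul (A.char_α_mul_char_β χ)) ?_
    rw [map_smul, smul_eq_mul, mul_comm] at h1
    rw [← h1, QuasiBialgebra.conv_apply]
    generalize A.comul h = D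
    induction D using TensorProduct.induction_on with
    | zero => simp
    | add x y hx hy => rw [map_add, map_add, map_add, mul_add, hx, hy]
    | tmul a b => simp; ring
  rw [scalarMap_apply, ← h2, QuasiBialgebra.conv_apply, QuasiBialgebra.conv_apply]
  generalize A.comul h = D
  induction D using TensorProduct.induction_on with
  | zero => simp
  | add x y hx hy => rw [map_add, map_add, map_add, hx, hy]
  | tmul a b => simp

theorem harpoon_eq (h : H) : A.harpoon χ.toLinearMap h = contractL χ.toLinearMap (A.comul h) := rfl

theorem conv_scalarMap {B : Type*} [Ring B] [Algebra k B] (f : H →ₗ[k] B) :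
    A.conv (scalarMap B χ) f = f ∘ₗ A.harpoon χ.toLinearMap := by
  ext h
  rw [QuasiBialgebra.conv_apply, joint_scalarMap_left]
  rfl

/-- The characters χ ∘ S and χ convolve to ε. By quasi-coassociativity h ↦ (h ↼ (χ∘S)) ↼ χ is
therefore conjugation by the unit c, and d y c is the preimage under this conjugation. -/
theorem harpoon_surjective : Function.Surjective (A.harpoon χ.toLinearMap) := by
  intro y
  let c := A.phi (scalarMap H (A.charS χ)) (scalarMap H χ) (LinearMap.id : H →ₗ[k] H)
  let d := A.phiInv (scalarMap H (A.charS χ)) (scalarMap H χ) (LinearMap.id : H →ₗ[k] H)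
  have hcd : c * d = 1 := A.phi_mul_phiInv _ _ _
  have h := A.phi_mul_conv (scalarMap H (A.charS χ)) (scalarMap H χ) LinearMap.id (d * y * c)
  rw [conv_charS_char, A.conv_counit_left, A.conv_scalarMap χ, A.conv_scalarMap] at h
  change c * (d * y * c) = A.harpoon χ.toLinearMap (A.harpoon _ _) * c at h
  refine ⟨A.harpoon (A.charS χ).toLinearMap (d * y * c), ?_⟩
  have h2 := congrArg (· * d) h
  simp only [mul_assoc, hcd, mul_one] at h2
  rw [mul_assoc d y c, ← h2, ← mul_assoc, hcd, one_mul]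

instance : IsMulMap (A.harpoon χ.toLinearMap) := by
  have := A.conv_scalarMap χ (LinearMap.id : H →ₗ[k] H)
  rw [LinearMap.id_comp] at this
  rw [← this]
  infer_instance

end Character

section Monodromy

variable {R : H ⊗[k] H} {A}

/-- The element `R₂₁ R`. -/
def monodromy (R : H ⊗[k] H) : H ⊗[k] H := flip₂ R * R

theorem IsRMatrix.monodromy_mul_comul (hR : A.IsRMatrix R) (h : H) :
    monodromy R * A.comul h = A.comul h * monodromy R := by
  have := congrArg flip₂ (hR.intertwine h)
  rw [map_mul, map_mul, flip₂_flip₂] at this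
  rw [monodromy, mul_assoc, ← hR.intertwine, ← mul_assoc, ← this, mul_assoc]

/-- The monodromy commutes with every Δ(h), so its contraction commutes with every h ↼ χ, and these
exhaust H. -/
theorem IsRMatrix.contractL_monodromy_comm (hR : A.IsRMatrix R) (χ : H →ₐ[k] k) (x : H) :
    contractL χ.toLinearMap (monodromy R) * x = x * contractL χ.toLinearMap (monodromy R) := by
  obtain ⟨h, rfl⟩ := A.harpoon_surjective χ x
  rw [harpoon_eq, ← contractL_mul, hR.monodromy_mul_comul, contractL_mul]

/-- `χ(X¹) X² ⊗ X³`. -/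
def phiχ (A : QuasiHopfAlgebra k H) (χ : H →ₐ[k] k) : H ⊗[k] H :=
  A.phi (B := H ⊗[k] H) (scalarMap (H ⊗[k] H) χ) (inl k H) (inr k H)

theorem joint_harpoon (χ : H →ₐ[k] k) (W : H ⊗[k] H) :
    joint (B := H ⊗[k] H) (A.conv (scalarMap (H ⊗[k] H) χ) (inl k H)) (inr k H) W =
      TensorProduct.map (A.harpoon χ.toLinearMap) LinearMap.id W := by
  rw [conv_scalarMap]
  induction W using TensorProduct.induction_on with
  | zero => simp
  | add x y hx hy => rw [map_add, map_add, hx, hy]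
  | tmul a b => simp

/-- Multiply the hexagons for R on ((χ,1),2) and for R₂₁ on (2,(χ,1)). The reassociators between
them cancel, and the factors on χ combine to the central element χ(M¹)M², with M = R₂₁R, which moves
out to the front. -/
theorem IsRMatrix.map_harpoon_monodromy (hR : A.IsRMatrix R) (χ : H →ₐ[k] k) :
    A.phiχ χ * TensorProduct.map (A.harpoon χ.toLinearMap) LinearMap.id (monodromy R) =
      ((1 : H) ⊗ₜ contractL χ.toLinearMap (monodromy R)) * (monodromy R * A.phiχ χ) := by
  have hm : ∀ y : H ⊗[k] H, y * ((1 : H) ⊗ₜ contractL χ.toLinearMap (monodromy R)) =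
      ((1 : H) ⊗ₜ contractL χ.toLinearMap (monodromy R)) * y := by
    intro y
    induction y using TensorProduct.induction_on with
    | zero => simp
    | add x y hx hy => rw [add_mul, mul_add, hx, hy]
    | tmul a b => simp [hR.contractL_monodromy_comm]
  have hm2 : joint (B := H ⊗[k] H) (inr k H) (scalarMap (H ⊗[k] H) χ) R *
      joint (B := H ⊗[k] H) (scalarMap (H ⊗[k] H) χ) (inr k H) R =
        (1 : H) ⊗ₜ contractL χ.toLinearMap (monodromy R) := by
    rw [← joint_flip₂ (B := H ⊗[k] H) (inr k H), ← IsMulMap.map_mul (B := H ⊗[k] H)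
      (f := joint (B := H ⊗[k] H) (scalarMap (H ⊗[k] H) χ) (inr k H)), joint_scalarMap_left]
    rfl
  have hm3 : joint (B := H ⊗[k] H) (inr k H) (inl k H) R * joint (B := H ⊗[k] H) (inl k H)
      (inr k H) R = monodromy R := by
    rw [← joint_flip₂ (B := H ⊗[k] H) (inr k H), joint_inl_inr, joint_inl_inr]
    rfl
  rw [← joint_harpoon]
  nth_rw 1 [monodromy]
  rw [IsMulMap.map_mul (B := H ⊗[k] H)
    (f := joint (B := H ⊗[k] H) (A.conv (scalarMap (H ⊗[k] H) χ) (inl k H)) (inr k H)),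
    joint_flip₂ (B := H ⊗[k] H) (inr k H),
    hR.joint_conv_left (B := H ⊗[k] H) (scalarMap (H ⊗[k] H) χ) (inl k H) (inr k H),
    hR.joint_conv_right (B := H ⊗[k] H) (inr k H) (scalarMap (H ⊗[k] H) χ) (inl k H), phiχ]
  simp only [mul_assoc]
  rw [A.phiInv_mul_phi_assoc (B := H ⊗[k] H) (inr k H) (scalarMap (H ⊗[k] H) χ) (inl k H),
    A.phi_mul_phiInv_assoc (B := H ⊗[k] H) (scalarMap (H ⊗[k] H) χ) (inl k H) (inr k H),
    ← mul_assoc (joint (B := H ⊗[k] H) (inr k H) (scalarMap (H ⊗[k] H) χ) R), hm2,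
    ← mul_assoc (A.phi _ _ _) (_ ⊗ₜ _), hm, mul_assoc,
    A.phi_mul_phiInv_assoc (B := H ⊗[k] H) (scalarMap (H ⊗[k] H) χ) (inr k H) (inl k H),
    ← mul_assoc, hm, mul_assoc, ← mul_assoc (joint (B := H ⊗[k] H) (inr k H) (inl k H) R), hm3]

theorem twistedEv_eq (χ : H →ₐ[k] k) (y : H ⊗[k] H) : A.twistedEv χ y =
    evMap A.S A.α (A.phiχ χ * TensorProduct.map (A.harpoon χ.toLinearMap) LinearMap.id y) := by
  rw [evMap_mul, twistedEv, LinearMap.comp_apply]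
  congr 2
  rw [twistedα, phiχ, QuasiBialgebra.phi]
  generalize (A.Φ : H ⊗[k] (H ⊗[k] H)) = W
  rw [joint_scalarMap_left]
  induction W using tensor₃_induction with
  | add x y hx hy => simp only [map_add, hx, hy]
  | tmul a b c => simp

theorem evMap_one_tmul_central {m : H} (hm : ∀ x, m * x = x * m) (y : H ⊗[k] H) :
    evMap A.S A.α (((1 : H) ⊗ₜ m) * y) = m * evMap A.S A.α y := by
  induction y using TensorProduct.induction_on with
  | zero => simp
  | add x y hx hy => rw [mul_add, map_add, map_add, mul_add, hx, hy]
  | tmul a b => simp [← mul_assoc, hm]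

end Monodromy

end QuasiHopfAlgebra


/-! ### Invertibility of R, and the monodromy at the distinguished character. -/

namespace QuasiHopfAlgebra

variable {k H : Type*} [Field k] [Ring H] [Algebra k H] {A : QuasiHopfAlgebra k H}

section LeftInverse

variable {B : Type*} [Ring B] [Algebra k B] {R : H ⊗[k] H}

theorem quad_mul_leg₂₃ (l₁ l₂ l₃ : H →ₗ[k] B) (m₁ : B) [IsMulMap l₂] [IsMulMap l₃]
    [CommRange l₂ l₃] (χ : H →ₐ[k] k) (y : Four k H) (V : H ⊗[k] H) :
    quad l₁ m₁ l₂ 1 l₃ 1 (scalarMap B χ) (y * joint (leg₂ k H) (leg₃ k H) V) =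
      quad l₁ m₁ l₂ 1 l₃ 1 (scalarMap B χ) y * joint l₂ l₃ V := by
  induction V using TensorProduct.induction_on with
  | zero => simp
  | add x y hx hy => simp only [map_add, mul_add, hx, hy]
  | tmul p q =>
    induction y using Four.induction with
    | add x y hx hy => simp only [map_add, add_mul, hx, hy]
    | tmul a b c d =>
      have h1 := CommRange.comm (f := l₂) (g := l₃) p c
      simp only [joint_tmul, leg₂_apply, leg₃_apply, Four.tmul_mul_tmul, quad_tmul, mul_one,
        one_mul, IsMulMap.map_mul, scalarMap_apply, mul_assoc, Algebra.commutes (χ d)]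
      rw [← mul_assoc (l₂ p) (l₃ c), h1, mul_assoc]

/-- An `R`-matrix has a left inverse. -/
theorem IsRMatrix.exists_left_inverse (hR : A.IsRMatrix R) : ∃ V, V * R = 1 := by
  have hA : A.IsAntipode (B := H ⊗[k] H) (inl k H) (inl k H ∘ₗ A.S) (inl k H A.α) (inl k H A.β) :=
    A.isAntipode.map A.toQuasiBialgebra (C := H ⊗[k] H) (inl k H)
  have : IsAntiMap (B := H ⊗[k] H) (inl k H ∘ₗ A.S) := IsMulMap.comp_anti _ _
  have hl := A.quad_conv_left₁₂ (B := H ⊗[k] H) (inl k H ∘ₗ A.S) (inl k H) (inr k H)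
    (scalarMap (H ⊗[k] H) A.counit) (inl k H A.α) 1 1 hA.left
  obtain ⟨T, hT⟩ : ∃ T, T = quad (B := H ⊗[k] H) (inl k H ∘ₗ A.S) (inl k H A.α) (inl k H) 1
    (inr k H) 1 (scalarMap (H ⊗[k] H) A.counit) := ⟨_, rfl⟩
  rw [← hT] at hl
  have h1 (y : Four k H) : T (y * joint (leg₂ k H) (leg₃ k H) R) = T y * R := by
    have := quad_mul_leg₂₃ (B := H ⊗[k] H) (inl k H ∘ₗ A.S) (inl k H) (inr k H) (inl k H A.α)
      A.counit y R
    rwa [joint_inl_inr, ← hT] at this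
  have h2 : T (A.phiInv (leg₁ k H) (leg₂ k H) (leg₃ k H)) =
      joint (B := H ⊗[k] H) (mulAfter (B := H ⊗[k] H) (inl k H ∘ₗ A.S) (inl k H A.α))
        (joint (B := H ⊗[k] H) (inl k H) (inr k H)) (↑A.Φ⁻¹ : H ⊗[k] (H ⊗[k] H)) := by
    rw [hT, QuasiBialgebra.phiInv]
    generalize (↑A.Φ⁻¹ : H ⊗[k] (H ⊗[k] H)) = W
    induction W using tensor₃_induction with
    | add x y hx hy => rw [map_add, map_add, hx, hy, map_add]
    | tmul a b c => simp
  -- In the first hexagon for R on ((12),3) the chain T absorbs the left side, while on the right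
  -- R₂₃ stands last; so S(x¹)αx² ⊗ x³ is a left multiple of R.
  obtain ⟨V, hV⟩ : ∃ V, T (A.phiInv (leg₁ k H) (leg₂ k H) (leg₃ k H)) = V * R := by
    have h := congrArg (· * A.phiInv (leg₁ k H) (leg₂ k H) (leg₃ k H))
      (hR.joint_conv_left (leg₁ k H) (leg₂ k H) (leg₃ k H))
    simp only [mul_assoc, QuasiBialgebra.phi_mul_phiInv, mul_one] at h
    simp only [← mul_assoc] at h
    have h' := congrArg T h
    rw [h1, absorb_left_fst T (A.conv (leg₁ k H) (leg₂ k H)) (leg₃ k H) A.counit.toLinearMap hl,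
      hR.contractL_eq_one, IsMulMap.map_one, one_mul] at h'
    exact ⟨_, h'⟩
  have h3 := A.phiInv_mul_conv (B := H ⊗[k] H) (inr k H) hA
  rw [← h2, hV, conv_inl_inr] at h3
  -- In (X¹βS(X²) ⊗ 1) V R Δ(X³) = 1 the factor R passes Δ(X³), turning it into Δᵒᵖ(X³); what
  -- precedes R is the left inverse.
  refine ⟨joint (B := H ⊗[k] H) (mulAfter (B := H ⊗[k] H) (inl k H) (inl k H A.β))
    (joint (B := H ⊗[k] H) (mulAfter (B := H ⊗[k] H) (inl k H ∘ₗ A.S) V)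
    ((flip₂ : H ⊗[k] H →ₐ[k] H ⊗[k] H).toLinearMap ∘ₗ A.comul.toLinearMap))
    (A.Φ : H ⊗[k] (H ⊗[k] H)), ?_⟩
  rw [← h3]
  generalize (A.Φ : H ⊗[k] (H ⊗[k] H)) = W
  induction W using tensor₃_induction with
  | add x y hx hy => rw [map_add, add_mul, hx, hy, map_add]
  | tmul a b c =>
    rw [joint_tmul, joint_tmul, joint_tmul, joint_tmul, mulAfter_apply, mulAfter_apply,
      mulAfter_apply]
    simp only [LinearMap.comp_apply, AlgHom.toLinearMap_apply, mul_assoc, hR.intertwine]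

end LeftInverse

section

variable [FiniteDimensional k H] {R : H ⊗[k] H} {t : H} (ht0 : t ≠ 0) (ht : A.IsLeftIntegral t)

include ht0 in
/-- `Δ(t) p_R (1 ⊗ z) = 0` only if `z = 0`. -/
theorem eq_zero_of_comul_mul_pR {z : H} (h : A.comul t * A.pR * ((1 : H) ⊗ₜ z) = 0) : z = 0 := by
  have hp : joint (actL k H) A.actR A.pR =
      A.pElement (actL k H) A.actR (A.actR A.β) (A.actR ∘ₗ A.S) := by
    rw [pR, QuasiBialgebra.pElement]
    generalize (↑A.Φ⁻¹ : H ⊗[k] (H ⊗[k] H)) = W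
    induction W using tensor₃_induction with
    | add x y hx hy => rw [map_add, map_add, hx, hy, map_add]
    | tmul a b c => simp [IsMulMap.map_mul]
  -- The hypothesis acts on End H as the image under `hopfMap` of t ⊗ χ(S(z)·) for each χ.
  -- Injectivity of `hopfMap` and t ≠ 0 then kill every χ(S(z)).
  have h1 : A.diagP t * A.actR z = 0 := by
    rw [diagP, mulAfter_apply, ← hp, QuasiBialgebra.conv_apply,
      ← IsMulMap.map_mul (f := joint (actL k H) A.actR), ← joint_one_tmul (actL k H) A.actR z,
      ← IsMulMap.map_mul (f := joint (actL k H) A.actR), h, map_zero]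
  have h2 (χ : Module.Dual k H) : χ (A.S z) = 0 := by
    have h3 : A.hopfMap (t ⊗ₜ (χ ∘ₗ LinearMap.mulLeft k (A.S z))) = 0 := by
      rw [hopfMap_tmul, ← actR_smulRight, ← Module.End.mul_apply, ← map_mul, h1, map_zero]
      rfl
    have h4 := A.hopfMap_bijective.1 (h3.trans (map_zero _).symm)
    obtain ⟨φ, hφ⟩ := Module.Projective.exists_dual_eq_one k ht0
    have h5 := congrArg (fun w => TensorProduct.lid k _ (LinearMap.rTensor _ φ w)) h4
    simp only [LinearMap.rTensor_tmul, TensorProduct.lid_tmul, hφ, one_smul, map_zero] at h5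
    simpa using LinearMap.congr_fun h5 1
  have := (Module.forall_dual_apply_eq_zero_iff k (A.S z)).mp h2
  exact A.antipode_bijective.1 (this.trans (map_zero _).symm)

variable (hR : A.IsRMatrix R)

/-- The element `S(u) u`. -/
def casimir (A : QuasiHopfAlgebra k H) (R : H ⊗[k] H) : H :=
  A.S (A.drinfeldElement R) * A.drinfeldElement R

include hR

theorem IsRMatrix.casimir_comm (x : H) : A.casimir R * x = x * A.casimir R := by
  rw [casimir, mul_assoc, hR.drinfeldElement_mul, ← mul_assoc, hR.antipode_drinfeldElement,
    hR.coevQR_mul, mul_assoc]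

theorem IsRMatrix.one_tmul_casimir_comm (y : H ⊗[k] H) :
    ((1 : H) ⊗ₜ A.casimir R) * y = y * ((1 : H) ⊗ₜ A.casimir R) := by
  induction y using TensorProduct.induction_on with
  | zero => simp
  | add x y hx hy => rw [add_mul, mul_add, hx, hy]
  | tmul a b => simp [hR.casimir_comm]

-- Apply `flip_qR_mul` once flipped, for R₂₁, and once directly, for R. The factor S(u) ⊗ 1 so
-- obtained is moved to the second leg by `one_tmul_mul`, which gives S(u)u there. Then S⁻¹(β)
-- strips off q_R, and M commutes with Δ(t).
include ht in
theorem IsRMatrix.comul_mul_monodromy :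
    A.comul t * monodromy R = A.comul t * ((1 : H) ⊗ₜ A.casimir R) := by
  have h1 : A.qR * (monodromy R * A.comul t) =
      ((1 : H) ⊗ₜ A.casimir R) * (A.qR * A.comul t) := by
    have h2 := congrArg flip₂ (ht.flip_qR_mul hR)
    rw [map_mul, map_mul, map_mul, flip₂_flip₂, flip₂_tmul, map_mul] at h2
    have h3 := congrArg (· * R) h2
    simp only [mul_assoc, hR.intertwine] at h3
    rw [monodromy, mul_assoc, h3, ← mul_assoc (flip₂ A.qR), ht.flip_qR_mul hR, ht.one_tmul_mul,
      casimir, A.S_mul, ← mul_assoc]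
    have h4 := ht.one_tmul_mul (A.S (A.drinfeldElement R))
    rw [show (A.S (A.drinfeldElement R) * A.S (A.S (A.drinfeldElement R))) ⊗ₜ[k] (1 : H) =
      (A.S (A.drinfeldElement R) ⊗ₜ[k] (1 : H)) * (A.S (A.S (A.drinfeldElement R)) ⊗ₜ[k] (1 : H)) by
        simp, mul_assoc (A.S _ ⊗ₜ[k] (1 : H)) _ (A.qR * _), ← h4]
    simp [← mul_assoc]
  rw [← hR.one_tmul_casimir_comm]
  nth_rw 2 [← ht.Sinv_mul]
  rw [← mul_assoc, hR.one_tmul_casimir_comm, mul_assoc, ← h1, hR.monodromy_mul_comul, ← mul_assoc,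
    ← mul_assoc]
  nth_rw 1 [← ht.Sinv_mul]
  simp only [mul_assoc]

/-- The same factor S(u)u arises from α: S(R²)αR¹ = S(α)u, a second R turns this into S(S(R²)αR¹)u,
and S(S(R²)αR¹) = αS(u). -/
theorem IsRMatrix.evMap_monodromy_mul (y : H ⊗[k] H) :
    evMap A.S A.α (monodromy R * y) = A.casimir R * evMap A.S A.α y := by
  have h1 : evMap A.S (evMap A.S A.α (flip₂ R)) R = A.α * A.casimir R := by
    change evMap A.S (A.evR R) R = _
    have h2 (W : H ⊗[k] H) : evMap A.S (A.evR R) W =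
        A.S (evMap A.S A.α (flip₂ W)) * A.drinfeldElement R := by
      rw [hR.evR_eq]
      induction W using TensorProduct.induction_on with
      | zero => simp
      | add x y hx hy => simp only [map_add, hx, hy, add_mul]
      | tmul a b => simp [A.S_mul, mul_assoc, hR.drinfeldElement_mul]
    rw [h2]
    change A.S (A.evR R) * _ = _
    rw [← hR.α_mul_coevQR, ← hR.antipode_drinfeldElement, casimir, mul_assoc]
  rw [evMap_mul, monodromy, evMap_mul, h1]
  induction y using TensorProduct.induction_on with
  | zero => simp
  | add x y hx hy => rw [map_add, map_add, mul_add, hx, hy]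
  | tmul a b =>
    rw [evMap_tmul, evMap_tmul, ← hR.casimir_comm A.α, ← mul_assoc, ← hR.casimir_comm]
    simp only [mul_assoc]

variable {χ : H →ₐ[k] k} (htχ : ∀ h, t * h = χ h • t)

include ht0 ht htχ

omit hR ht in
theorem twistedEv_pR : A.twistedEv χ A.pR = 1 := by
  refine (sub_eq_zero.mp (eq_zero_of_comul_mul_pR (k := k) (A := A) ht0 ?_)).symm
  rw [TensorProduct.tmul_sub, mul_sub, ← comul_mul_eq htχ, ← Algebra.TensorProduct.one_def,
    mul_one, sub_self]

theorem IsRMatrix.twistedEv_monodromy_mul (y : H ⊗[k] H) :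
    A.twistedEv χ (monodromy R * y) = A.casimir R * A.twistedEv χ y := by
  refine sub_eq_zero.mp (eq_zero_of_comul_mul_pR (k := k) (A := A) ht0 ?_)
  rw [TensorProduct.tmul_sub, mul_sub, ← comul_mul_eq htχ, ← mul_assoc,
    hR.comul_mul_monodromy ht, ← hR.one_tmul_casimir_comm, mul_assoc, comul_mul_eq htχ,
    ← mul_assoc, hR.one_tmul_casimir_comm,  sub_eq_zero]
  simp [mul_assoc]

/-- The monodromy, contracted with the distinguished character, is trivial. -/
theorem IsRMatrix.contractL_monodromy_eq_one :
    contractL χ.toLinearMap (monodromy R) = 1 := by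
  have h1 := hR.twistedEv_monodromy_mul ht0 ht htχ
  -- A second evaluation of the same quantity, through the twisted hexagons; it carries the extra
  -- factor c = χ(M¹)M².
  have h2 (y : H ⊗[k] H) : A.twistedEv χ (monodromy R * y) =
      contractL χ.toLinearMap (monodromy R) * (A.casimir R * A.twistedEv χ y) := by
    rw [twistedEv_eq, ← joint_harpoon, IsMulMap.map_mul (B := H ⊗[k] H)
      (f := joint (B := H ⊗[k] H) (A.conv (scalarMap (H ⊗[k] H) χ) (inl k H)) (inr k H)),
      joint_harpoon, joint_harpoon, ← mul_assoc, hR.map_harpoon_monodromy, mul_assoc, mul_assoc,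
      evMap_one_tmul_central (hR.contractL_monodromy_comm χ), hR.evMap_monodromy_mul,
      twistedEv_eq]
  obtain ⟨V, hV⟩ := hR.exists_left_inverse
  have hV' : R * V = 1 := by
    have := IsNoetherianRing.of_finite k (H ⊗[k] H)
    exact mul_eq_one_comm.mp hV
  have h3 : monodromy R * (V * flip₂ V) = 1 := by
    rw [monodromy, mul_assoc, ← mul_assoc R, hV', one_mul, ← map_mul, hV', map_one]
  -- For y = M⁻¹p_R the common factor S(u)u m(y) is m(p_R) = 1, so that only c remains.
  have hc : A.casimir R * A.twistedEv χ (V * flip₂ V * A.pR) = 1 := by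
    rw [← h1, ← mul_assoc, h3, one_mul, twistedEv_pR ht0 htχ]
  have h4 := h2 (V * flip₂ V * A.pR)
  rw [h1, hc, mul_one] at h4
  exact h4.symm

end

end QuasiHopfAlgebra


/-! ### Antipode data twisted by a character. -/

theorem mul_algebraMap_eq_smul {k B : Type*} [Field k] [Ring B] [Algebra k B] (x : B) (r : k) :
    x * algebraMap k B r = r • x := by rw [← Algebra.commutes, Algebra.smul_def]

theorem algebraMap_mul_eq_smul {k B : Type*} [Field k] [Ring B] [Algebra k B] (x : B) (r : k) :
    algebraMap k B r * x = r • x := (Algebra.smul_def r x).symm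

namespace QuasiHopfAlgebra

variable {k H : Type*} [Field k] [Ring H] [Algebra k H] (A : QuasiHopfAlgebra k H) (χ : H →ₐ[k] k)

/-- The algebra map `h ↦ h₁ χ(S(h₂))`. -/
def tau : H →ₗ[k] H := A.conv LinearMap.id (scalarMap H (A.charS χ))

instance : IsMulMap (A.tau χ) := by unfold tau; infer_instance

theorem tau_apply (h : H) :
    A.tau χ h = contractR (A.charS χ).toLinearMap (A.comul h) :=
  joint_scalarMap_right _ _ _

/-- The anti-algebra map `h ↦ S(h₁) χ(S(h₂))`. -/
def sTau : H →ₗ[k] H := A.S ∘ₗ A.tau χ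

instance : IsAntiMap (A.sTau χ) := IsAntiMap.comp_mul _ _

/-- `X¹ χ(S(X²)) χ(X³)`. -/
def rho : H := A.phi LinearMap.id (scalarMap H (A.charS χ)) (scalarMap H χ)

/-- `X¹ β S(X²) χ(S(X³))`. -/
def pTau : H := joint (mulAfter LinearMap.id A.β) (joint A.S (scalarMap H (A.charS χ)))
  (A.Φ : H ⊗[k] (H ⊗[k] H))

theorem conv_char_charS (B : Type*) [Ring B] [Algebra k B] :
    A.conv (scalarMap B χ) (scalarMap B (A.charS χ)) = scalarMap B A.counit := by
  ext h
  have h1 := congrArg χ (A.antipode_right h)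
  have h2 : A.conv (scalarMap k χ) (scalarMap k (A.charS χ)) h = A.counit h := by
    refine mul_left_cancel₀ (right_ne_zero_of_mul (A.char_α_mul_char_β χ)) ?_
    rw [map_smul, smul_eq_mul, mul_comm] at h1
    rw [← h1, QuasiBialgebra.conv_apply]
    generalize A.comul h = D
    induction D using TensorProduct.induction_on with
    | zero => simp
    | add x y hx hy => rw [map_add, map_add, map_add, mul_add, hx, hy]
    | tmul a b => simp; ring
  rw [scalarMap_apply, ← h2, QuasiBialgebra.conv_apply, QuasiBialgebra.conv_apply]
  generalize A.comul h = D
  induction D using TensorProduct.induction_on with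
  | zero => simp
  | add x y hx hy => rw [map_add, map_add, map_add, hx, hy]
  | tmul a b => simp

/-- `ρ h₁ χ(S(h₂)) χ(h₃) = h ρ`. -/
theorem rho_mul (h : H) :
    A.rho χ * A.conv (A.tau χ) (scalarMap H χ) h = h * A.rho χ := by
  have := A.phi_mul_conv LinearMap.id (scalarMap H (A.charS χ)) (scalarMap H χ) h
  rwa [conv_charS_char, A.conv_counit_right] at this

theorem S_rho_mul (h : H) :
    joint (mulAfter (A.sTau χ) (A.S (A.rho χ))) (scalarMap H χ) (A.comul h) =
      A.S (A.rho χ) * A.S h := by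
  rw [← A.S_mul, ← rho_mul, QuasiBialgebra.conv_apply]
  generalize A.comul h = D
  induction D using TensorProduct.induction_on with
  | zero => simp
  | add x y hx hy => rw [map_add, map_add, mul_add, map_add, hx, hy]
  | tmul a b =>
    simp only [joint_tmul, mulAfter_apply, scalarMap_apply, sTau, LinearMap.comp_apply]
    rw [← mul_assoc, mul_algebraMap_eq_smul, mul_algebraMap_eq_smul, map_smul, A.S_mul]

/-- `h₁ p' s'(h₂) = χ(S(h)) p'`. -/
theorem pTau_mul (h : H) :
    joint (mulAfter LinearMap.id (A.pTau χ)) (A.sTau χ) (A.comul h) = A.charS χ h • A.pTau χ := by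
  have hr := A.quad_conv_right₁₂ LinearMap.id A.S (scalarMap H (A.charS χ))
    (scalarMap H A.counit) A.β 1 1 A.isAntipode.right
  obtain ⟨T, hT⟩ : ∃ T, T = quad LinearMap.id A.β A.S 1 (scalarMap H (A.charS χ)) 1
    (scalarMap H A.counit) := ⟨_, rfl⟩
  rw [← hT] at hr
  have h1 := congrArg T (A.phi_mul_conv (leg₁ k H) (leg₂ k H) (leg₃ k H) h)
  rw [A.conv_apply (A.conv _ _), absorb_right_fst T (A.conv (leg₁ k H) (leg₂ k H)) (leg₃ k H)
    A.counit.toLinearMap hr, A.contractL_comul] at h1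
  refine Eq.trans ?_ (h1.symm.trans ?_)
  · rw [hT, A.conv_apply (leg₁ k H), QuasiBialgebra.phi, pTau]
    generalize (A.Φ : H ⊗[k] (H ⊗[k] H)) = W
    generalize A.comul h = D
    induction D using TensorProduct.induction_on with
    | zero => simp
    | add x y hx hy => rw [map_add, map_add, add_mul, map_add, hx, hy]
    | tmul a b =>
      rw [joint_tmul, joint_tmul, mulAfter_apply, sTau, LinearMap.comp_apply, tau,
        A.conv_apply, A.conv_apply]
      generalize A.comul b = E
      induction W using tensor₃_induction with
      | add x y hx hy => simp only [map_add, mul_add, add_mul, hx, hy]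
      | tmul x y z =>
        induction E using TensorProduct.induction_on with
        | zero => simp
        | add x y hx hy => simp only [map_add, mul_add, add_mul, hx, hy]
        | tmul p q =>
          simp [A.S_mul, mul_assoc, mul_algebraMap_eq_smul, smul_smul,
            mul_comm]
  · rw [hT, QuasiBialgebra.phi, pTau]
    generalize (A.Φ : H ⊗[k] (H ⊗[k] H)) = W
    induction W using tensor₃_induction with
    | add x y hx hy => simp only [map_add, add_mul, hx, hy, smul_add]
    | tmul x y z =>
      simp [A.S_mul, mul_assoc, mul_algebraMap_eq_smul, smul_smul,
            mul_comm]

/-- `S(x¹) α x² p' s'(x³) = 1`. -/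
theorem phiInv_pTau : joint (mulAfter A.S A.α) (joint (mulAfter LinearMap.id (A.pTau χ))
    (A.sTau χ)) (↑A.Φ⁻¹ : H ⊗[k] (H ⊗[k] H)) = 1 := by
  have hl := A.quad_conv_left₁₂ A.S LinearMap.id A.S (scalarMap H (A.charS χ)) A.α A.β 1
    A.isAntipode.left
  have hr := A.quad_conv_right₂₃ A.S LinearMap.id A.S (scalarMap H (A.charS χ)) A.α A.β 1
    A.isAntipode.right
  obtain ⟨T, hT⟩ : ∃ T, T = quad A.S A.α LinearMap.id A.β A.S 1 (scalarMap H (A.charS χ)) :=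
    ⟨_, rfl⟩
  rw [← hT] at hl hr
  have h1 := congrArg T (A.pentagon_phiInv_mul_phi' (leg₁ k H) (leg₂ k H) (leg₃ k H) (leg₄ k H))
  rw [A.phi_left_fst T (leg₃ k H) (leg₄ k H) _ _ hl,
    A.phiInv_right_snd T (leg₁ k H) (leg₄ k H) _ _ hr] at h1
  have h2 : T (A.phiInv (leg₁ k H) (leg₂ k H) (leg₃ k H)) = 1 := by
    rw [hT, QuasiBialgebra.phiInv, quad_leg₁₂₃, A.isAntipode.phiInv, IsMulMap.map_one]
    simp
  rw [h2] at h1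
  rw [← h1, hT, QuasiBialgebra.phi, QuasiBialgebra.phiInv, pTau]
  generalize (A.Φ : H ⊗[k] (H ⊗[k] H)) = W
  generalize (↑A.Φ⁻¹ : H ⊗[k] (H ⊗[k] H)) = V
  induction V using tensor₃_induction with
  | add x y hx hy => simp only [map_add, add_mul, hx, hy]
  | tmul u v w =>
    rw [joint_tmul, joint_tmul, joint_tmul, joint_tmul, mulAfter_apply, mulAfter_apply, sTau,
      LinearMap.comp_apply, tau, A.conv_apply, A.conv_apply]
    generalize A.comul w = E
    induction W using tensor₃_induction with
    | add x y hx hy => simp only [map_add, mul_add, add_mul, hx, hy]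
    | tmul x y z =>
      induction E using TensorProduct.induction_on with
      | zero => simp
      | add x y hx hy => simp only [map_add, mul_add, add_mul, hx, hy]
      | tmul p q =>
        simp [A.S_mul, mul_assoc, mul_algebraMap_eq_smul, smul_smul,
            mul_comm]

/-- The scalar `χ(S(x¹)) χ(x²) χ(S(x³))` is inverse to `χ(α) χ(β)`. -/
theorem char_mul_phiInv : (χ A.α * χ A.β) • A.phiInv (scalarMap H (A.charS χ)) (scalarMap H χ)
    (scalarMap H (A.charS χ)) = 1 := by
  have h := congrArg (algebraMap k H) (congrArg χ A.isAntipode.phiInv)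
  rw [map_one, map_one] at h
  rw [← h, QuasiBialgebra.phiInv]
  generalize (↑A.Φ⁻¹ : H ⊗[k] (H ⊗[k] H)) = V
  induction V using tensor₃_induction with
  | add x y hx hy => simp only [map_add, smul_add, hx, hy]
  | tmul u v w =>
    simp only [joint_tmul, mulAfter_apply, scalarMap_apply, charS_apply, LinearMap.id_apply,
      ← map_mul, Algebra.smul_def]
    congr 1
    simp only [map_mul]
    ring

/-- The pentagon for (id, χ∘S, χ, χ∘S): two of its factors contain a counit, because χ∘S and χ are
convolution inverse. -/
theorem rho_mul_phiInv : A.rho χ * A.phiInv (A.tau χ) (scalarMap H χ) (scalarMap H (A.charS χ)) =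
    A.phiInv (scalarMap H (A.charS χ)) (scalarMap H χ) (scalarMap H (A.charS χ)) := by
  have := A.pentagon_elemA LinearMap.id (scalarMap H (A.charS χ)) (scalarMap H χ)
    (scalarMap H (A.charS χ))
  rwa [conv_charS_char, conv_char_charS, A.phiInv_counit_mid, A.phi_counit_last, one_mul,
    mul_one] at this

/-- `s¹ ⊗ s² ⊗ s³ ⊗ s⁴ ↦ s'(s¹) S(ρ) χ(s²) α s³ p' s'(s⁴)`. -/
def twistChain : Four k H →ₗ[k] H :=
  quad (A.sTau χ) (A.S (A.rho χ)) (scalarMap H χ) A.α LinearMap.id (A.pTau χ) (A.sTau χ)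

theorem quad_sTau_left (m : H) (l l' : H →ₗ[k] H) (m' : H) (h : H) (y : Four k H) :
    quad (A.sTau χ) (A.S (A.rho χ)) (scalarMap H χ) m l m' l'
      (A.conv (leg₁ k H) (leg₂ k H) h * y) =
    quad (A.sTau χ) (A.S (A.rho χ) * A.S h) (scalarMap H χ) m l m' l' y := by
  rw [← S_rho_mul, A.conv_apply]
  generalize A.comul h = D
  induction y using Four.induction with
  | add x y hx hy => simp only [map_add, mul_add, hx, hy]
  | tmul a b c d =>
    induction D using TensorProduct.induction_on with
    | zero => simp
    | add x y hx hy => rw [map_add, map_add, add_mul, map_add, hx, hy]; simp [mul_add, add_mul]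
    | tmul p q => simp [IsAntiMap.map_mul, mul_assoc, mul_algebraMap_eq_smul, algebraMap_mul_eq_smul]

/-- The pentagon replaces three inverse reassociators by two. The left one evaluates to S(ρ) by the
twisted axiom `phiInv_pTau`. In the right one the coproduct on slots 3, 4 contracts to χ∘S, and
`rho_mul_phiInv` combines it with ρ into a scalar. -/
theorem twistChain_phiInv :
    A.twistChain χ (A.phiInv (leg₁ k H) (leg₂ k H) (leg₃ k H) *
      (A.phiInv (leg₁ k H) (A.conv (leg₂ k H) (leg₃ k H)) (leg₄ k H) *
        A.phiInv (leg₂ k H) (leg₃ k H) (leg₄ k H))) =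
      A.S (A.phiInv (scalarMap H (A.charS χ)) (scalarMap H χ) (scalarMap H (A.charS χ))) := by
  rw [A.pentagon_inv]
  have hr (h : H) (y : Four k H) : A.twistChain χ (y * A.conv (leg₃ k H) (leg₄ k H) h) =
      A.charS χ h • A.twistChain χ y := quad_right₃₄ _ _ _ _ _ _ _ (A.pTau_mul χ h) y
  have h1 (y : Four k H) (V : H ⊗[k] H) : A.twistChain χ (y * joint (leg₁ k H) (leg₂ k H) V) =
      joint (A.sTau χ) (scalarMap H χ) V * A.twistChain χ y := by
    rw [twistChain]
    induction y using Four.induction with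
    | add x y hx hy => simp only [map_add, mul_add, add_mul, hx, hy]
    | tmul a b c d =>
      induction V using TensorProduct.induction_on with
      | zero => simp
      | add x y hx hy => simp only [map_add, mul_add, add_mul, hx, hy]
      | tmul p q =>
        simp [IsAntiMap.map_mul, mul_assoc, mul_algebraMap_eq_smul, algebraMap_mul_eq_smul, smul_smul,
          mul_comm]
  have h2 : A.twistChain χ (A.phiInv (A.conv (leg₁ k H) (leg₂ k H)) (leg₃ k H) (leg₄ k H)) =
      A.S (A.rho χ) := by
    rw [← mul_one (A.S _), ← A.phiInv_pTau χ, QuasiBialgebra.phiInv]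
    generalize (↑A.Φ⁻¹ : H ⊗[k] (H ⊗[k] H)) = V
    induction V using tensor₃_induction with
    | add x y hx hy => simp only [map_add, mul_add, hx, hy]
    | tmul u v w =>
      rw [joint_tmul, twistChain, quad_sTau_left]
      simp [mul_assoc, IsAntiMap.map_one]
  have h3 (y : Four k H) := absorb_right_trd (A.twistChain χ) (leg₁ k H)
    (A.conv (leg₃ k H) (leg₄ k H)) (leg₂ k H) (A.charS χ).toLinearMap hr
    (↑A.Φ⁻¹ : H ⊗[k] (H ⊗[k] H)) y
  rw [QuasiBialgebra.phiInv] at h2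
  rw [QuasiBialgebra.phiInv, QuasiBialgebra.phiInv, h3, h1, h2,
    ← rho_mul_phiInv, A.S_mul, QuasiBialgebra.phiInv, joint_scalarMap_last]
  congr 1
  obtain ⟨V, hV⟩ : ∃ V : H ⊗[k] H, V = TensorProduct.map LinearMap.id
    (contractR (A.charS χ).toLinearMap) (↑A.Φ⁻¹ : H ⊗[k] (H ⊗[k] H)) := ⟨_, rfl⟩
  rw [← hV]
  clear hV
  induction V using TensorProduct.induction_on with
  | zero => simp
  | add x y hx hy => simp only [map_add, hx, hy]
  | tmul p q => simp [sTau, mul_algebraMap_eq_smul]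

end QuasiHopfAlgebra


/-! ### The Drinfeld twist contracted with a character. -/

namespace QuasiHopfAlgebra

variable {k H : Type*} [Field k] [Ring H] [Algebra k H] (A : QuasiHopfAlgebra k H)

@[simp] theorem SSop_tmul (a b : H) : A.SSop (a ⊗ₜ b) = A.S b ⊗ₜ A.S a := rfl

@[simp] theorem assocInvHom_tmul (a b c : H) :
    assocInvHom (k := k) H H H (a ⊗ₜ (b ⊗ₜ c)) = (a ⊗ₜ b) ⊗ₜ c := rfl

theorem contractL_SSop (χ : H →ₐ[k] k) (W : H ⊗[k] H) : contractL χ.toLinearMap (A.SSop W) =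
    A.S (contractR (A.charS χ).toLinearMap W) := by
  induction W using TensorProduct.induction_on with
  | zero => simp
  | add x y hx hy => simp only [map_add, hx, hy]
  | tmul a b => simp

theorem map_place12_eq (W : H ⊗[k] (H ⊗[k] H)) :
    (Algebra.TensorProduct.map (AlgHom.id k H) place12 W : Four k H) =
      joint (leg₁ k H) (joint (leg₂ k H) (leg₃ k H)) W := by
  induction W using tensor₃_induction with
  | add x y hx hy => rw [map_add, map_add]; exact congrArg₂ (· + ·) hx hy
  | tmul a b c => simp [place12]; rfl

theorem comulFirst_eq (W : H ⊗[k] (H ⊗[k] H)) :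
    (A.comulFirst W : Four k H) =
      joint (A.conv (leg₁ k H) (leg₂ k H)) (joint (leg₃ k H) (leg₄ k H)) W := by
  induction W using tensor₃_induction with
  | add x y hx hy => rw [map_add, map_add]; exact congrArg₂ (· + ·) hx hy
  | tmul a b c =>
    rw [joint_tmul, A.conv_apply, comulFirst, AlgHom.comp_apply, Algebra.TensorProduct.map_tmul]
    generalize A.comul a = D
    induction D using TensorProduct.induction_on with
    | zero => rw [map_zero, zero_mul, TensorProduct.zero_tmul, map_zero]; rfl
    | add x y hx hy =>
      rw [map_add, add_mul, TensorProduct.add_tmul, map_add]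
      exact congrArg₂ (· + ·) hx hy
    | tmul p q => simp; rfl

theorem elemA_eq : (A.elemA : Four k H) = A.phi (leg₁ k H) (leg₂ k H) (leg₃ k H) *
    A.phiInv (A.conv (leg₁ k H) (leg₂ k H)) (leg₃ k H) (leg₄ k H) :=
  congrArg₂ (fun x y : Four k H => x * y) (map_place12_eq _) (A.comulFirst_eq _)

theorem elemB_eq : (A.elemB : Four k H) =
    A.phi (A.conv (leg₁ k H) (leg₂ k H)) (leg₃ k H) (leg₄ k H) *
      A.phiInv (leg₁ k H) (leg₂ k H) (leg₃ k H) :=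
  congrArg₂ (fun x y : Four k H => x * y) (A.comulFirst_eq _) (map_place12_eq _)

variable (χ : H →ₐ[k] k)

theorem contractL_γ_eq_quad : contractL χ.toLinearMap A.γ = χ A.α •
    quad A.S 1 (scalarMap H (A.charS χ)) 1 (scalarMap H χ) A.α LinearMap.id (A.elemA : Four k H) := by
  rw [γ]
  obtain ⟨W, hW⟩ : ∃ W : Four k H, W = A.elemA := ⟨_, rfl⟩
  rw [← hW]
  clear hW
  induction W using Four.induction with
  | add x y hx hy =>
    rw [map_add, smul_add, ← hx, ← hy, ← map_add, ← map_add, ← map_add]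
    congr 3
    exact map_add _ _ _
  | tmul a b c d =>
    rw [quad_tmul, Four.tmul]
    simp [assocInvHom, algebraMap_mul_eq_smul, smul_smul, mul_assoc]
    congr 1
    ring

theorem contractL_δ_eq_quad : contractL χ.toLinearMap A.δ = χ A.β •
    quad (scalarMap H χ) 1 LinearMap.id A.β A.S 1 (scalarMap H (A.charS χ))
      (A.elemB : Four k H) := by
  rw [δ]
  obtain ⟨W, hW⟩ : ∃ W : Four k H, W = A.elemB := ⟨_, rfl⟩
  rw [← hW]
  clear hW
  induction W using Four.induction with
  | add x y hx hy =>
    rw [map_add, smul_add, ← hx, ← hy, ← map_add, ← map_add, ← map_add]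
    congr 3
    exact map_add _ _ _
  | tmul a b c d =>
    rw [quad_tmul, Four.tmul]
    simp [assocInvHom, mul_algebraMap_eq_smul, algebraMap_mul_eq_smul, smul_smul, mul_assoc]
    congr 1
    ring

/-- `χ(γ¹) γ²`. -/
theorem contractL_γ : contractL χ.toLinearMap A.γ = χ A.α •
    quad (A.sTau χ) (A.S (A.rho χ)) (scalarMap H χ) A.α LinearMap.id 1 (scalarMap H A.counit)
      (A.phiInv (leg₁ k H) (leg₂ k H) (leg₃ k H)) := by
  rw [contractL_γ_eq_quad, elemA_eq]
  congr 1
  rw [QuasiBialgebra.phiInv, QuasiBialgebra.phiInv, QuasiBialgebra.phi, rho, QuasiBialgebra.phi]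
  generalize (A.Φ : H ⊗[k] (H ⊗[k] H)) = W
  generalize (↑A.Φ⁻¹ : H ⊗[k] (H ⊗[k] H)) = V
  induction V using tensor₃_induction with
  | add x y hx hy => simp only [map_add, mul_add, hx, hy]
  | tmul u v w =>
    rw [quad_leg₁₂₃, joint_tmul, joint_tmul, joint_tmul, joint_tmul, mulAfter_apply, sTau,
      LinearMap.comp_apply, tau, A.conv_apply, A.conv_apply]
    generalize A.comul u = E
    induction W using tensor₃_induction with
    | add x y hx hy => simp only [map_add, mul_add, add_mul, hx, hy]
    | tmul x y z =>
      induction E using TensorProduct.induction_on with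
      | zero => simp
      | add x y hx hy => simp only [map_add, mul_add, add_mul, hx, hy]
      | tmul p q =>
        simp [A.S_mul, mul_assoc, mul_algebraMap_eq_smul, algebraMap_mul_eq_smul, smul_smul]

/-- `χ(δ¹) δ²`. -/
theorem contractL_δ : contractL χ.toLinearMap A.δ = χ A.β •
    joint (scalarMap H χ) (joint (mulAfter LinearMap.id (A.pTau χ)) (A.sTau χ))
      (↑A.Φ⁻¹ : H ⊗[k] (H ⊗[k] H)) := by
  rw [contractL_δ_eq_quad, elemB_eq, A.pentagon_elemB]
  congr 1
  have hr := A.quad_conv_right₂₃ (scalarMap H χ) LinearMap.id A.S (scalarMap H (A.charS χ))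
    1 A.β 1 A.isAntipode.right
  obtain ⟨T, hT⟩ : ∃ T, T = quad (scalarMap H χ) 1 LinearMap.id A.β A.S 1
    (scalarMap H (A.charS χ)) := ⟨_, rfl⟩
  rw [← hT] at hr ⊢
  rw [← mul_assoc, A.phi_right_snd T (leg₁ k H) (leg₄ k H) _ _ hr, hT, QuasiBialgebra.phiInv,
    QuasiBialgebra.phi, pTau]
  generalize (A.Φ : H ⊗[k] (H ⊗[k] H)) = W
  generalize (↑A.Φ⁻¹ : H ⊗[k] (H ⊗[k] H)) = V
  induction V using tensor₃_induction with
  | add x y hx hy => simp only [map_add, add_mul, hx, hy]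
  | tmul u v w =>
    rw [joint_tmul, joint_tmul, joint_tmul, joint_tmul, mulAfter_apply, sTau,
      LinearMap.comp_apply, tau, A.conv_apply, A.conv_apply]
    generalize A.comul w = E
    induction W using tensor₃_induction with
    | add x y hx hy => simp only [map_add, mul_add, add_mul, hx, hy]
    | tmul x y z =>
      induction E using TensorProduct.induction_on with
      | zero => simp
      | add x y hx hy => simp only [map_add, mul_add, add_mul, hx, hy]
      | tmul p q =>
        simp [A.S_mul, mul_assoc, mul_algebraMap_eq_smul, algebraMap_mul_eq_smul, smul_smul,
          mul_comm]

/-- The coproduct on slots 1, 2 leaves S(h₁) after S(ρ), which meets α and the h₂ of slot 3 as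
S(h₁)αh₂ = ε(h)α. -/
theorem quad_sTau_left₁₂₃ (h : H) (y : Four k H) :
    quad (A.sTau χ) (A.S (A.rho χ)) (scalarMap H χ) A.α LinearMap.id 1 (scalarMap H A.counit)
      (A.conv (A.conv (leg₁ k H) (leg₂ k H)) (leg₃ k H) h * y) =
    A.counit h • quad (A.sTau χ) (A.S (A.rho χ)) (scalarMap H χ) A.α LinearMap.id 1
      (scalarMap H A.counit) y := by
  trans quad (A.sTau χ) (A.S (A.rho χ)) (scalarMap H χ)
    (joint (mulAfter A.S A.α) LinearMap.id (A.comul h)) LinearMap.id 1 (scalarMap H A.counit) y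
  · rw [A.conv_apply (A.conv _ _)]
    generalize A.comul h = D
    induction D using TensorProduct.induction_on with
    | zero =>
      simp only [map_zero, zero_mul]
      induction y using Four.induction with
      | add x y hx hy => rw [map_add, ← hx, ← hy, add_zero]
      | tmul a b c d => simp
    | add x z hx hz =>
      rw [map_add, map_add, add_mul, map_add, hx, hz]
      clear hx hz
      induction y using Four.induction with
      | add x y hx hy => simp only [map_add, ← hx, ← hy]; abel
      | tmul a b c d => simp [mul_add, add_mul]
    | tmul p q =>
      rw [joint_tmul, mul_assoc, quad_sTau_left]
      induction y using Four.induction with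
      | add x y hx hy => simp only [map_add, mul_add, hx, hy]
      | tmul a b c d =>
        simp [mul_assoc, mul_algebraMap_eq_smul, algebraMap_mul_eq_smul]
  · rw [A.isAntipode.left]
    induction y using Four.induction with
    | add x y hx hy => simp only [map_add, smul_add, hx, hy]
    | tmul a b c d => simp

/-- Exactly the hypothesis under which χ(γ¹)γ² may play the role of a' in `cotransfer`, for the
algebra map h ↦ h ↼ χ. -/
theorem sTau_contractL_γ (h : H) :
    joint (mulAfter (A.sTau χ) (contractL χ.toLinearMap A.γ)) (A.harpoon χ.toLinearMap)
      (A.comul h) = A.counit h • contractL χ.toLinearMap A.γ := by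
  rw [contractL_γ]
  obtain ⟨y, hy⟩ : ∃ y : Four k H, y = A.phiInv (leg₁ k H) (leg₂ k H) (leg₃ k H) := ⟨_, rfl⟩
  have h1 := A.quad_sTau_left₁₂₃ χ h y
  rw [hy, A.conv_mul_phiInv, ← hy] at h1
  rw [← hy, smul_comm, ← h1, A.conv_apply]
  clear h1 hy
  generalize A.comul h = D
  induction D using TensorProduct.induction_on with
  | zero => simp
  | add x z hx hz => simp only [map_add, mul_add, smul_add, hx, hz]
  | tmul p q =>
    rw [joint_tmul, joint_tmul, harpoon_eq, A.conv_apply, mulAfter_apply]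
    generalize A.comul q = E
    induction y using Four.induction with
    | add x y hx hy => simp only [map_add, mul_add, add_mul, smul_add, hx, hy]
    | tmul a b c d =>
      induction E using TensorProduct.induction_on with
      | zero => simp
      | add x y hx hy => simp only [map_add, mul_add, smul_add, hx, hy]
      | tmul r s =>
        simp [mul_assoc, mul_algebraMap_eq_smul, algebraMap_mul_eq_smul, smul_smul,
          IsAntiMap.map_mul]
        ring_nf

/-- Recognising χ(f¹)f² as a `cotransfer` yields its intertwining property and its product with α ↼
χ without any computation with f itself. -/
theorem contractL_f : contractL χ.toLinearMap A.f =
    A.cotransfer (A.sTau χ) (contractL χ.toLinearMap A.γ) (A.harpoon χ.toLinearMap)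
      (A.harpoon χ.toLinearMap A.β) (A.harpoon χ.toLinearMap ∘ₗ A.S) := by
  rw [f, QuasiBialgebra.cotransfer]
  generalize (↑A.Φ⁻¹ : H ⊗[k] (H ⊗[k] H)) = V
  induction V using tensor₃_induction with
  | add x y hx hy => simp only [map_add, hx, hy]
  | tmul u v w =>
    simp only [TensorProduct.map_tmul, LinearMap.mul'_apply, LinearMap.comp_apply,
      LinearMap.mulRight_apply, contractL_mul, contractL_SSop, coevMap_tmul, joint_tmul,
      mulAfter_apply, AlgHom.toLinearMap_apply, map_mul, harpoon_eq, sTau, tau_apply, mul_assoc]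

theorem contractL_fInv : contractL χ.toLinearMap A.fInv =
    joint (mulAfter (A.harpoon χ.toLinearMap ∘ₗ A.S) (A.harpoon χ.toLinearMap A.α))
      (joint (mulAfter (A.harpoon χ.toLinearMap) (contractL χ.toLinearMap A.δ)) (A.sTau χ))
      (↑A.Φ⁻¹ : H ⊗[k] (H ⊗[k] H)) := by
  rw [fInv]
  generalize (↑A.Φ⁻¹ : H ⊗[k] (H ⊗[k] H)) = V
  induction V using tensor₃_induction with
  | add x y hx hy => simp only [map_add, hx, hy]
  | tmul u v w =>
    simp only [assocInvHom_tmul, TensorProduct.map_tmul, LinearMap.mul'_apply, LinearMap.comp_apply,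
      LinearMap.mulRight_apply, contractL_mul, contractL_SSop, evMap_tmul, joint_tmul,
      mulAfter_apply, AlgHom.toLinearMap_apply, map_mul, harpoon_eq, sTau, tau_apply, mul_assoc]

/-- The Drinfeld twist and its inverse stay inverse to each other after applying an algebra map to
the first tensor factor. -/
theorem contractL_f_mul_contractL_fInv :
    contractL χ.toLinearMap A.f * contractL χ.toLinearMap A.fInv = 1 := by
  have hA := A.isAntipode.map A.toQuasiBialgebra (A.harpoon χ.toLinearMap)
  rw [LinearMap.comp_id] at hA
  have : IsAntiMap (A.harpoon χ.toLinearMap ∘ₗ A.S) := IsMulMap.comp_anti _ _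
  have h1 := A.cotransfer_intertwines (A.sTau χ) _ hA (A.sTau_contractL_γ χ)
  have h2 := A.cotransfer_mul (A.sTau χ) _ hA (A.sTau_contractL_γ χ)
  rw [contractL_f, contractL_fInv]
  -- χ(f¹)f² passes the values S(x¹) ↼ χ and turns α ↼ χ into χ(γ¹)γ².
  trans joint (mulAfter (A.sTau χ) (contractL χ.toLinearMap A.γ))
      (joint (mulAfter (A.harpoon χ.toLinearMap) (contractL χ.toLinearMap A.δ)) (A.sTau χ))
      (↑A.Φ⁻¹ : H ⊗[k] (H ⊗[k] H))
  · obtain ⟨F, hF⟩ : ∃ F, F = A.cotransfer (A.sTau χ) (contractL χ.toLinearMap A.γ)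
      (A.harpoon χ.toLinearMap) (A.harpoon χ.toLinearMap A.β) (A.harpoon χ.toLinearMap ∘ₗ A.S) :=
      ⟨_, rfl⟩
    rw [← hF] at h1 h2 ⊢
    generalize (↑A.Φ⁻¹ : H ⊗[k] (H ⊗[k] H)) = V
    induction V using tensor₃_induction with
    | add x y hx hy => simp only [map_add, mul_add, hx, hy]
    | tmul u v w =>
      simp only [joint_tmul, mulAfter_apply]
      rw [← h2, ← mul_assoc (A.sTau χ u), ← h1]
      simp only [mul_assoc]
  · have h3 := congrArg A.S (A.char_mul_phiInv χ)
    rw [map_smul, A.S_one, ← twistChain_phiInv] at h3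
    rw [← h3, contractL_γ, contractL_δ, QuasiBialgebra.phiInv, QuasiBialgebra.phiInv,
      QuasiBialgebra.phiInv, twistChain]
    generalize hV : (↑A.Φ⁻¹ : H ⊗[k] (H ⊗[k] H)) = V
    -- The three occurrences of Φ⁻¹ get separate names, so that each can be expanded linearly on its
    -- own.
    obtain ⟨V₁, hV₁⟩ : ∃ V₁, V₁ = V := ⟨_, rfl⟩
    obtain ⟨V₂, hV₂⟩ : ∃ V₂, V₂ = V := ⟨_, rfl⟩
    trans joint (mulAfter (A.sTau χ) (χ A.α • quad (A.sTau χ) (A.S (A.rho χ)) (scalarMap H χ) A.α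
        LinearMap.id 1 (scalarMap H A.counit)
        (joint (leg₁ k H) (joint (leg₂ k H) (leg₃ k H)) V₁)))
      (joint (mulAfter (A.harpoon χ.toLinearMap) (χ A.β • joint (scalarMap H χ)
        (joint (mulAfter LinearMap.id (A.pTau χ)) (A.sTau χ)) V₂)) (A.sTau χ)) V
    · rw [hV₁, hV₂]
    -- This is the product in `twistChain_phiInv`, a scalar which `char_mul_phiInv` shows to be
    -- inverse to χ(α)χ(β).
    trans (χ A.α * χ A.β) • quad (A.sTau χ) (A.S (A.rho χ)) (scalarMap H χ) A.α LinearMap.id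
      (A.pTau χ) (A.sTau χ) (joint (leg₁ k H) (joint (leg₂ k H) (leg₃ k H)) V₁ *
        (joint (leg₁ k H) (joint (A.conv (leg₂ k H) (leg₃ k H)) (leg₄ k H)) V *
          joint (leg₂ k H) (joint (leg₃ k H) (leg₄ k H)) V₂))
    · clear h3 hV hV₁ hV₂
      induction V using tensor₃_induction with
      | add x y hx hy => simp only [map_add, mul_add, add_mul, smul_add, hx, hy]
      | tmul u v w =>
        simp only [joint_tmul, mulAfter_apply, harpoon_eq, A.conv_apply]
        generalize A.comul v = E
        induction V₁ using tensor₃_induction with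
        | add x y hx hy => simp only [map_add, mul_add, add_mul, smul_add, hx, hy]
        | tmul a b c =>
          induction V₂ using tensor₃_induction with
          | add x y hx hy => simp only [map_add, mul_add, add_mul, smul_add, hx, hy]
          | tmul x y z =>
            induction E using TensorProduct.induction_on with
            | zero => simp
            | add x y hx hy => simp only [map_add, mul_add, add_mul, smul_add, hx, hy]
            | tmul p q =>
              simp [mul_assoc, mul_algebraMap_eq_smul, algebraMap_mul_eq_smul, smul_smul,
                IsAntiMap.map_mul]
              congr 1
              ring
    · rw [hV₁, hV₂]

end QuasiHopfAlgebra


/-! ### The map 𝒬 at a character, and unimodularity. -/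

namespace QuasiHopfAlgebra

variable {k H : Type*} [Field k] [Ring H] [Algebra k H] (A : QuasiHopfAlgebra k H)

theorem contractR_mul {P Q : Type*} [Ring P] [Algebra k P] [Ring Q] [Algebra k Q] (χ : Q →ₐ[k] k)
    (V W : P ⊗[k] Q) : contractR χ.toLinearMap (V * W) =
      contractR χ.toLinearMap V * contractR χ.toLinearMap W := by
  have := IsMulMap.map_mul (f := joint (LinearMap.id : P →ₗ[k] P) (scalarMap P χ)) V W
  rwa [joint_scalarMap_right, joint_scalarMap_right, joint_scalarMap_right] at this

theorem contractR_flip (χ : H →ₗ[k] k) (W : H ⊗[k] H) :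
    contractR χ (flip₂ W) = contractL χ W := by
  induction W using TensorProduct.induction_on with
  | zero => simp
  | add x y hx hy => simp only [map_add, hx, hy]
  | tmul a b => simp

theorem contractR_SS (χ : H →ₐ[k] k) (W : H ⊗[k] H) : contractR χ.toLinearMap (A.SS W) =
    A.S (contractR (A.charS χ).toLinearMap W) := by
  induction W using TensorProduct.induction_on with
  | zero => simp
  | add x y hx hy => simp only [map_add, hx, hy]
  | tmul a b => simp [SS]

variable [FiniteDimensional k H] (χ : H →ₐ[k] k)

theorem contractR_qR : contractR (A.charS χ).toLinearMap A.qR = χ A.α • A.rho χ := by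
  rw [qR, rho, QuasiBialgebra.phi]
  generalize (A.Φ : H ⊗[k] (H ⊗[k] H)) = W
  induction W using tensor₃_induction with
  | add x y hx hy => simp only [map_add, smul_add, hx, hy]
  | tmul x y z =>
    simp [S_Sinv, A.S_mul, mul_algebraMap_eq_smul, smul_smul]
    congr 1
    ring

theorem S_contractR_pL : A.S (contractR (A.charS χ).toLinearMap A.pL) = A.pTau χ := by
  rw [pL, pTau]
  generalize (A.Φ : H ⊗[k] (H ⊗[k] H)) = W
  induction W using tensor₃_induction with
  | add x y hx hy => simp only [map_add, hx, hy]
  | tmul x y z =>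
    simp [S_Sinv, A.S_mul, mul_algebraMap_eq_smul]

omit [FiniteDimensional k H] in
/-- `X¹ p' s'(X²) S(ρ) χ(X³) = β`. -/
theorem phi_pTau : joint (mulAfter LinearMap.id (A.pTau χ))
    (joint (mulAfter (A.sTau χ) (A.S (A.rho χ))) (scalarMap H χ)) (A.Φ : H ⊗[k] (H ⊗[k] H)) =
      A.β := by
  have hr := A.quad_conv_right₁₂ LinearMap.id A.S (scalarMap H (A.charS χ)) (scalarMap H χ)
    A.β 1 1 A.isAntipode.right
  obtain ⟨T, hT⟩ : ∃ T, T = quad LinearMap.id A.β A.S 1 (scalarMap H (A.charS χ)) 1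
    (scalarMap H χ) := ⟨_, rfl⟩
  -- The chain absorbs coproducts on slots 3, 4 because χ∘S and χ convolve to ε.
  have hl : ∀ (h : H) (y : Four k H), T (A.conv (leg₃ k H) (leg₄ k H) h * y) =
      A.counit h • T y := by
    intro h y
    have h1 := congrArg (fun f : H →ₗ[k] H => f h) (A.conv_charS_char χ H)
    rw [← algebraMap_mul_eq_smul (T y), ← scalarMap_apply (B := H), ← h1, A.conv_apply,
      A.conv_apply, hT]
    generalize A.comul h = D
    induction y using Four.induction with
    | add x y hx hy => simp only [map_add, mul_add, hx, hy]
    | tmul a b c d =>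
      induction D using TensorProduct.induction_on with
      | zero => simp
      | add x y hx hy => simp only [map_add, add_mul, hx, hy]
      | tmul p q =>
        simp [A.S_mul, mul_algebraMap_eq_smul, algebraMap_mul_eq_smul, smul_smul]
        congr 1
        ring
  rw [← hT] at hr
  have h1 := congrArg T (A.pentagon (leg₁ k H) (leg₂ k H) (leg₃ k H) (leg₄ k H))
  have h2 := A.phi_right_fst T (leg₃ k H) (leg₄ k H) _ 1 hr
  have h3 : T 1 = A.β := by
    rw [hT, ← IsMulMap.map_one (f := leg₁ k H), leg₁_apply, quad_tmul]
    simp [A.S_one]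
  rw [A.phi_left_trd T (leg₁ k H) (leg₂ k H) _ _ hl, ← one_mul (A.phi (A.conv _ _) _ _), h2, h3]
    at h1
  rw [← h1, hT, pTau, rho, QuasiBialgebra.phi, QuasiBialgebra.phi, QuasiBialgebra.phi,
    QuasiBialgebra.phi]
  obtain ⟨W, hW⟩ : ∃ W, W = (A.Φ : H ⊗[k] (H ⊗[k] H)) := ⟨_, rfl⟩
  obtain ⟨W₁, hW₁⟩ : ∃ W₁, W₁ = (A.Φ : H ⊗[k] (H ⊗[k] H)) := ⟨_, rfl⟩
  obtain ⟨W₂, hW₂⟩ : ∃ W₂, W₂ = (A.Φ : H ⊗[k] (H ⊗[k] H)) := ⟨_, rfl⟩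
  trans joint (mulAfter LinearMap.id (joint (mulAfter LinearMap.id A.β)
      (joint A.S (scalarMap H (A.charS χ))) W₁)) (joint (mulAfter (A.sTau χ)
      (A.S (joint LinearMap.id (joint (scalarMap H (A.charS χ)) (scalarMap H χ)) W₂)))
      (scalarMap H χ)) W
  · rw [hW, hW₁, hW₂]
  trans quad LinearMap.id A.β A.S 1 (scalarMap H (A.charS χ)) 1 (scalarMap H χ)
    (joint (leg₂ k H) (joint (leg₃ k H) (leg₄ k H)) W₂ *
      (joint (leg₁ k H) (joint (A.conv (leg₂ k H) (leg₃ k H)) (leg₄ k H)) W *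
        joint (leg₁ k H) (joint (leg₂ k H) (leg₃ k H)) W₁))
  · clear h1 h2 h3 hl hr hT hW hW₁ hW₂
    induction W using tensor₃_induction with
    | add x y hx hy => simp only [map_add, mul_add, add_mul, hx, hy]
    | tmul u v w =>
      simp only [joint_tmul, mulAfter_apply, A.conv_apply, sTau, LinearMap.comp_apply, tau]
      generalize A.comul v = E
      induction W₁ using tensor₃_induction with
      | add x y hx hy => simp only [map_add, mul_add, add_mul, hx, hy]
      | tmul a b c =>
        induction W₂ using tensor₃_induction with
        | add x y hx hy => simp only [map_add, mul_add, add_mul, hx, hy]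
        | tmul x y z =>
          induction E using TensorProduct.induction_on with
          | zero => simp
          | add x y hx hy => simp only [map_add, mul_add, add_mul, hx, hy]
          | tmul p q =>
            simp [A.S_mul, mul_assoc, mul_algebraMap_eq_smul, smul_smul]
  · rw [hW, hW₁, hW₂]

/-- Contraction with a character is multiplicative. With the monodromy contracted to 1, f meets f⁻¹
and cancels, q_R contributes χ(α)S(ρ), p_L contributes p' = `pTau`, and `phi_pTau` collapses the
rest to β. -/
theorem QMap_char (R : H ⊗[k] H) (h : contractL χ.toLinearMap (monodromy R) = 1) :
    A.QMap R χ.toLinearMap = χ A.α • A.β := by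
  have hM : contractR χ.toLinearMap (flip₂ A.f * R * flip₂ R * flip₂ A.U) =
      χ A.α • A.S (A.rho χ) := by
    have : flip₂ A.f * R * flip₂ R * flip₂ A.U =
        flip₂ (A.f * monodromy R * (A.fInv * A.SSop A.qR)) := by
      simp only [map_mul, monodromy, flip₂_flip₂, U, mul_assoc]
    rw [this, contractR_flip, contractL_mul, contractL_mul, contractL_mul, h, mul_one,
      ← mul_assoc, contractL_f_mul_contractL_fInv, one_mul, contractL_SSop, contractR_qR, map_smul]
  rw [← A.phi_pTau χ]
  change contractR χ.toLinearMap (A.QElement R) = _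
  rw [QElement]
  obtain ⟨M, hM'⟩ : ∃ M, M = flip₂ A.f * R * flip₂ R * flip₂ A.U := ⟨_, rfl⟩
  rw [← hM'] at hM ⊢
  generalize (A.Φ : H ⊗[k] (H ⊗[k] H)) = W
  induction W using tensor₃_induction with
  | add x y hx hy => simp only [map_add, smul_add, hx, hy]
  | tmul x y z =>
    simp only [TensorProduct.map_tmul, LinearMap.mul'_apply, LinearMap.comp_apply,
      LinearMap.mulRight_apply, contractR_mul, contractR_SS, joint_tmul, hM, A.S_mul,
      S_contractR_pL, mulAfter_apply, AlgHom.toLinearMap_apply, sTau, tau_apply, mul_assoc]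
    simp [mul_algebraMap_eq_smul, smul_smul, mul_comm]

omit [FiniteDimensional k H] in
theorem contractL_counit_monodromy {R : H ⊗[k] H} (hR : A.IsRMatrix R) :
    contractL A.counit.toLinearMap (monodromy R) = 1 := by
  rw [monodromy, contractL_mul, ← contractR_flip, flip₂_flip₂, hR.contractL_eq_one,
    hR.contractR_eq_one, mul_one]

omit [FiniteDimensional k H] in
theorem QMap_sub (R : H ⊗[k] H) (φ ψ : Module.Dual k H) (a b : k) :
    A.QMap R (a • φ - b • ψ) = a • A.QMap R φ - b • A.QMap R ψ := by
  change contractR (a • φ - b • ψ) _ = a • contractR φ _ - b • contractR ψ _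
  generalize A.QElement R = W
  induction W using TensorProduct.induction_on with
  | zero => simp
  | add x y hx hy => simp only [map_add, smul_add, hx, hy]; abel
  | tmul x y => simp [sub_smul, mul_smul]

/-- A factorizable quasi-Hopf algebra is unimodular. -/
theorem IsFactorizable.isUnimodular {R : H ⊗[k] H} (hR : A.IsRMatrix R)
    (h : A.IsFactorizable R) : A.IsUnimodular := by
  have : Nontrivial H := A.counit.toRingHom.domain_nontrivial
  obtain ⟨t, χ, ht0, ht, htχ⟩ := A.exists_char
  have h1 := A.QMap_char χ R (hR.contractL_monodromy_eq_one ht0 ht htχ)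
  have h2 := A.QMap_char A.counit R (A.contractL_counit_monodromy hR)
  -- The combination is chosen to cancel the two multiples of β. Injectivity makes χ and ε
  -- proportional; evaluation at 1 gives ε(α) = χ(α), and ε(α) ≠ 0.
  have h3 : A.QMap R (A.counit A.α • χ.toLinearMap - χ A.α • A.counit.toLinearMap) = A.QMap R 0 := by
    have h0 : A.QMap R 0 = 0 := by simpa using A.QMap_sub R 0 0 0 0
    rw [QMap_sub, h1, h2, h0, smul_comm, sub_self]
  have h4 := h.1 h3
  have h5 := left_ne_zero_of_mul (A.char_α_mul_char_β A.counit)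
  have h6 (x : H) : A.counit A.α * χ x = χ A.α * A.counit x := by
    have := congrArg (fun f : Module.Dual k H => f x) h4
    simpa [sub_eq_zero] using this
  have h7 : A.counit A.α = χ A.α := by simpa using h6 1
  refine ⟨t, ht0, ht, fun x => ?_⟩
  rw [htχ, mul_left_cancel₀ h5 ((h6 x).trans (by rw [h7]))]

end QuasiHopfAlgebra

end QuasiHopf

end

theorem mainTheorem3 {k H : Type*} [Field k] [Ring H] [Algebra k H] [FiniteDimensional k H]
    (A : QuasiHopf.QuasiHopfAlgebra k H) (R : H ⊗[k] H) (hR : A.IsRMatrix R) :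
    Function.Bijective A.S ∧
    (∀ μ : Module.Dual k H, A.IsDistinguishedGrouplike μ →
      ∀ t : H, A.IsLeftIntegral t →
        QuasiHopf.flip₂ (A.qtp t) * (A.twistFactor R μ ⊗ₜ[k] (1 : H)) =
          (A.S (A.drinfeldElement R) ⊗ₜ[k] (1 : H)) * A.qtp t) ∧
    (A.IsFactorizable R → A.IsUnimodular) := by
  exact ⟨A.antipode_bijective,
    fun μ hμ t ht => A.flip_qtp_mul_twistFactor_distinguished hR μ hμ t ht,
    fun h => QuasiHopf.QuasiHopfAlgebra.IsFactorizable.isUnimodular A hR h⟩
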